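/- **Theorem (Elliptic orthogonality).** Fix $q\in\mathbb C$ with $|q|<1$ and let $$\vartheta(x)=(x^{1/2}-x^{-1/2})\prod_{s\ge 1}(1-q^{s}x)(1-q^{s}/x),$$ a function on the double cover of $\mathbb C^*$; $\vartheta'(1)$ is its derivative in $x$ at $x=1$ (on the branch $1^{1/2}=1$). Let $N\ge 1$, $\lambda=(\lambda_1,\dots,\lambda_N)\in\mathbb Z_{\ge 0}^N$, $\lambda^{(k)}=\lambda_1+\dots+\lambda_k$, $n=\lambda^{(N)}$, $\dim_\lambda=\sum_{i<j}\lambda_i\lambda_j$. Let $\mathcal I_\lambda$ be the set of tuples $I=(I_1,\dots,I_N)$ of pairwise disjoint subsets of $\{1,\dots,n\}$ with $|I_j|=\lambda_j$. For $I\in\mathcal I_\lambda$ put $I^{(k)}=I_1\cup\dots\cup I_k=\{i^{(k)}_1<\dots<i^{(k)}_{\lambda^{(k)}}\}$, $p(I,j,i)=|I_j\cap\{1,\dots,i-1\}|$, let $j(I,k,a)$ be the index with $i^{(k)}_a\in I_{j(I,k,a)}$, and $\dim_I=|\bigcup_{j<k}\{(a,b)\in I_j\times I_k: a>b\}|$.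 Consider variables $t^{(k)}_a$ ($1\le k\le N-1$, $1\le a\le\lambda^{(k)}$), $z_1,\dots,z_n$, $\hbar$, $\mu_1,\dots,\mu_N$, and set $t^{(N)}_a=z_a$. With $i=i^{(k)}_a$, $j=j(I,k,a)$ and $y=\frac{\mu_{k+1}}{\mu_{j}}\hbar^{1+p(I,j,i)-p(I,k+1,i)}$ let $$\psi_{I,k,a,b}(x)=\begin{cases}\vartheta(x\hbar)/\vartheta(\hbar)& i^{(k+1)}_b<i^{(k)}_a,\\ \vartheta(xy)/\vartheta(y)& i^{(k+1)}_b=i^{(k)}_a,\\ \vartheta(x)& i^{(k+1)}_b>i^{(k)}_a,\end{cases}$$ $$U_I=\vartheta'(1)^{\dim_I}\prod_{k=1}^{N-1}\Bigl(\prod_{a=1}^{\lambda^{(k)}}\prod_{b=1}^{\lambda^{(k+1)}}\psi_{I,k,a,b}\bigl(t^{(k+1)}_b/t^{(k)}_a\bigr)\prod_{a<b\le\lambda^{(k)}}\frac1{\vartheta(t^{(k)}_b/t^{(k)}_a)}\prod_{b<a\le\lambda^{(k)}}\frac{\vartheta(\hbar)}{\vartheta(\hbar t^{(k)}_b/t^{(k)}_a)}\Bigr).$$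 Let $W^E_I$ be the sum of all functions obtained from $U_I$ by permuting, for each $k=1,\dots,N-1$, the variables $t^{(k)}_1,\dots,t^{(k)}_{\lambda^{(k)}}$ among themselves, over $S_{\lambda^{(1)}}\times\dots\times S_{\lambda^{(N-1)}}$, and for $\sigma\in S_n$ let $W^E_{\sigma,I}=W^E_{\sigma^{-1}(I)}(t,z_{\sigma(1)},\dots,z_{\sigma(n)},\hbar,\mu)$. Let $s_0\in S_n$, $s_0(i)=n+1-i$, and let $\tau$ be the substitution $\mu_i\mapsto\hbar^{\lambda_i}/\mu_i$ for all $i$. Put $$R_I^E=\prod_{k<l}\prod_{a\in I_k}\prod_{b\in I_l}\vartheta(z_b/z_a),\qquad Q_I^E=\prod_{k<l}\prod_{a\in I_k}\prod_{b\in I_l}\vartheta(\hbar z_b/z_a),$$ $$\langle f(t),g(t)\rangle_E=\sum_{K\in\mathcal I_\lambda}\frac{f(z_K)\,g(z_K)}{R_K^E\,Q_K^E},$$ where $f(z_K)$ is the result of substituting $t^{(k)}_a=z_{i^{(k)}_a}$ with $i^{(k)}_a$ the elements of $K^{(k)}$. Then for all $I,J\in\mathcal I_\lambda$ $$\Bigl\langle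 W^E_{\mathrm{id},I},\ \bigl(\vartheta(\hbar)/\vartheta'(1)\bigr)^{\dim_\lambda}\,\tau[W^E_{s_0,J}]\Bigr\rangle_E=\delta_{I,J}.$$ This holds for all nonzero complex values of $z_i,\hbar,\mu_i$ (with square roots of these chosen, and each monomial in them given the corresponding monomial in the chosen roots as its square root) such that none of the following numbers vanishes: $\vartheta(\hbar)$; $\vartheta(z_b/z_a)$ and $\vartheta(\hbar z_b/z_a)$ for $a\neq b$; $\vartheta(\hbar^{e}\mu_k/\mu_j)$ for $j<k$ with $\lambda_j\ne0$ and integers $-\lambda_k\le e\le\lambda_j$. -/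

import Mathlib

open Finset

noncomputable section

namespace EllipticOrth

/-! ### The theta function

The function `ϑ(x) = (x^{1/2} - x^{-1/2}) ∏_{s ≥ 1} (1 - q^s x)(1 - q^s / x)` lives on the double
cover `y ↦ x = y ^ 2` of `ℂ \ {0}`.  We use the coordinate `y = x^{1/2}` on this double cover, so
`theta q y` is `ϑ(y ^ 2)`.  Accordingly every variable `t, z, ħ, μ` below is a nonzero complex
number standing for a chosen square root of the variable; a monomial in the variables is lifted to
the same monomial in the chosen roots, so that all the formulas keep their multiplicative form. -/

/-- `theta q y = ϑ(x)` where `y = x^{1/2}`. -/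
def theta (q y : ℂ) : ℂ :=
  (y - y⁻¹) * ∏' s : ℕ, ((1 - q ^ (s + 1) * y ^ 2) * (1 - q ^ (s + 1) / y ^ 2))

/-- `ϑ'(1)`, the derivative with respect to `x` at `x = 1` of the branch of `ϑ` with `1^{1/2} = 1`. -/
def thetaPrimeOne (q : ℂ) : ℂ :=
  deriv (fun x : ℂ => theta q (x ^ (1 / 2 : ℂ))) 1

/-! ### Combinatorics of the fixed points

The number of parts is `N = m + 1`; the indices `1, …, N` are `Fin (m + 1)`, and the indices
`k = 1, …, N - 1` are `k : Fin m`, for which `k.castSucc` is `k` and `k.succ` is `k + 1`. -/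

variable {m : ℕ}

/-- `λ^{(k)} = λ_1 + ⋯ + λ_k`. -/
def psum (lam : Fin (m + 1) → ℕ) (k : Fin (m + 1)) : ℕ := ∑ i ∈ Iic k, lam i

/-- `n = λ^{(N)}`. -/
abbrev size (lam : Fin (m + 1) → ℕ) : ℕ := psum lam (Fin.last m)

/-- `dim_λ = ∑_{i < j} λ_i λ_j`. -/
def dimLam (lam : Fin (m + 1) → ℕ) : ℕ := ∑ i, ∑ j ∈ Ioi i, lam i * lam j

/-- The set `ℐ_λ` of tuples `I = (I_1, …, I_N)` of pairwise disjoint subsets of `[n]` with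
`|I_j| = λ_j`. -/
abbrev FlagIndex (lam : Fin (m + 1) → ℕ) : Type :=
  {I : Fin (m + 1) → Finset (Fin (size lam)) //
    (∀ j, (I j).card = lam j) ∧ ∀ i j, i ≠ j → Disjoint (I i) (I j)}

variable {lam : Fin (m + 1) → ℕ}

/-- `I^{(k)} = I_1 ∪ ⋯ ∪ I_k`. -/
def FlagIndex.upTo (I : FlagIndex lam) (k : Fin (m + 1)) : Finset (Fin (size lam)) :=
  (Iic k).biUnion I.1

theorem FlagIndex.card_upTo (I : FlagIndex lam) (k : Fin (m + 1)) :
    (I.upTo k).card = psum lam k := by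
  unfold FlagIndex.upTo psum
  rw [card_biUnion (fun i _ j _ hij => I.2.2 i j hij)]
  exact sum_congr rfl (fun j _ => I.2.1 j)

/-- `i^{(k)}_a`, the `a`-th element of `I^{(k)}` in increasing order. -/
def FlagIndex.elt (I : FlagIndex lam) (k : Fin (m + 1)) (a : Fin (psum lam k)) :
    Fin (size lam) :=
  (I.upTo k).orderEmbOfFin (I.card_upTo k) a

theorem FlagIndex.exists_part (I : FlagIndex lam) (k : Fin (m + 1)) (a : Fin (psum lam k)) :
    ∃ j, I.elt k a ∈ I.1 j := by
  have h : I.elt k a ∈ I.upTo k := orderEmbOfFin_mem _ _ _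
  obtain ⟨j, _, hj⟩ := mem_biUnion.1 h
  exact ⟨j, hj⟩

/-- `j(I, k, a)`, the (unique) `j` with `i^{(k)}_a ∈ I_j`. -/
def FlagIndex.part (I : FlagIndex lam) (k : Fin (m + 1)) (a : Fin (psum lam k)) : Fin (m + 1) :=
  (I.exists_part k a).choose

/-- `p(I, j, i) = |I_j ∩ {1, …, i - 1}|`. -/
def FlagIndex.pos (I : FlagIndex lam) (j : Fin (m + 1)) (i : Fin (size lam)) : ℕ :=
  ((I.1 j).filter (· < i)).card

/-- `dim_I = |⋃_{j < k} {(a, b) ∈ I_j × I_k : a > b}|`. -/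
def FlagIndex.dim (I : FlagIndex lam) : ℕ :=
  (univ.filter fun ab : Fin (size lam) × Fin (size lam) =>
    ∃ j k, j < k ∧ ab.1 ∈ I.1 j ∧ ab.2 ∈ I.1 k ∧ ab.2 < ab.1).card

/-- `σ(I) = (σ(I_1), …, σ(I_N))`. -/
def FlagIndex.perm (σ : Equiv.Perm (Fin (size lam))) (I : FlagIndex lam) : FlagIndex lam :=
  ⟨fun j => (I.1 j).map σ.toEmbedding,
    fun j => by rw [card_map]; exact I.2.1 j,
    fun i j hij => (disjoint_map _).2 (I.2.2 i j hij)⟩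

/-! ### Elliptic weight functions -/

/-- Values of the variables `t^{(k)}_a`, `k = 1, …, N - 1`, `a = 1, …, λ^{(k)}`. -/
abbrev TVar (lam : Fin (m + 1) → ℕ) : Type :=
  (k : Fin m) → Fin (psum lam k.castSucc) → ℂ

/-- The variables `t` completed by `t^{(N)}_a = z_a`. -/
def extendZ (t : TVar lam) (z : Fin (size lam) → ℂ) :
    (k : Fin (m + 1)) → Fin (psum lam k) → ℂ :=
  Fin.lastCases (motive := fun k => Fin (psum lam k) → ℂ) z t

/-- Functions of the variables `t, z, ħ, μ`. -/
abbrev WeightFun (lam : Fin (m + 1) → ℕ) : Type :=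
  TVar lam → (Fin (size lam) → ℂ) → ℂ → (Fin (m + 1) → ℂ) → ℂ

/-- The argument `(μ_{k+1} / μ_j) ħ^{1 + p(I, j, i) - p(I, k + 1, i)}`, for `i = i^{(k)}_a` and
`j = j(I, k, a)`. -/
def dynArg (I : FlagIndex lam) (h : ℂ) (μ : Fin (m + 1) → ℂ) (k : Fin m)
    (a : Fin (psum lam k.castSucc)) : ℂ :=
  μ k.succ / μ (I.part k.castSucc a) *
    h ^ (1 + (I.pos (I.part k.castSucc a) (I.elt k.castSucc a) : ℤ)
      - (I.pos k.succ (I.elt k.castSucc a) : ℤ))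

/-- `ψ_{I,k,a,b}(x)`. -/
def psi (q : ℂ) (I : FlagIndex lam) (h : ℂ) (μ : Fin (m + 1) → ℂ) (k : Fin m)
    (a : Fin (psum lam k.castSucc)) (b : Fin (psum lam k.succ)) (x : ℂ) : ℂ :=
  if I.elt k.succ b < I.elt k.castSucc a then
    theta q (x * h) / theta q h
  else if I.elt k.succ b = I.elt k.castSucc a then
    theta q (x * dynArg I h μ k a) / theta q (dynArg I h μ k a)
  else
    theta q x

/-- The function `U_I`. -/
def weightU (q : ℂ) (I : FlagIndex lam) : WeightFun lam := fun t z h μ =>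
  thetaPrimeOne q ^ I.dim *
    ∏ k : Fin m,
      ((∏ a : Fin (psum lam k.castSucc), ∏ b : Fin (psum lam k.succ),
          psi q I h μ k a b (extendZ t z k.succ b / t k a)) *
        (∏ a : Fin (psum lam k.castSucc), ∏ b ∈ Ioi a, 1 / theta q (t k b / t k a)) *
        (∏ a : Fin (psum lam k.castSucc), ∏ b ∈ Iio a,
          theta q h / theta q (h * t k b / t k a)))

/-- `Sym_λ`: symmetrization (sum over permutations) in each group `t^{(k)}_*` of variables. -/
def symLam (F : WeightFun lam) : WeightFun lam := fun t z h μ =>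
  ∑ σ : (k : Fin m) → Equiv.Perm (Fin (psum lam k.castSucc)),
    F (fun k a => t k (σ k a)) z h μ

/-- The elliptic weight function `W_I = Sym_λ (U_I)`. -/
def weightW (q : ℂ) (I : FlagIndex lam) : WeightFun lam := symLam (weightU q I)

/-- `W_{σ,I} = W_{σ⁻¹(I)}(t, z_{σ(1)}, …, z_{σ(n)}, ħ, μ)`. -/
def weightWPerm (q : ℂ) (σ : Equiv.Perm (Fin (size lam))) (I : FlagIndex lam) : WeightFun lam :=
  fun t z h μ => weightW q (I.perm σ⁻¹) t (fun i => z (σ i)) h μ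

/-- The longest permutation `s_0 : i ↦ n + 1 - i`. -/
def longest (lam : Fin (m + 1) → ℕ) : Equiv.Perm (Fin (size lam)) := Fin.revPerm

/-- `τ` substitutes `ħ^{λ_i} / μ_i` for `μ_i`, for all `i`. -/
def tau (F : WeightFun lam) : WeightFun lam := fun t z h μ =>
  F t z h (fun i => h ^ lam i / μ i)

/-! ### The inner product -/

/-- `R_I = ∏_{k < l} ∏_{a ∈ I_k} ∏_{b ∈ I_l} ϑ(z_b / z_a)`. -/
def denomR (q : ℂ) (z : Fin (size lam) → ℂ) (I : FlagIndex lam) : ℂ :=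
  ∏ k, ∏ l ∈ Ioi k, ∏ a ∈ I.1 k, ∏ b ∈ I.1 l, theta q (z b / z a)

/-- `Q_I = ∏_{k < l} ∏_{a ∈ I_k} ∏_{b ∈ I_l} ϑ(ħ z_b / z_a)`. -/
def denomQ (q : ℂ) (z : Fin (size lam) → ℂ) (h : ℂ) (I : FlagIndex lam) : ℂ :=
  ∏ k, ∏ l ∈ Ioi k, ∏ a ∈ I.1 k, ∏ b ∈ I.1 l, theta q (h * z b / z a)

/-- The point `z_I` of the `t`-space: `t^{(k)}_a = z_{i^{(k)}_a}`. -/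
def fixedPt (z : Fin (size lam) → ℂ) (I : FlagIndex lam) : TVar lam :=
  fun k a => z (I.elt k.castSucc a)

/-- `⟨f, g⟩ = ∑_{I ∈ ℐ_λ} f(z_I) g(z_I) / (R_I Q_I)`. -/
def innerE (q : ℂ) (z : Fin (size lam) → ℂ) (h : ℂ) (f g : TVar lam → ℂ) : ℂ :=
  ∑ I : FlagIndex lam,
    f (fixedPt z I) * g (fixedPt z I) / (denomR q z I * denomQ q z h I)

end EllipticOrth

end

/-!
# Orthogonality of elliptic weight functions

A tuple `I` of disjoint subsets with `|I_j| = λ_j` is the same as a colouring `c` of the `n`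
positions in which the colour `j` occurs `λ_j` times. Everything is phrased with colourings, since
exchanging two neighbouring positions acts on them by composition. At a fixed point, the variables
of level `k` run over all assignments of a set `V k` of values to the positions of colour at most
`k`, so the weight function becomes an iterated sum of kernels `kern` between consecutive levels
(`gfun`, `weightWPerm_eq`), which can be studied level by level.

The sum over the fixed points in the inner product is traded for a sum over the index of the weight
functions. Let `M` be the square matrix of the values of the `W_{id,I}` at the fixed points, and `N`
the matrix of the normalized values of the `τ[W_{s₀,J}]`. The theorem says `N M = 1`; as a one-sided
inverse of a square matrix is two-sided, it suffices to show `M N = 1`, and there the sum runs over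
all colourings (`pairing`) while the fixed points on the two sides merely prescribe the sets `V` and
`V'` of values. Three facts evaluate it.

* Exchange relations (`exchange`): with the sets `V k` fixed, exchanging the variables at two
  neighbouring positions `i, i'` multiplies the vector of weight functions by a dynamical
  `R`-matrix, which mixes the colourings `c` and `c ∘ (i i')` only. The proof is by induction on the
  level; at each level it reduces to two-variable identities, all of them consequences of the
  three-term relation `theta_three_term`. The latter follows from the Jacobi triple product: a
  product `ϑ(x)ϑ(y)` is a `2 × 2` determinant in `xy` and `x/y`, and such determinants satisfy the
  Plücker relation.
* Under `τ` and reversal of the positions the exchange matrices turn into their inverse transposes,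
  by the unitarity identity `rDiag_mul_rDiag`. Hence `pairing` is a symmetric function of the
  variables (`pairing_perm`).
* Triangularity (`eq_of_gfun_ne_zero_left`, `eq_of_gfun_ne_zero_right`): since `ϑ(1) = 0`, in a
  nonvanishing term values move in one direction only on the way from a level to the next. By
  symmetry the positions may be permuted so that the colouring of one of the fixed points is
  sorted, and then at most one term of `pairing` survives. It is present exactly when the two fixed
  points agree, and then it is the product of the diagonal values `gfun_diag`, which cancels against
  `R`, `Q` and the powers of `ϑ(ħ)`. The powers of `ϑ'(1)` cancel because every pair of positions
  whose colours increase is an inversion for exactly one of `I` and its reversal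
  (`FlagIndex.dim_add_dim_rev`).
-/

noncomputable section

namespace EllipticOrth

/-! ### The Jacobi triple product -/

section Theta

open Filter Topology

/-- The triangular number `k (k + 1) / 2` of an integer. -/
def tri (k : ℤ) : ℤ := k * (k + 1) / 2

theorem two_mul_tri (k : ℤ) : 2 * tri k = k * (k + 1) :=
  Int.mul_ediv_cancel' (Int.even_mul_succ_self k).two_dvd

theorem tri_succ (k : ℤ) : tri (k + 1) = tri k + (k + 1) := by
  have h1 := two_mul_tri k
  have h2 := two_mul_tri (k + 1)
  linarith

theorem tri_neg (k : ℤ) : tri (-k) = tri k - k := by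
  have h1 := two_mul_tri k
  have h2 := two_mul_tri (-k)
  linarith

theorem tri_pred (k : ℤ) : tri (k - 1) = tri k - k := by
  have := tri_succ (k - 1)
  simp only [sub_add_cancel] at this
  omega

theorem summable_nat_tri {r : ℝ} (hr : 0 < r) (hr1 : r < 1) {R : ℝ} (hR : 0 < R) :
    Summable fun n : ℕ => r ^ tri n * R ^ (n : ℤ) := by
  refine summable_of_ratio_test_tendsto_lt_one (l := 0) one_pos
    (Eventually.of_forall fun n => by positivity) ?_
  have key : ∀ n : ℕ, ‖r ^ tri ((n + 1 : ℕ) : ℤ) * R ^ ((n + 1 : ℕ) : ℤ)‖ /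
      ‖r ^ tri (n : ℤ) * R ^ (n : ℤ)‖ = r * R * r ^ n := by
    intro n
    rw [Real.norm_of_nonneg (by positivity), Real.norm_of_nonneg (by positivity)]
    push_cast
    rw [tri_succ, zpow_add₀ hr.ne', zpow_add₀ hr.ne', zpow_add₀ hR.ne', zpow_one, zpow_one,
      zpow_natCast]
    field_simp
  simp only [key]
  simpa using (tendsto_pow_atTop_nhds_zero_of_lt_one hr.le hr1).const_mul (r * R)

theorem summable_tri {r : ℝ} (hr : 0 < r) (hr1 : r < 1) {R : ℝ} (hR : 0 < R) :
    Summable fun k : ℤ => r ^ tri k * R ^ k := by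
  refine Summable.of_nat_of_neg (summable_nat_tri hr hr1 hR) ?_
  refine (summable_nat_tri hr hr1 (R := r⁻¹ * R⁻¹) (by positivity)).congr fun n => ?_
  rw [tri_neg, zpow_sub₀ hr.ne', mul_zpow, zpow_neg, inv_zpow, inv_zpow]
  field_simp

/-- The finite `q`-factorial `(1 - q) ⋯ (1 - q ^ n)`. -/
def qFact (q : ℂ) (n : ℕ) : ℂ := ∏ i ∈ range n, (1 - q ^ (i + 1))

/-- The infinite product `∏_{s ≥ 1} (1 - q ^ s)`. -/
def euler (q : ℂ) : ℂ := ∏' i : ℕ, (1 - q ^ (i + 1))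

theorem one_sub_pow_ne_zero {q : ℂ} (hq : ‖q‖ < 1) (n : ℕ) : 1 - q ^ (n + 1) ≠ 0 := by
  intro h
  have h1 : ‖q ^ (n + 1)‖ = 1 := by rw [← sub_eq_zero.1 h]; simp
  rw [norm_pow] at h1
  exact absurd h1 (pow_lt_one₀ (norm_nonneg q) hq (Nat.succ_ne_zero n)).ne

theorem qFact_ne_zero {q : ℂ} (hq : ‖q‖ < 1) (n : ℕ) : qFact q n ≠ 0 :=
  prod_ne_zero_iff.2 fun i _ => one_sub_pow_ne_zero hq i

theorem qFact_succ (q : ℂ) (n : ℕ) : qFact q (n + 1) = qFact q n * (1 - q ^ (n + 1)) :=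
  prod_range_succ _ _

theorem summable_norm_pow_succ_mul {q : ℂ} (hq : ‖q‖ < 1) (x : ℂ) :
    Summable fun s : ℕ => ‖-(q ^ (s + 1) * x)‖ := by
  have h := (summable_geometric_of_lt_one (norm_nonneg q) hq).mul_right (‖q‖ * ‖x‖)
  refine h.congr fun s => ?_
  rw [norm_neg, norm_mul, norm_pow, pow_succ]
  ring

theorem multipliable_one_sub {q : ℂ} (hq : ‖q‖ < 1) (x : ℂ) :
    Multipliable fun s : ℕ => 1 - q ^ (s + 1) * x := by
  simpa only [sub_eq_add_neg] using
    multipliable_one_add_of_summable (summable_norm_pow_succ_mul hq x)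

theorem tendsto_qFact {q : ℂ} (hq : ‖q‖ < 1) : Tendsto (qFact q) atTop (𝓝 (euler q)) := by
  have h := (multipliable_one_sub hq 1).hasProd.tendsto_prod_nat
  simp only [mul_one] at h
  exact h

theorem euler_ne_zero {q : ℂ} (hq : ‖q‖ < 1) : euler q ≠ 0 := by
  have h := tprod_one_add_ne_zero_of_summable (f := fun s : ℕ => -(q ^ (s + 1) * 1))
    (fun s => by simpa [← sub_eq_add_neg] using one_sub_pow_ne_zero hq s)
    (summable_norm_pow_succ_mul hq 1)
  simpa [← sub_eq_add_neg, euler] using h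

/-- `1 / (q)_j` for integer `j`, with value `0` at negative `j`. -/
def qInv (q : ℂ) (j : ℤ) : ℂ := if 0 ≤ j then (qFact q j.toNat)⁻¹ else 0

theorem qInv_pred {q : ℂ} (hq : ‖q‖ < 1) (j : ℤ) :
    qInv q (j - 1) = (1 - q ^ j) * qInv q j := by
  rcases lt_trichotomy j 0 with hj | rfl | hj
  · simp [qInv, hj.not_ge, show ¬ (1 ≤ j) by omega]
  · simp [qInv]
  · obtain ⟨n, rfl⟩ : ∃ n : ℕ, j = (n : ℤ) + 1 := ⟨(j - 1).toNat, by omega⟩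
    have h1 : ((n : ℤ) + 1).toNat = n + 1 := by omega
    have h2 := one_sub_pow_ne_zero hq n
    have h3 := qFact_ne_zero hq n
    have h4 : q ^ ((n : ℤ) + 1) = q ^ (n + 1) := by exact_mod_cast zpow_natCast q (n + 1)
    simp only [qInv, add_sub_cancel_right, Int.natCast_nonneg, if_true, Int.toNat_natCast, h1,
      show (0 : ℤ) ≤ (n : ℤ) + 1 by omega, qFact_succ, h4]
    field_simp

theorem tendsto_qInv {q : ℂ} (hq : ‖q‖ < 1) : Tendsto (qInv q) atTop (𝓝 (euler q)⁻¹) := by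
  have h : Tendsto (fun j : ℤ => (qFact q j.toNat)⁻¹) atTop (𝓝 (euler q)⁻¹) :=
    ((tendsto_qFact hq).inv₀ (euler_ne_zero hq)).comp <| tendsto_atTop.2 fun b => by
      filter_upwards [eventually_ge_atTop (b : ℤ)] with j hj
      omega
  refine h.congr' ?_
  filter_upwards [eventually_ge_atTop 0] with j hj
  simp [qInv, hj]

theorem exists_norm_qInv_le {q : ℂ} (hq : ‖q‖ < 1) : ∃ C, ∀ j, ‖qInv q j‖ ≤ C := by
  obtain ⟨C, hC⟩ := (Metric.isBounded_range_of_tendsto _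
    ((tendsto_qFact hq).inv₀ (euler_ne_zero hq))).exists_norm_le
  refine ⟨C, fun j => ?_⟩
  unfold qInv
  split_ifs
  · exact hC _ ⟨_, rfl⟩
  · exact norm_zero.trans_le ((norm_nonneg _).trans (hC _ ⟨0, rfl⟩))

theorem exists_norm_qFact_le {q : ℂ} (hq : ‖q‖ < 1) : ∃ C, ∀ n, ‖qFact q n‖ ≤ C := by
  obtain ⟨C, hC⟩ := (Metric.isBounded_range_of_tendsto _ (tendsto_qFact hq)).exists_norm_le
  exact ⟨C, fun n => hC _ ⟨n, rfl⟩⟩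

/-- The Laurent coefficient of `y ^ (2 k + 1)` in the `N`-th partial product of `theta q y`. -/
def thetaCoeff (q : ℂ) (N : ℕ) (k : ℤ) : ℂ :=
  (-1) ^ k * q ^ tri k * qFact q (2 * N + 1) * qInv q (N - k) * qInv q (N + k + 1)

/-- The recurrence of the coefficients under multiplication by
`(1 - q ^ (N + 1) y ^ 2) (1 - q ^ (N + 1) / y ^ 2)`. -/
theorem thetaCoeff_succ {q : ℂ} (hq : ‖q‖ < 1) (hq0 : q ≠ 0) (N : ℕ) (k : ℤ) :
    thetaCoeff q (N + 1) k = (1 + q ^ (2 * N + 2)) * thetaCoeff q N k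
      - q ^ (N + 1) * (thetaCoeff q N (k - 1) + thetaCoeff q N (k + 1)) := by
  have e1 : qInv q (N - k) = (1 - q ^ ((N : ℤ) + 1 - k)) * qInv q (N + 1 - k) := by
    rw [← qInv_pred hq]; congr 1; ring
  have e2 : qInv q (N + k + 1) = (1 - q ^ ((N : ℤ) + 1 + k + 1)) * qInv q (N + 1 + k + 1) := by
    rw [← qInv_pred hq]; congr 1; ring
  have e3 : qInv q (N - (k + 1)) = (1 - q ^ ((N : ℤ) - k)) * qInv q (N - k) := by
    rw [← qInv_pred hq]; congr 1; ring
  have e4 : qInv q (N + (k - 1) + 1) = (1 - q ^ ((N : ℤ) + k + 1)) * qInv q (N + k + 1) := by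
    rw [← qInv_pred hq]; congr 1; ring
  have e5 : qInv q (N - (k - 1)) = qInv q (N + 1 - k) := by congr 1; ring
  have e6 : qInv q (N + (k + 1) + 1) = qInv q (N + 1 + k + 1) := by congr 1; ring
  have e7 : qFact q (2 * (N + 1) + 1) =
      qFact q (2 * N + 1) * (1 - q ^ (2 * N + 2)) * (1 - q ^ (2 * N + 3)) := by
    rw [show 2 * (N + 1) + 1 = 2 * N + 1 + 1 + 1 by ring, qFact_succ, qFact_succ]
  have m1 : ((-1 : ℂ)) ^ (k - 1) = -(-1) ^ k := by rw [zpow_sub_one₀ (by norm_num)]; norm_num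
  have m2 : ((-1 : ℂ)) ^ (k + 1) = -(-1) ^ k := by rw [zpow_add_one₀ (by norm_num)]; norm_num
  unfold thetaCoeff
  push_cast
  rw [e3, e4, e5, e6, e1, e2, e7, m1, m2, tri_succ, tri_pred]
  simp only [zpow_add₀ hq0, zpow_sub₀ hq0, zpow_natCast, zpow_one, pow_add, pow_mul', pow_one]
  have hk : q ^ k ≠ 0 := zpow_ne_zero _ hq0
  field_simp
  ring

/-- The expansion of a partial product of `theta`: a finite form of the triple product. -/
theorem hasSum_thetaCoeff {q : ℂ} (hq : ‖q‖ < 1) (hq0 : q ≠ 0) {y : ℂ} (hy : y ≠ 0) (N : ℕ) :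
    HasSum (fun k : ℤ => thetaCoeff q N k * y ^ (2 * k + 1))
      ((y - y⁻¹) * ∏ s ∈ range N, ((1 - q ^ (s + 1) * y ^ 2) * (1 - q ^ (s + 1) / y ^ 2))) := by
  induction N with
  | zero =>
    have h : ∀ k ∉ ({0, -1} : Finset ℤ), thetaCoeff q 0 k * y ^ (2 * k + 1) = 0 := by
      intro k hk
      simp only [mem_insert, mem_singleton, not_or] at hk
      rcases lt_or_ge k 0 with h | h
      · simp [thetaCoeff, qInv, show ¬ (0 ≤ k + 1) by omega]
      · simp [thetaCoeff, qInv, show ¬ (k ≤ 0) by omega]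
    have h1 : HasSum _ _ := hasSum_sum_of_ne_finset_zero (L := .unconditional ℤ) h
    have h2 := one_sub_pow_ne_zero hq 0
    rw [sum_pair (by norm_num)] at h1
    convert h1 using 1
    simp only [zero_add, pow_one] at h2
    simp [thetaCoeff, qInv, tri, qFact, h2]
    field_simp
    ring
  | succ N ih =>
    have h1 := ih.mul_left (1 + q ^ (2 * N + 2))
    have h2 := ((Equiv.subRight (1 : ℤ)).hasSum_iff.2 ih).mul_left (q ^ (N + 1) * y ^ 2)
    have h3 := ((Equiv.addRight (1 : ℤ)).hasSum_iff.2 ih).mul_left (q ^ (N + 1) / y ^ 2)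
    convert (h1.sub h2).sub h3 using 1
    · rfl
    · funext k
      simp only [Function.comp, Equiv.subRight_apply, Equiv.coe_addRight]
      rw [thetaCoeff_succ hq hq0, show 2 * (k - 1) + 1 = 2 * k + 1 - 2 by ring,
        show 2 * (k + 1) + 1 = 2 * k + 1 + 2 by ring, zpow_sub₀ hy, zpow_add₀ hy (2 * k + 1)]
      norm_cast
      field_simp
      ring
    · rw [prod_range_succ]
      field_simp
      ring

/-- The Jacobi triple product, as the limit `N → ∞` of `hasSum_thetaCoeff`. -/
theorem hasSum_theta {q : ℂ} (hq : ‖q‖ < 1) (hq0 : q ≠ 0) {y : ℂ} (hy : y ≠ 0) :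
    HasSum (fun k : ℤ => (-1) ^ k * q ^ tri k * y ^ (2 * k + 1)) (euler q * theta q y) := by
  have hq' : 0 < ‖q‖ := norm_pos_iff.2 hq0
  have hy' : 0 < ‖y‖ := norm_pos_iff.2 hy
  have hE := euler_ne_zero hq
  obtain ⟨C, hC⟩ := exists_norm_qInv_le hq
  obtain ⟨D, hD⟩ := exists_norm_qFact_le hq
  have hC0 : 0 ≤ C := (norm_nonneg _).trans (hC 0)
  have hD0 : 0 ≤ D := (norm_nonneg _).trans (hD 0)
  have hsum : Summable fun k : ℤ => ‖q‖ ^ tri k * ‖y‖ ^ (2 * k + 1) := by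
    refine ((summable_tri hq' hq (R := ‖y‖ ^ 2) (by positivity)).mul_right ‖y‖).congr fun k => ?_
    rw [zpow_add₀ hy'.ne', zpow_mul, zpow_one]
    norm_cast
    ring
  have hnorm : ∀ k : ℤ, ‖(-1) ^ k * q ^ tri k * y ^ (2 * k + 1)‖
      = ‖q‖ ^ tri k * ‖y‖ ^ (2 * k + 1) := by
    intro k
    simp [norm_zpow]
  have hfin : Tendsto (fun N : ℕ => ∑' k : ℤ, thetaCoeff q N k * y ^ (2 * k + 1)) atTop
      (𝓝 (theta q y)) := by
    have h1 := ((multipliable_one_sub hq (y ^ 2)).mul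
      (multipliable_one_sub hq (y ^ 2)⁻¹)).hasProd.tendsto_prod_nat.const_mul (y - y⁻¹)
    simp only [← div_eq_mul_inv] at h1
    exact h1.congr fun N => (hasSum_thetaCoeff hq hq0 hy N).tsum_eq.symm
  have hlim : Tendsto (fun N : ℕ => ∑' k : ℤ, thetaCoeff q N k * y ^ (2 * k + 1)) atTop
      (𝓝 (∑' k : ℤ, (-1) ^ k * q ^ tri k * (euler q)⁻¹ * y ^ (2 * k + 1))) := by
    refine tendsto_tsum_of_dominated_convergence
      (bound := fun k => D * C * C * (‖q‖ ^ tri k * ‖y‖ ^ (2 * k + 1))) (hsum.mul_left _) ?_ ?_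
    · intro k
      have t1 : Tendsto (fun N : ℕ => qFact q (2 * N + 1)) atTop (𝓝 (euler q)) :=
        (tendsto_qFact hq).comp (tendsto_atTop_mono (fun N => by simp only [id]; omega) tendsto_id)
      have t2 : Tendsto (fun N : ℕ => qInv q (N - k)) atTop (𝓝 (euler q)⁻¹) :=
        (tendsto_qInv hq).comp
          (tendsto_atTop_add_const_right _ (-k) tendsto_natCast_atTop_atTop)
      have t3 : Tendsto (fun N : ℕ => qInv q (N + k + 1)) atTop (𝓝 (euler q)⁻¹) := by
        simpa only [Function.comp_def, add_assoc] using (tendsto_qInv hq).comp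
          (tendsto_atTop_add_const_right _ (k + 1) tendsto_natCast_atTop_atTop)
      have t4 := (((t1.const_mul ((-1) ^ k * q ^ tri k)).mul t2).mul t3).mul_const
        (y ^ (2 * k + 1))
      rw [show (-1) ^ k * q ^ tri k * euler q * (euler q)⁻¹ * (euler q)⁻¹ * y ^ (2 * k + 1)
        = (-1) ^ k * q ^ tri k * (euler q)⁻¹ * y ^ (2 * k + 1) by field_simp] at t4
      exact t4
    · refine Eventually.of_forall fun N k => ?_
      have : thetaCoeff q N k * y ^ (2 * k + 1) = (qFact q (2 * N + 1) * qInv q (N - k) *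
          qInv q (N + k + 1)) * ((-1) ^ k * q ^ tri k * y ^ (2 * k + 1)) := by
        unfold thetaCoeff; ring
      rw [this, norm_mul, hnorm, norm_mul, norm_mul]
      gcongr
      · exact hD _
      · exact hC _
      · exact hC _
  have hval := tendsto_nhds_unique hfin hlim
  have hs : Summable fun k : ℤ => (-1) ^ k * q ^ tri k * y ^ (2 * k + 1) :=
    Summable.of_norm (by simpa only [hnorm] using hsum)
  have he : ∀ k : ℤ, euler q * ((-1) ^ k * q ^ tri k * (euler q)⁻¹ * y ^ (2 * k + 1))
      = (-1) ^ k * q ^ tri k * y ^ (2 * k + 1) := fun k => by field_simp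
  rw [hval, ← tsum_mul_left]
  simp only [he]
  exact hs.hasSum

/-! ### The three-term relation -/

theorem summable_norm_theta {q : ℂ} (hq : ‖q‖ < 1) (hq0 : q ≠ 0) {y : ℂ} (hy : y ≠ 0) :
    Summable fun k : ℤ => ‖(-1) ^ k * q ^ tri k * y ^ (2 * k + 1)‖ := by
  have hq' : 0 < ‖q‖ := norm_pos_iff.2 hq0
  have hy' : 0 < ‖y‖ := norm_pos_iff.2 hy
  refine ((summable_tri hq' hq (R := ‖y‖ ^ 2) (by positivity)).mul_right ‖y‖).congr fun k => ?_
  simp only [norm_mul, norm_zpow, norm_neg, norm_one, one_zpow, one_mul]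
  rw [zpow_add₀ hy'.ne', zpow_mul, zpow_one]
  norm_cast
  ring

theorem summable_norm_odd {q : ℂ} (hq : ‖q‖ < 1) (hq0 : q ≠ 0) {u : ℂ} (hu : u ≠ 0) :
    Summable fun k : ℤ => ‖q ^ (2 * tri k) * u ^ (2 * k + 1)‖ := by
  have hq2 : ‖q ^ 2‖ < 1 := by
    rw [norm_pow]
    exact pow_lt_one₀ (norm_nonneg q) hq two_ne_zero
  have h := summable_norm_theta hq2 (pow_ne_zero 2 hq0) hu
  refine h.congr fun k => ?_
  rw [zpow_mul]
  simp [norm_zpow]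

theorem summable_norm_even {q : ℂ} (hq : ‖q‖ < 1) (hq0 : q ≠ 0) {w : ℂ} (hw : w ≠ 0) :
    Summable fun k : ℤ => ‖q ^ (k * k) * w ^ (2 * k)‖ := by
  have hq' : 0 < ‖q‖ := norm_pos_iff.2 hq0
  have hw' : 0 < ‖w‖ := norm_pos_iff.2 hw
  refine (summable_tri (r := ‖q‖ ^ 2) (by positivity) (pow_lt_one₀ (norm_nonneg q)
    hq two_ne_zero) (R := ‖q‖⁻¹ * ‖w‖ ^ 2) (by positivity)).congr fun k => ?_
  have h2 : k * k = 2 * tri k + -k := by rw [two_mul_tri]; ring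
  rw [norm_mul, norm_zpow, norm_zpow, h2, zpow_add₀ hq'.ne', zpow_mul, zpow_mul, mul_zpow,
    zpow_neg, inv_zpow]
  norm_cast
  ring

/-- The parities of `m + n` split `ℤ × ℤ` into the points `(i + j, i - j)` and
`(i + j, i - j - 1)`. -/
theorem isCompl_range_parity :
    IsCompl (Set.range fun p : ℤ × ℤ => (p.1 + p.2, p.1 - p.2))
      (Set.range fun p : ℤ × ℤ => (p.1 + p.2, p.1 - p.2 - 1)) := by
  refine IsCompl.of_eq ?_ ?_
  · ext ⟨m, n⟩
    simp only [Set.inf_eq_inter, Set.mem_inter_iff, Set.mem_range, Prod.exists, Prod.mk.injEq,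
      Set.bot_eq_empty, Set.mem_empty_iff_false, iff_false]
    rintro ⟨⟨a, b, h1, h2⟩, c, d, h3, h4⟩
    omega
  · ext ⟨m, n⟩
    simp only [Set.sup_eq_union, Set.mem_union, Set.mem_range, Prod.exists, Prod.mk.injEq,
      Set.top_eq_univ, Set.mem_univ, iff_true]
    rcases Int.even_or_odd' (m + n) with ⟨i, h | h⟩
    · exact Or.inl ⟨i, m - i, by omega, by omega⟩
    · exact Or.inr ⟨i + 1, m - i - 1, by omega, by omega⟩

/-- The product of two theta functions is a `2 × 2` determinant: in the double series, `m + n` even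
and `m + n` odd contribute the two terms. -/
theorem exists_theta_mul_theta {q : ℂ} (hq : ‖q‖ < 1) :
    ∃ A B : ℂ → ℂ, ∀ x y : ℂ, x ≠ 0 → y ≠ 0 →
      theta q x * theta q y = A (x * y) * B (x / y) - B (x * y) * A (x / y) := by
  rcases eq_or_ne q 0 with rfl | hq0
  · refine ⟨fun u => u + u⁻¹, fun _ => 1, fun x y hx hy => ?_⟩
    simp [theta]
    field_simp
    ring
  · have hE := euler_ne_zero hq
    refine ⟨fun u => (euler q)⁻¹ * ∑' k : ℤ, q ^ (2 * tri k) * u ^ (2 * k + 1),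
      fun w => (euler q)⁻¹ * ∑' k : ℤ, q ^ (k * k) * w ^ (2 * k), fun x y hx hy => ?_⟩
    have hu : x * y ≠ 0 := mul_ne_zero hx hy
    have hw : x / y ≠ 0 := div_ne_zero hx hy
    set F : ℤ × ℤ → ℂ := fun p => ((-1) ^ p.1 * q ^ tri p.1 * x ^ (2 * p.1 + 1)) *
      ((-1) ^ p.2 * q ^ tri p.2 * y ^ (2 * p.2 + 1)) with hF
    have h0 : HasSum F ((euler q * theta q x) * (euler q * theta q y)) := by
      have h := (summable_mul_of_summable_norm (summable_norm_theta hq hq0 hx)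
        (summable_norm_theta hq hq0 hy)).hasSum
      rwa [← tsum_mul_tsum_of_summable_norm (summable_norm_theta hq hq0 hx)
        (summable_norm_theta hq hq0 hy), (hasSum_theta hq hq0 hx).tsum_eq,
        (hasSum_theta hq hq0 hy).tsum_eq] at h
    have h1 := (summable_mul_of_summable_norm (summable_norm_odd hq hq0 hu)
        (summable_norm_even hq hq0 hw)).hasSum
    rw [← tsum_mul_tsum_of_summable_norm (summable_norm_odd hq hq0 hu)
        (summable_norm_even hq hq0 hw)] at h1
    have h2 := (summable_mul_of_summable_norm (summable_norm_even hq hq0 hu)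
        (summable_norm_odd hq hq0 hw)).hasSum.neg
    rw [← tsum_mul_tsum_of_summable_norm (summable_norm_even hq hq0 hu)
        (summable_norm_odd hq hq0 hw)] at h2
    have i1 : Function.Injective fun p : ℤ × ℤ => (p.1 + p.2, p.1 - p.2) := by
      rintro ⟨a, b⟩ ⟨c, d⟩ h
      simp only [Prod.mk.injEq] at h ⊢
      omega
    have i2 : Function.Injective fun p : ℤ × ℤ => (p.1 + p.2, p.1 - p.2 - 1) := by
      rintro ⟨a, b⟩ ⟨c, d⟩ h
      simp only [Prod.mk.injEq] at h ⊢
      omega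
    have e1 : ∀ p : ℤ × ℤ, q ^ (2 * tri p.1) * (x * y) ^ (2 * p.1 + 1) *
        (q ^ (p.2 * p.2) * (x / y) ^ (2 * p.2)) = F (p.1 + p.2, p.1 - p.2) := by
      rintro ⟨i, j⟩
      have t : tri (i + j) + tri (i - j) = 2 * tri i + j * j := by
        have a1 := two_mul_tri (i + j)
        have a2 := two_mul_tri (i - j)
        have a3 := two_mul_tri i
        linarith
      have s : ((-1 : ℂ)) ^ (i + j) * (-1) ^ (i - j) = 1 := by
        rw [← zpow_add₀ (by norm_num), show i + j + (i - j) = 2 * i by ring, zpow_mul]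
        norm_num
      have p1 : x ^ (2 * (i + j) + 1) * y ^ (2 * (i - j) + 1)
          = (x * y) ^ (2 * i + 1) * (x / y) ^ (2 * j) := by
        rw [mul_zpow, div_zpow, show 2 * (i + j) + 1 = (2 * i + 1) + 2 * j by ring,
          show 2 * (i - j) + 1 = (2 * i + 1) - 2 * j by ring, zpow_add₀ hx (2 * i + 1),
          zpow_sub₀ hy]
        ring
      calc _ = q ^ (2 * tri i + j * j) * ((x * y) ^ (2 * i + 1) * (x / y) ^ (2 * j)) := by
            rw [zpow_add₀ hq0]; ring
        _ = _ := by
            rw [← t, ← p1, zpow_add₀ hq0]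
            simp only [hF]
            linear_combination (-(q ^ tri (i + j) * q ^ tri (i - j) * x ^ (2 * (i + j) + 1) *
              y ^ (2 * (i - j) + 1))) * s
    have e2 : ∀ p : ℤ × ℤ, -(q ^ (p.1 * p.1) * (x * y) ^ (2 * p.1) *
        (q ^ (2 * tri p.2) * (x / y) ^ (2 * p.2 + 1))) = F (p.1 + p.2, p.1 - p.2 - 1) := by
      rintro ⟨i, j⟩
      have t : tri (i + j) + tri (i - j - 1) = i * i + 2 * tri j := by
        have a1 := two_mul_tri (i + j)
        have a2 := two_mul_tri (i - j - 1)
        have a3 := two_mul_tri j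
        linarith
      have s : ((-1 : ℂ)) ^ (i + j) * (-1) ^ (i - j - 1) = -1 := by
        rw [← zpow_add₀ (by norm_num), show i + j + (i - j - 1) = 2 * (i - 1) + 1 by ring,
          zpow_add₀ (by norm_num), zpow_mul]
        norm_num
      have p1 : x ^ (2 * (i + j) + 1) * y ^ (2 * (i - j - 1) + 1)
          = (x * y) ^ (2 * i) * (x / y) ^ (2 * j + 1) := by
        rw [mul_zpow, div_zpow, show 2 * (i + j) + 1 = 2 * i + (2 * j + 1) by ring,
          show 2 * (i - j - 1) + 1 = 2 * i - (2 * j + 1) by ring, zpow_add₀ hx (2 * i),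
          zpow_sub₀ hy]
        ring
      calc _ = -(q ^ (i * i + 2 * tri j) * ((x * y) ^ (2 * i) * (x / y) ^ (2 * j + 1))) := by
            rw [zpow_add₀ hq0]; ring
        _ = _ := by
            rw [← t, ← p1, zpow_add₀ hq0]
            simp only [hF]
            linear_combination (-(q ^ tri (i + j) * q ^ tri (i - j - 1) * x ^ (2 * (i + j) + 1) *
              y ^ (2 * (i - j - 1) + 1))) * s
    simp only [e1] at h1
    simp only [e2] at h2
    have h1' := (Function.Injective.hasSum_range_iff (f := F) i1).2 h1
    have h2' := (Function.Injective.hasSum_range_iff (f := F) i2).2 h2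
    have h3 := HasSum.add_isCompl (f := F) isCompl_range_parity h1' h2'
    have h4 := h0.unique h3
    field_simp
    linear_combination h4

/-- Weierstrass' three-term relation `ϑ(ab)ϑ(a/b)ϑ(cd)ϑ(c/d) - ϑ(ac)ϑ(a/c)ϑ(bd)ϑ(b/d) +
ϑ(ad)ϑ(a/d)ϑ(bc)ϑ(b/c) = 0`.  It is the Plücker relation of the `2 × 2` determinants of
`exists_theta_mul_theta`.  The parameters `a, b, c, d` enter through their squares only, as
products and quotients of the arguments, so no square roots have to be chosen. -/
theorem theta_three_term {q : ℂ} (hq : ‖q‖ < 1) {ab a_b cd c_d ac a_c bd b_d ad a_d bc b_c : ℂ}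
    (h1 : ab ≠ 0) (h1' : a_b ≠ 0) (h2 : cd ≠ 0) (h2' : c_d ≠ 0) (h3 : ac ≠ 0) (h3' : a_c ≠ 0)
    (h4 : bd ≠ 0) (h4' : b_d ≠ 0) (h5 : ad ≠ 0) (h5' : a_d ≠ 0) (h6 : bc ≠ 0) (h6' : b_c ≠ 0)
    (ha : ac * a_c = ab * a_b) (ha' : ad * a_d = ab * a_b)
    (hb : bd * b_d = ab / a_b) (hb' : bc * b_c = ab / a_b)
    (hc : ac / a_c = cd * c_d) (hc' : bc / b_c = cd * c_d)
    (hd : bd / b_d = cd / c_d) (hd' : ad / a_d = cd / c_d) :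
    theta q ab * theta q a_b * (theta q cd * theta q c_d)
      - theta q ac * theta q a_c * (theta q bd * theta q b_d)
      + theta q ad * theta q a_d * (theta q bc * theta q b_c) = 0 := by
  obtain ⟨A, B, h⟩ := exists_theta_mul_theta hq
  rw [h _ _ h1 h1', h _ _ h2 h2', h _ _ h3 h3', h _ _ h4 h4', h _ _ h5 h5', h _ _ h6 h6',
    ha, ha', hb, hb', hc, hc', hd, hd']
  ring

theorem theta_inv (q y : ℂ) : theta q y⁻¹ = -theta q y := by
  unfold theta
  have : ∀ s : ℕ, (1 - q ^ (s + 1) * y⁻¹ ^ 2) * (1 - q ^ (s + 1) / y⁻¹ ^ 2)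
      = (1 - q ^ (s + 1) * y ^ 2) * (1 - q ^ (s + 1) / y ^ 2) := by
    intro s
    rw [inv_pow, div_inv_eq_mul, ← div_eq_mul_inv]
    ring
  simp only [this, inv_inv]
  ring

theorem theta_one (q : ℂ) : theta q 1 = 0 := by simp [theta]

/-- Continuity of one half of the infinite product. -/
theorem continuousAt_tprod_one_sub {q : ℂ} (hq : ‖q‖ < 1) :
    ContinuousAt (fun x : ℂ => ∏' s : ℕ, (1 - q ^ (s + 1) * x)) 1 := by
  have hsum : Summable fun s : ℕ => ‖q‖ ^ (s + 1) * 2 := by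
    have h := (summable_geometric_of_lt_one (norm_nonneg q) hq).mul_right (‖q‖ * 2)
    refine h.congr fun s => ?_
    rw [pow_succ]
    ring
  have h := (Summable.hasProdUniformlyOn_nat_one_add
    (f := fun (s : ℕ) (x : ℂ) => -(q ^ (s + 1) * x)) (K := Metric.closedBall 0 2)
    (isCompact_closedBall (0 : ℂ) 2) hsum (Eventually.of_forall fun n x hx => by
      rw [norm_neg, norm_mul, norm_pow]
      gcongr
      simpa using hx) (fun n => by fun_prop)).tendstoUniformlyOn_finsetRange
  have hc := h.continuousOn (Eventually.of_forall fun n => by fun_prop).frequently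
  simp only [← sub_eq_add_neg] at hc
  exact hc.continuousAt (Metric.closedBall_mem_nhds_of_mem (by simp))

theorem thetaPrimeOne_ne_zero {q : ℂ} (hq : ‖q‖ < 1) : thetaPrimeOne q ≠ 0 := by
  set P : ℂ → ℂ := fun x => ∏' s : ℕ, (1 - q ^ (s + 1) * x) with hP
  set g : ℂ → ℂ := fun x => x ^ (1 / 2 : ℂ) - (x ^ (1 / 2 : ℂ))⁻¹ with hg
  have hPc : ContinuousAt P 1 := continuousAt_tprod_one_sub hq
  have hPi : ContinuousAt (fun x => P x⁻¹) 1 := by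
    refine ContinuousAt.comp (f := fun x : ℂ => x⁻¹) (g := P) ?_ (continuousAt_inv₀ one_ne_zero)
    simpa using hPc
  have hsq : ∀ x : ℂ, (x ^ (1 / 2 : ℂ)) ^ 2 = x := fun x => by
    rw [← Complex.cpow_nat_mul]
    norm_num
  have hform : ∀ x : ℂ, theta q (x ^ (1 / 2 : ℂ)) = g x * (P x * P x⁻¹) := by
    intro x
    simp only [theta, hg, hP, hsq]
    simp only [div_eq_mul_inv]
    rw [Multipliable.tprod_mul (multipliable_one_sub hq x) (multipliable_one_sub hq x⁻¹)]
  have hg1 : g 1 = 0 := by simp [hg]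
  have hgd : HasDerivAt g 1 1 := by
    have h1 : HasDerivAt (fun x : ℂ => x ^ (1 / 2 : ℂ)) (1 / 2) 1 := by
      have := (hasDerivAt_id (1 : ℂ)).cpow_const (c := 1 / 2) (by simp [Complex.slitPlane])
      simpa using this
    have h2 := h1.sub (h1.inv (by simp))
    have e : (1 / 2 : ℂ) - -(1 / 2) / ((1 : ℂ) ^ (1 / 2 : ℂ)) ^ 2 = 1 := by norm_num
    rw [e] at h2
    exact h2
  have hd : HasDerivAt (fun x : ℂ => theta q (x ^ (1 / 2 : ℂ))) (1 * (P 1 * P 1⁻¹)) 1 := by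
    rw [hasDerivAt_iff_tendsto_slope] at hgd ⊢
    have hPP : Tendsto (fun x => P x * P x⁻¹) (𝓝[≠] 1) (𝓝 (P 1 * P 1⁻¹)) :=
      (hPc.mul hPi).tendsto.mono_left nhdsWithin_le_nhds
    -- the first factor vanishes at `1`, so continuity of the product suffices
    refine (hgd.mul hPP).congr fun x => ?_
    simp only [slope_def_field, hform, hg1]
    ring
  have hP1 : P 1 = euler q := by simp [hP, euler]
  unfold thetaPrimeOne
  rw [hd.deriv, inv_one, hP1, one_mul]
  exact mul_ne_zero (euler_ne_zero hq) (euler_ne_zero hq)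

end Theta

/-! ### The two-variable identities behind the exchange relations -/

theorem theta_ratio_swap (q x y : ℂ) : theta q (y / x) = -theta q (x / y) := by
  rw [← theta_inv, inv_div]

/-- The three-term relation for the values `x₁, x₂` and `s₁, s₂` of two neighbouring positions on
two consecutive levels. -/
theorem theta_exchange {q : ℂ} (hq : ‖q‖ < 1) {h x₁ x₂ s₁ s₂ : ℂ} (hh : h ≠ 0) (hx₁ : x₁ ≠ 0)
    (hx₂ : x₂ ≠ 0) (hs₁ : s₁ ≠ 0) (hs₂ : s₂ ≠ 0) :
    theta q (x₁ / x₂) * theta q (h * (s₁ / s₂)) * theta q (s₁ / x₂) * theta q (s₂ / x₁ * h)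
      + theta q (s₁ / s₂) * theta q (h / (x₁ / x₂)) * theta q (s₂ / x₁) * theta q (s₁ / x₂ * h)
      = theta q h * theta q (s₂ / x₂) * theta q (s₁ / x₁ * h)
        * theta q (x₁ / x₂ * (s₁ / s₂)) := by
  have key := theta_three_term hq
    (ab := s₂ / x₁ * h) (a_b := s₁ / x₂) (cd := h * (s₁ / s₂)) (c_d := x₁ / x₂)
    (ac := s₁ / x₂ * h) (a_c := s₂ / x₁) (bd := h / (x₁ / x₂)) (b_d := (s₁ / s₂)⁻¹)
    (ad := s₁ / x₁ * h) (a_d := s₂ / x₂) (bc := h) (b_c := (x₁ / x₂ * (s₁ / s₂))⁻¹)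
    (by positivity) (by positivity) (by positivity) (by positivity) (by positivity)
    (by positivity) (by positivity) (by positivity) (by positivity) (by positivity)
    (by positivity) (by positivity)
    (by field_simp) (by field_simp) (by field_simp) (by field_simp) (by field_simp)
    (by field_simp) (by field_simp) (by field_simp)
  rw [theta_inv, theta_inv] at key
  linear_combination key

/-- The degenerate case of the three-term relation behind the unitarity of the exchange matrices. -/
theorem theta_unitarity {q : ℂ} (hq : ‖q‖ < 1) {h w x : ℂ} (hh : h ≠ 0) (hw : w ≠ 0)
    (hx : x ≠ 0) :
    theta q h ^ 2 * theta q (w / x) * theta q (w * x)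
      - theta q x ^ 2 * theta q (w / h) * theta q (w * h)
      = theta q w ^ 2 * theta q (h * x) * theta q (h / x) := by
  have key := theta_three_term hq
    (ab := w * x) (a_b := w / x) (cd := h) (c_d := h)
    (ac := w * h) (a_c := w / h) (bd := x) (b_d := x)
    (ad := w) (a_d := w) (bc := x * h) (b_c := x / h)
    (by positivity) (by positivity) (by positivity) (by positivity) (by positivity)
    (by positivity) (by positivity) (by positivity) (by positivity) (by positivity)
    (by positivity) (by positivity)
    (by field_simp) (by field_simp) (by field_simp) (by field_simp) (by field_simp)
    (by field_simp) (by field_simp) (by field_simp)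
  rw [theta_ratio_swap q h x, mul_comm x h] at key
  linear_combination key

/-- Diagonal coefficient of the exchange relation (a dynamical `R`-matrix entry). -/
def rDiag (q h w x : ℂ) : ℂ := theta q h * theta q (w / x) / (theta q w * theta q (h * x))

/-- Off-diagonal coefficient of the exchange relation, without its dependence on the dynamical
variable. -/
def rOff (q h x : ℂ) : ℂ := theta q x / theta q (h * x)

/-- The factor of the kernel between two consecutive levels coming from two adjacent positions that
both belong to the lower level, with values `x₁, x₂` there and `s₁, s₂` in the upper level. -/
def pairKernel (q h u v x₁ x₂ s₁ s₂ : ℂ) : ℂ :=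
  theta q (s₁ / x₁ * u) / theta q u * theta q (s₂ / x₁) * (theta q (s₁ / x₂ * h) / theta q h) *
    (theta q (s₂ / x₂ * v) / theta q v) * (1 / theta q (x₂ / x₁)) *
      (theta q h / theta q (h * x₁ / x₂))

/-- The part of the exchange relation for `pairKernel` that involves the swapped colours: the
difference of the two sides is a combination of two instances of the three-term relation, one with
the parameter `h` and one with the dynamical parameter `v / u`. -/
theorem pairKernel_offDiag {q : ℂ} (hq : ‖q‖ < 1) {h u v x₁ x₂ s₁ s₂ : ℂ} (hh : h ≠ 0)
    (hu : u ≠ 0) (hv : v ≠ 0) (hx₁ : x₁ ≠ 0) (hx₂ : x₂ ≠ 0) (hs₁ : s₁ ≠ 0) (hs₂ : s₂ ≠ 0)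
    (θh : theta q h ≠ 0) (θu : theta q u ≠ 0) (θv : theta q v ≠ 0) (θw : theta q (u / v) ≠ 0)
    (θx : theta q (x₁ / x₂) ≠ 0) (θhx : theta q (h * (x₁ / x₂)) ≠ 0)
    (θxh : theta q (h / (x₁ / x₂)) ≠ 0) (θs : theta q (h * (s₁ / s₂)) ≠ 0) :
    rOff q h (x₁ / x₂) * (pairKernel q h u v x₂ x₁ s₂ s₁
        - rDiag q h (u / v) (s₁ / s₂) * pairKernel q h u v x₂ x₁ s₁ s₂)
      = rOff q h (s₁ / s₂) * (pairKernel q h v u x₁ x₂ s₁ s₂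
        + rDiag q h (v / u) (x₁ / x₂) * pairKernel q h v u x₂ x₁ s₁ s₂) := by
  have J1 := theta_exchange hq hh hx₁ hx₂ hs₁ hs₂
  have J2 := theta_exchange hq (h := v / u) (x₁ := x₁) (x₂ := x₂) (s₁ := u * s₁) (s₂ := u * s₂)
    (by positivity) hx₁ hx₂ (by positivity) (by positivity)
  rw [show u * s₁ / (u * s₂) = s₁ / s₂ by field_simp,
    show v / u * (s₁ / s₂) = (u / v / (s₁ / s₂))⁻¹ by field_simp, theta_inv,
    show u * s₁ / x₂ = s₁ / x₂ * u by ring, show u * s₂ / x₁ * (v / u) = s₂ / x₁ * v by field_simp,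
    show v / u / (x₁ / x₂) = (u / v * (x₁ / x₂))⁻¹ by field_simp, theta_inv,
    show u * s₂ / x₁ = s₂ / x₁ * u by ring, show s₁ / x₂ * u * (v / u) = s₁ / x₂ * v by field_simp,
    show v / u = (u / v)⁻¹ by field_simp, theta_inv, show u * s₂ / x₂ = s₂ / x₂ * u by ring,
    show u * s₁ / x₁ * (u / v)⁻¹ = s₁ / x₁ * v by field_simp] at J2
  unfold pairKernel rOff rDiag
  rw [theta_ratio_swap q x₁ x₂, mul_div_assoc h x₁ x₂,
    show h * x₂ / x₁ = h / (x₁ / x₂) by field_simp,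
    show v / u / (x₁ / x₂) = (u / v * (x₁ / x₂))⁻¹ by field_simp, theta_inv,
    show theta q (v / u) = -theta q (u / v) from theta_ratio_swap q u v]
  generalize theta q (x₁ / x₂ * (s₁ / s₂)) = t1 at *
  generalize theta q (h * (x₁ / x₂)) = t2 at *
  generalize theta q (h / (x₁ / x₂)) = t3 at *
  generalize theta q (h * (s₁ / s₂)) = t4 at *
  generalize theta q (u / v * (x₁ / x₂)) = t5 at *
  generalize theta q (u / v / (s₁ / s₂)) = t6 at *
  generalize theta q (u / v) = t7 at *
  generalize theta q (x₁ / x₂) = t8 at *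
  generalize theta q (s₁ / s₂) = t9 at *
  generalize theta q (s₁ / x₁ * u) = a1 at *
  generalize theta q (s₁ / x₂ * u) = a2 at *
  generalize theta q (s₂ / x₁ * u) = a3 at *
  generalize theta q (s₂ / x₂ * u) = a4 at *
  generalize theta q (s₁ / x₁ * v) = b1 at *
  generalize theta q (s₁ / x₂ * v) = b2 at *
  generalize theta q (s₂ / x₁ * v) = b3 at *
  generalize theta q (s₂ / x₂ * v) = b4 at *
  generalize theta q (s₁ / x₁ * h) = c1 at *
  generalize theta q (s₁ / x₂ * h) = c2 at *
  generalize theta q (s₂ / x₁ * h) = c3 at *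
  generalize theta q (s₂ / x₂ * h) = c4 at *
  generalize theta q (s₁ / x₁) = d1 at *
  generalize theta q (s₁ / x₂) = d2 at *
  generalize theta q (s₂ / x₁) = d3 at *
  generalize theta q (s₂ / x₂) = d4 at *
  generalize theta q u = e1 at *
  generalize theta q v = e2 at *
  generalize theta q h = e3 at *
  field_simp
  linear_combination (t7 * a4 * b1) * J1 + (e3 * d4 * c1) * J2

theorem rDiag_inv_mul_rOff (q h w x : ℂ) :
    rDiag q h w⁻¹ x⁻¹ * rOff q h x = -(rDiag q h w x * rOff q h x⁻¹) := by
  unfold rDiag rOff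
  rw [show w⁻¹ / x⁻¹ = (w / x)⁻¹ by rw [inv_div_inv, inv_div], theta_inv, theta_inv, theta_inv]
  ring

/-- Unitarity: the `2 × 2` exchange matrices for `x` and `x⁻¹` are inverse to each other. Here `g`
is the product of the dynamical parts of the two off-diagonal coefficients; their individual values
play no role. -/
theorem rDiag_mul_rDiag {q : ℂ} (hq : ‖q‖ < 1) {h w x : ℂ} (hh : h ≠ 0) (hw : w ≠ 0)
    (hx : x ≠ 0) (θw : theta q w ≠ 0) (θhx : theta q (h * x) ≠ 0) (θhx' : theta q (h / x) ≠ 0)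
    {g : ℂ} (hg : g * theta q w ^ 2 = theta q (w / h) * theta q (w * h)) :
    rDiag q h w x * rDiag q h w x⁻¹ + g * rOff q h x * rOff q h x⁻¹ = 1 := by
  have key := theta_unitarity hq hh hw hx
  unfold rDiag rOff
  rw [theta_inv, div_inv_eq_mul, ← div_eq_mul_inv]
  generalize theta q (h * x) = a at *
  generalize theta q (h / x) = b at *
  generalize theta q (w * x) = c at *
  generalize theta q (w / x) = d at *
  field_simp
  linear_combination key - theta q x ^ 2 * hg

/-- The part of the exchange relation for `pairKernel` that involves the original colours. No
further theta identity is needed: it follows from `pairKernel_offDiag` for both orders of `s₁, s₂`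
and the unitarity of the exchange matrices. -/
theorem pairKernel_diag {q : ℂ} (hq : ‖q‖ < 1) {h u v x₁ x₂ s₁ s₂ : ℂ} (hh : h ≠ 0)
    (hu : u ≠ 0) (hv : v ≠ 0) (hx₁ : x₁ ≠ 0) (hx₂ : x₂ ≠ 0) (hs₁ : s₁ ≠ 0) (hs₂ : s₂ ≠ 0)
    (θh : theta q h ≠ 0) (θu : theta q u ≠ 0) (θv : theta q v ≠ 0) (θw : theta q (u / v) ≠ 0)
    (θx : theta q (x₁ / x₂) ≠ 0) (θhx : theta q (h * (x₁ / x₂)) ≠ 0)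
    (θxh : theta q (h / (x₁ / x₂)) ≠ 0) (θs : theta q (s₁ / s₂) ≠ 0)
    (θhs : theta q (h * (s₁ / s₂)) ≠ 0) (θsh : theta q (h / (s₁ / s₂)) ≠ 0)
    {g : ℂ} (hg : g * theta q (u / v) ^ 2 = theta q (u / v / h) * theta q (u / v * h)) :
    pairKernel q h u v x₁ x₂ s₂ s₁ + rDiag q h (u / v) (x₁ / x₂) * pairKernel q h u v x₂ x₁ s₂ s₁
      = rDiag q h (u / v) (s₁ / s₂) * (pairKernel q h u v x₁ x₂ s₁ s₂
          + rDiag q h (u / v) (x₁ / x₂) * pairKernel q h u v x₂ x₁ s₁ s₂)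
        + g * rOff q h (s₁ / s₂) * rOff q h (x₁ / x₂) * pairKernel q h v u x₂ x₁ s₁ s₂ := by
  have θw' : theta q (v / u) ≠ 0 := by rw [theta_ratio_swap]; exact neg_ne_zero.2 θw
  have θhs' : theta q (h * (s₂ / s₁)) ≠ 0 := by
    rwa [show h * (s₂ / s₁) = h / (s₁ / s₂) by field_simp]
  have E1 := pairKernel_offDiag hq hh hv hu hx₁ hx₂ hs₁ hs₂ θh θv θu θw' θx θhx θxh θhs
  have E2 := pairKernel_offDiag hq hh hv hu hx₁ hx₂ hs₂ hs₁ θh θv θu θw' θx θhx θxh θhs'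
  have hw : u / v ≠ 0 := div_ne_zero hu hv
  have hS : s₁ / s₂ ≠ 0 := div_ne_zero hs₁ hs₂
  have F1 := rDiag_inv_mul_rOff q h (u / v) (s₁ / s₂)
  have F2 := rDiag_mul_rDiag hq hh hw hS θw θhs θsh hg
  have F3 := rDiag_inv_mul_rOff q h (u / v) (s₁ / s₂)⁻¹
  have r0 : rOff q h (s₁ / s₂) ≠ 0 := div_ne_zero θs θhs
  have r0' : rOff q h (s₁ / s₂)⁻¹ ≠ 0 := by
    refine div_ne_zero (by rw [theta_inv]; exact neg_ne_zero.2 θs) ?_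
    rwa [← div_eq_mul_inv]
  rw [← inv_div s₁ s₂, ← inv_div u v] at E2
  rw [← inv_div u v] at E1
  rw [inv_inv] at F3
  generalize rOff q h (x₁ / x₂) = ρ at *
  generalize rOff q h (s₁ / s₂) = r at *
  generalize rOff q h (s₁ / s₂)⁻¹ = r' at *
  generalize rDiag q h (u / v) (s₁ / s₂) = a at *
  generalize rDiag q h (u / v)⁻¹ (s₁ / s₂) = d at *
  generalize rDiag q h (u / v) (s₁ / s₂)⁻¹ = a' at *
  generalize rDiag q h (u / v)⁻¹ (s₁ / s₂)⁻¹ = d' at *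
  generalize rDiag q h (u / v) (x₁ / x₂) = b at *
  generalize pairKernel q h u v x₁ x₂ s₂ s₁ = P1 at *
  generalize pairKernel q h u v x₂ x₁ s₂ s₁ = P2 at *
  generalize pairKernel q h u v x₁ x₂ s₁ s₂ = P3 at *
  generalize pairKernel q h u v x₂ x₁ s₁ s₂ = P4 at *
  generalize pairKernel q h v u x₂ x₁ s₁ s₂ = P5 at *
  generalize pairKernel q h v u x₂ x₁ s₂ s₁ = P6 at *
  refine mul_left_cancel₀ (mul_ne_zero r0 r0') ?_
  linear_combination -r * E2 + a * r' * E1 - ρ * P6 * F1 + ρ * P5 * a * F3 - ρ * P5 * r * F2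

/-- The exchange relation propagates through one level: if the functions `f₁, f₂` (with `f₁', f₂'`
their values after the swap `x₁ ↔ x₂`) satisfy it, so do their symmetrizations against the pair
kernels. -/
theorem pairKernel_exchange {q : ℂ} (hq : ‖q‖ < 1) {h u v x₁ x₂ s₁ s₂ : ℂ} (hh : h ≠ 0)
    (hu : u ≠ 0) (hv : v ≠ 0) (hx₁ : x₁ ≠ 0) (hx₂ : x₂ ≠ 0) (hs₁ : s₁ ≠ 0) (hs₂ : s₂ ≠ 0)
    (θh : theta q h ≠ 0) (θu : theta q u ≠ 0) (θv : theta q v ≠ 0) (θw : theta q (u / v) ≠ 0)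
    (θx : theta q (x₁ / x₂) ≠ 0) (θhx : theta q (h * (x₁ / x₂)) ≠ 0)
    (θxh : theta q (h * (x₂ / x₁)) ≠ 0) (θs : theta q (s₁ / s₂) ≠ 0)
    (θhs : theta q (h * (s₁ / s₂)) ≠ 0) (θsh : theta q (h * (s₂ / s₁)) ≠ 0)
    {g g' : ℂ} (hg : g * g' * theta q (u / v) ^ 2 = theta q (u / v / h) * theta q (u / v * h))
    {f₁ f₁' f₂ f₂' : ℂ}
    (hf₁ : f₁' = rDiag q h (u / v) (x₁ / x₂) * f₁ + g * rOff q h (x₁ / x₂) * f₂)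
    (hf₂ : f₂' = rDiag q h (v / u) (x₁ / x₂) * f₂ + g' * rOff q h (x₁ / x₂) * f₁) :
    f₁ * pairKernel q h u v x₁ x₂ s₂ s₁ + f₁' * pairKernel q h u v x₂ x₁ s₂ s₁
      = rDiag q h (u / v) (s₁ / s₂) * (f₁ * pairKernel q h u v x₁ x₂ s₁ s₂
          + f₁' * pairKernel q h u v x₂ x₁ s₁ s₂)
        + g * rOff q h (s₁ / s₂) * (f₂ * pairKernel q h v u x₁ x₂ s₁ s₂
          + f₂' * pairKernel q h v u x₂ x₁ s₁ s₂) := by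
  rw [show h * (x₂ / x₁) = h / (x₁ / x₂) by field_simp] at θxh
  rw [show h * (s₂ / s₁) = h / (s₁ / s₂) by field_simp] at θsh
  have E1 := pairKernel_offDiag hq hh hu hv hx₁ hx₂ hs₁ hs₂ θh θu θv θw θx θhx θxh θhs
  have E2 := pairKernel_diag hq hh hu hv hx₁ hx₂ hs₁ hs₂ θh θu θv θw θx θhx θxh θs θhs θsh hg
  rw [hf₁, hf₂]
  linear_combination f₁ * E2 + g * f₂ * E1

/-- The exchange relation for a position entering at the upper level, first case: the left one of
the two adjacent positions belongs to the lower level. -/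
theorem singleKernel_exchange_left {q : ℂ} (hq : ‖q‖ < 1) {h w x s₁ s₂ : ℂ} (hh : h ≠ 0)
    (hw : w ≠ 0) (hx : x ≠ 0) (hs₁ : s₁ ≠ 0) (hs₂ : s₂ ≠ 0)
    (θh : theta q h ≠ 0) (θw : theta q w ≠ 0) (θu : theta q (w * h) ≠ 0)
    (θhs : theta q (h * (s₁ / s₂)) ≠ 0) :
    theta q (s₂ / x * (w * h)) / theta q (w * h) * theta q (s₁ / x)
      = rDiag q h w (s₁ / s₂) * (theta q (s₁ / x * (w * h)) / theta q (w * h) * theta q (s₂ / x))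
        + theta q h * rOff q h (s₁ / s₂) *
          (theta q (s₁ / x * h) / theta q h * (theta q (s₂ / x * w) / theta q w)) := by
  have key := theta_three_term hq
    (ab := s₂ / x * (w * h)) (a_b := s₁ / x) (cd := h * (s₁ / s₂)) (c_d := w)
    (ac := s₁ / x * (w * h)) (a_c := s₂ / x) (bd := h) (b_d := w / (s₁ / s₂))
    (ad := s₁ / x * h) (a_d := s₂ / x * w) (bc := w * h) (b_c := (s₁ / s₂)⁻¹)
    (by positivity) (by positivity) (by positivity) (by positivity) (by positivity)
    (by positivity) (by positivity) (by positivity) (by positivity) (by positivity)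
    (by positivity) (by positivity)
    (by field_simp) (by field_simp) (by field_simp) (by field_simp) (by field_simp)
    (by field_simp) (by field_simp) (by field_simp)
  rw [theta_inv] at key
  unfold rDiag rOff
  generalize theta q (s₂ / x * (w * h)) = t0 at *
  generalize theta q (s₁ / x * (w * h)) = t1 at *
  generalize theta q (h * (s₁ / s₂)) = t2 at *
  generalize theta q (w / (s₁ / s₂)) = t3 at *
  generalize theta q (s₁ / x * h) = t4 at *
  generalize theta q (s₂ / x * w) = t5 at *
  generalize theta q (w * h) = t6 at *
  generalize theta q (s₁ / s₂) = t7 at *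
  generalize theta q (s₁ / x) = t8 at *
  generalize theta q (s₂ / x) = t9 at *
  generalize theta q (w) = t10 at *
  generalize theta q (h) = t11 at *
  field_simp
  linear_combination key

/-- The exchange relation for a position entering at the upper level, second case: the right one of
the two adjacent positions belongs to the lower level. -/
theorem singleKernel_exchange_right {q : ℂ} (hq : ‖q‖ < 1) {h w x s₁ s₂ : ℂ} (hh : h ≠ 0)
    (hw : w ≠ 0) (hx : x ≠ 0) (hs₁ : s₁ ≠ 0) (hs₂ : s₂ ≠ 0)
    (θh : theta q h ≠ 0) (θw : theta q w ≠ 0) (θu : theta q (w * h) ≠ 0)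
    (θhs : theta q (h * (s₁ / s₂)) ≠ 0) :
    theta q (s₂ / x * h) / theta q h * (theta q (s₁ / x * w) / theta q w)
      = rDiag q h w⁻¹ (s₁ / s₂) *
          (theta q (s₁ / x * h) / theta q h * (theta q (s₂ / x * w) / theta q w))
        + theta q (w / h) * theta q (w * h) / (theta q h * theta q w ^ 2) * rOff q h (s₁ / s₂) *
          (theta q (s₁ / x * (w * h)) / theta q (w * h) * theta q (s₂ / x)) := by
  have key := theta_three_term hq
    (ab := s₂ / x * h) (a_b := s₁ / x * w) (cd := h * (s₁ / s₂)) (c_d := w⁻¹)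
    (ac := s₁ / x * h) (a_c := s₂ / x * w) (bd := h) (b_d := w⁻¹ / (s₁ / s₂))
    (ad := s₁ / x * (w * h)) (a_d := s₂ / x) (bc := h / w) (b_c := (s₁ / s₂)⁻¹)
    (by positivity) (by positivity) (by positivity) (by positivity) (by positivity)
    (by positivity) (by positivity) (by positivity) (by positivity) (by positivity)
    (by positivity) (by positivity)
    (by field_simp) (by field_simp) (by field_simp) (by field_simp) (by field_simp)
    (by field_simp) (by field_simp) (by field_simp)
  rw [theta_inv q w, theta_inv q (s₁ / s₂), theta_ratio_swap q w h] at key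
  unfold rDiag rOff
  rw [theta_inv q w]
  generalize theta q (s₂ / x * h) = t0 at *
  generalize theta q (s₁ / x * (w * h)) = t1 at *
  generalize theta q (h * (s₁ / s₂)) = t2 at *
  generalize theta q (w⁻¹ / (s₁ / s₂)) = t3 at *
  generalize theta q (s₁ / x * h) = t4 at *
  generalize theta q (s₂ / x * w) = t5 at *
  generalize theta q (s₁ / x * w) = t6 at *
  generalize theta q (w * h) = t7 at *
  generalize theta q (w / h) = t8 at *
  generalize theta q (s₁ / s₂) = t9 at *
  generalize theta q (s₁ / x) = t10 at *
  generalize theta q (s₂ / x) = t11 at *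
  generalize theta q (w) = t12 at *
  generalize theta q (h) = t13 at *
  field_simp
  linear_combination (-1) * key

/-! ### Weight functions of colourings -/

section Colouring

variable {m n : ℕ}

/-- The positions of colour at most `k`: the set `I^{(k)}` for the colouring attached to `I`. -/
def lvl (c : Fin n → Fin (m + 1)) (k : Fin (m + 1)) : Finset (Fin n) := univ.filter (c · ≤ k)

/-- The number of positions of colour `j` to the left of `a`. -/
def cpos (c : Fin n → Fin (m + 1)) (j : Fin (m + 1)) (a : Fin n) : ℕ :=
  (univ.filter fun x => x < a ∧ c x = j).card

/-- The dynamical argument attached to position `a` at level `k`. -/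
def dyn (h : ℂ) (μ : Fin (m + 1) → ℂ) (c : Fin n → Fin (m + 1)) (k : Fin m) (a : Fin n) : ℂ :=
  μ k.succ / μ (c a) * h ^ (1 + (cpos c (c a) a : ℤ) - (cpos c k.succ a : ℤ))

/-- The factor of the numerator of the weight function at the positions `a` of level `k` and `b` of
level `k + 1`, evaluated at the quotient `x` of their values. -/
def psiC (q h : ℂ) (μ : Fin (m + 1) → ℂ) (c : Fin n → Fin (m + 1)) (k : Fin m) (a b : Fin n)
    (x : ℂ) : ℂ :=
  if b < a then theta q (x * h) / theta q h
  else if b = a then theta q (x * dyn h μ c k a) / theta q (dyn h μ c k a)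
  else theta q x

/-- The factor of the denominator at the positions `a, b` of the same level, carrying the values
`y, x`; it is `1` for `a = b`. -/
def denC (q h : ℂ) (a b : Fin n) (x y : ℂ) : ℂ :=
  if a < b then 1 / theta q (x / y) else if b < a then theta q h / theta q (h * x / y) else 1

/-- The part of the weight function involving the levels `k` and `k + 1`, whose variables are
`w` and `v`.  Variables of a level are functions of all positions, of which only the values on the
level matter. -/
def kern (q h : ℂ) (μ : Fin (m + 1) → ℂ) (c : Fin n → Fin (m + 1)) (k : Fin m)
    (w v : Fin n → ℂ) : ℂ :=
  (∏ a ∈ lvl c k.castSucc, ∏ b ∈ lvl c k.succ, psiC q h μ c k a b (v b / w a)) *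
    ∏ a ∈ lvl c k.castSucc, ∏ b ∈ lvl c k.castSucc, denC q h a b (w b) (w a)

/-- The ways of assigning the values in `V` bijectively to the positions in `s` (extended by zero
to the other positions). -/
def assign (V : Finset ℂ) (s : Finset (Fin n)) : Finset (Fin n → ℂ) := by
  classical
  exact (Fintype.piFinset fun _ => insert 0 V).filter
    fun w => Set.BijOn w s V ∧ ∀ x, x ∉ s → w x = 0

theorem mem_assign {V : Finset ℂ} {s : Finset (Fin n)} {w : Fin n → ℂ} :
    w ∈ assign V s ↔ Set.BijOn w s V ∧ ∀ x, x ∉ s → w x = 0 := by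
  classical
  simp only [assign, mem_filter, Fintype.mem_piFinset, mem_insert, and_iff_right_iff_imp]
  rintro ⟨h1, h2⟩ x
  by_cases hx : x ∈ s
  · exact Or.inr (h1.mapsTo hx)
  · exact Or.inl (h2 x hx)

/-- The partial weight function built from the levels up to `k`, as a function of the variables of
level `k`; the variables of a lower level `j` run over the assignments of the values `V j`. -/
def gfun (q h : ℂ) (μ : Fin (m + 1) → ℂ) (V : Fin m → Finset ℂ) (c : Fin n → Fin (m + 1))
    (k : Fin (m + 1)) : (Fin n → ℂ) → ℂ :=
  Fin.induction (motive := fun _ => (Fin n → ℂ) → ℂ) (fun _ => 1)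
    (fun k G v => ∑ w ∈ assign (V k) (lvl c k.castSucc), G w * kern q h μ c k w v) k

theorem gfun_zero (q h : ℂ) (μ : Fin (m + 1) → ℂ) (V : Fin m → Finset ℂ)
    (c : Fin n → Fin (m + 1)) (v : Fin n → ℂ) : gfun q h μ V c 0 v = 1 := rfl

theorem gfun_succ (q h : ℂ) (μ : Fin (m + 1) → ℂ) (V : Fin m → Finset ℂ)
    (c : Fin n → Fin (m + 1)) (k : Fin m) (v : Fin n → ℂ) : gfun q h μ V c k.succ v =
      ∑ w ∈ assign (V k) (lvl c k.castSucc), gfun q h μ V c k.castSucc w * kern q h μ c k w v :=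
  rfl

theorem mem_lvl {c : Fin n → Fin (m + 1)} {k : Fin (m + 1)} {a : Fin n} :
    a ∈ lvl c k ↔ c a ≤ k := by simp [lvl]

/-! ### Swapping two adjacent positions -/

variable {i i' : Fin n}

/-- Both positions belong to the pair `{i, i'}`. -/
def InPair (i i' a b : Fin n) : Prop := (a = i ∨ a = i') ∧ (b = i ∨ b = i')

theorem swap_cases (i i' a : Fin n) :
    (a = i ∧ Equiv.swap i i' a = i') ∨ (a = i' ∧ Equiv.swap i i' a = i) ∨
      (a ≠ i ∧ a ≠ i' ∧ Equiv.swap i i' a = a) := by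
  by_cases h1 : a = i
  · exact Or.inl ⟨h1, by rw [h1, Equiv.swap_apply_left]⟩
  · by_cases h2 : a = i'
    · exact Or.inr (Or.inl ⟨h2, by rw [h2, Equiv.swap_apply_right]⟩)
    · exact Or.inr (Or.inr ⟨h1, h2, Equiv.swap_apply_of_ne_of_ne h1 h2⟩)

theorem inPair_swap_left (a b : Fin n) : InPair i i' (Equiv.swap i i' a) b ↔ InPair i i' a b := by
  rcases swap_cases i i' a with ⟨h, h'⟩ | ⟨h, h'⟩ | ⟨h, h1, h'⟩ <;> rw [h'] <;> simp [InPair, h]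

theorem inPair_swap_right (a b : Fin n) :
    InPair i i' a (Equiv.swap i i' b) ↔ InPair i i' a b := by
  rcases swap_cases i i' b with ⟨h, h'⟩ | ⟨h, h'⟩ | ⟨h, h1, h'⟩ <;> rw [h'] <;> simp [InPair, h]

theorem swap_lt_left (hi : (i : ℕ) + 1 = i') {a b : Fin n} (hab : ¬ InPair i i' a b) :
    Equiv.swap i i' a < b ↔ a < b := by
  rcases swap_cases i i' a with ⟨h, h'⟩ | ⟨h, h'⟩ | ⟨h, h1, h'⟩ <;> rw [h']
  all_goals
    simp only [InPair, Fin.ext_iff, Fin.lt_def] at *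
    omega

theorem lt_swap_right (hi : (i : ℕ) + 1 = i') {a b : Fin n} (hab : ¬ InPair i i' a b) :
    a < Equiv.swap i i' b ↔ a < b := by
  rcases swap_cases i i' b with ⟨h, h'⟩ | ⟨h, h'⟩ | ⟨h, h1, h'⟩ <;> rw [h']
  all_goals
    simp only [InPair, Fin.ext_iff, Fin.lt_def] at *
    omega

theorem inPair_comm {a b : Fin n} : InPair i i' a b ↔ InPair i i' b a := and_comm

theorem swap_lt_right (hi : (i : ℕ) + 1 = i') {a b : Fin n} (hab : ¬ InPair i i' a b) :
    Equiv.swap i i' b < a ↔ b < a := swap_lt_left hi (inPair_comm.not.1 hab)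

theorem lt_swap_left (hi : (i : ℕ) + 1 = i') {a b : Fin n} (hab : ¬ InPair i i' a b) :
    b < Equiv.swap i i' a ↔ b < a := lt_swap_right hi (inPair_comm.not.1 hab)

theorem swap_eq_right {a b : Fin n} (hab : ¬ InPair i i' a b) :
    Equiv.swap i i' b = a ↔ b = a := by
  rcases swap_cases i i' b with ⟨h, h'⟩ | ⟨h, h'⟩ | ⟨h, h1, h'⟩ <;> rw [h']
  all_goals
    simp only [InPair, Fin.ext_iff] at *
    omega

theorem mem_lvl_swap {c : Fin n → Fin (m + 1)} {k : Fin (m + 1)} {a : Fin n} :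
    a ∈ lvl (c ∘ Equiv.swap i i') k ↔ Equiv.swap i i' a ∈ lvl c k := by simp [mem_lvl]

theorem prod_lvl_swap (c : Fin n → Fin (m + 1)) (k : Fin (m + 1)) (f : Fin n → ℂ) :
    ∏ a ∈ lvl (c ∘ Equiv.swap i i') k, f a = ∏ a ∈ lvl c k, f (Equiv.swap i i' a) :=
  prod_equiv (Equiv.swap i i') (fun _ => mem_lvl_swap) fun _ _ => by simp

theorem lvl_swap_eq {c : Fin n → Fin (m + 1)} {k : Fin (m + 1)} (h : i ∈ lvl c k ↔ i' ∈ lvl c k) :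
    lvl (c ∘ Equiv.swap i i') k = lvl c k := by
  ext a
  rw [mem_lvl_swap]
  rcases swap_cases i i' a with ⟨h, h'⟩ | ⟨h, h'⟩ | ⟨h, h1, h'⟩ <;> rw [h'] <;> simp [*]

theorem prod_lvl_swap_of_iff {c : Fin n → Fin (m + 1)} {k : Fin (m + 1)}
    (h : i ∈ lvl c k ↔ i' ∈ lvl c k) (f : Fin n → ℂ) :
    ∏ a ∈ lvl c k, f (Equiv.swap i i' a) = ∏ a ∈ lvl c k, f a := by
  rw [← prod_lvl_swap, lvl_swap_eq h]

theorem cpos_succ (hi : (i : ℕ) + 1 = i') (c : Fin n → Fin (m + 1)) (j : Fin (m + 1)) :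
    cpos c j i' = cpos c j i + if c i = j then 1 else 0 := by
  unfold cpos
  have : (univ.filter fun x => x < i' ∧ c x = j) =
      (univ.filter fun x => x < i ∧ c x = j) ∪ (({i} : Finset (Fin n)).filter (c · = j)) := by
    ext x
    simp only [mem_filter, mem_univ, true_and, mem_union, mem_singleton, Fin.lt_def, Fin.ext_iff]
    omega
  rw [this, card_union_of_disjoint, filter_singleton]
  · split_ifs <;> simp
  · rw [disjoint_left]
    intro x h1 h2
    simp only [mem_filter, mem_singleton, mem_univ, true_and] at h1 h2
    exact absurd h2.1 h1.1.ne

theorem cpos_swap (hi : (i : ℕ) + 1 = i') (c : Fin n → Fin (m + 1)) (j : Fin (m + 1)) {a : Fin n}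
    (ha : a ≠ i') : cpos (c ∘ Equiv.swap i i') j a = cpos c j a := by
  unfold cpos
  refine card_equiv (Equiv.swap i i') fun x => ?_
  simp only [mem_filter, mem_univ, true_and, Function.comp]
  refine and_congr_left fun _ => ?_
  rcases swap_cases i i' x with ⟨h, h'⟩ | ⟨h, h'⟩ | ⟨h, h1, h'⟩ <;> rw [h']
  all_goals
    simp only [Fin.ext_iff, Fin.lt_def, ne_eq] at *
    omega

theorem cpos_swap_right (hi : (i : ℕ) + 1 = i') (c : Fin n → Fin (m + 1)) (j : Fin (m + 1)) :
    cpos (c ∘ Equiv.swap i i') j i' = cpos c j i + if c i' = j then 1 else 0 := by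
  have hne : i ≠ i' := by rintro rfl; omega
  rw [cpos_succ hi, cpos_swap hi c j hne]
  simp

theorem dyn_swap_of_ne (hi : (i : ℕ) + 1 = i') (h : ℂ) (μ : Fin (m + 1) → ℂ)
    (c : Fin n → Fin (m + 1)) (k : Fin m) {a : Fin n} (ha : a ≠ i) (ha' : a ≠ i') :
    dyn h μ (c ∘ Equiv.swap i i') k a = dyn h μ c k a := by
  unfold dyn
  rw [cpos_swap hi c _ ha', cpos_swap hi c _ ha', Function.comp,
    Equiv.swap_apply_of_ne_of_ne ha ha']

/-- If only one of the two adjacent positions is in play, the dynamical argument moves along with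
its position. -/
theorem dyn_swap (hi : (i : ℕ) + 1 = i') (h : ℂ) (μ : Fin (m + 1) → ℂ)
    (c : Fin n → Fin (m + 1)) (k : Fin m) (hk : ¬ (c i ≤ k.succ ∧ c i' ≤ k.succ)) {a : Fin n}
    (ha : c a ≤ k.succ) :
    dyn h μ (c ∘ Equiv.swap i i') k (Equiv.swap i i' a) = dyn h μ c k a := by
  have hne : i ≠ i' := by rintro rfl; omega
  rcases swap_cases i i' a with ⟨rfl, h'⟩ | ⟨rfl, h'⟩ | ⟨h1, h2, h'⟩ <;> rw [h']
  · have h1 : c i' ≠ k.succ := fun e => hk ⟨ha, e.le⟩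
    have h2 : c i' ≠ c a := fun e => hk ⟨ha, e.le.trans ha⟩
    unfold dyn
    rw [cpos_swap_right hi, cpos_swap_right hi]
    simp [h1, h2]
  · have h1 : c i ≠ k.succ := fun e => hk ⟨e.le, ha⟩
    have h2 : c i ≠ c a := fun e => hk ⟨e.le.trans ha, ha⟩
    unfold dyn
    rw [cpos_swap hi c _ hne, cpos_swap hi c _ hne, cpos_succ hi, cpos_succ hi]
    simp [h1, h2]
  · exact dyn_swap_of_ne hi h μ c k h1 h2

theorem psiC_swap_left (hi : (i : ℕ) + 1 = i') (q h : ℂ) (μ : Fin (m + 1) → ℂ)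
    (c : Fin n → Fin (m + 1)) (k : Fin m) {a b : Fin n} (hab : ¬ InPair i i' a b) (x : ℂ) :
    psiC q h μ c k (Equiv.swap i i' a) b x = psiC q h μ c k a b x := by
  have e : b = Equiv.swap i i' a ↔ b = a := by
    rw [eq_comm, swap_eq_right (inPair_comm.not.1 hab), eq_comm]
  unfold psiC
  simp only [lt_swap_left hi hab, e]
  split_ifs with h1 h2
  · rfl
  · subst h2
    have h3 : b ≠ i ∧ b ≠ i' := by simpa [InPair, not_or] using hab
    rw [Equiv.swap_apply_of_ne_of_ne h3.1 h3.2]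
  · rfl

theorem psiC_swap_right (hi : (i : ℕ) + 1 = i') (q h : ℂ) (μ : Fin (m + 1) → ℂ)
    (c : Fin n → Fin (m + 1)) (k : Fin m) {a b : Fin n} (hab : ¬ InPair i i' a b) (x : ℂ) :
    psiC q h μ c k a (Equiv.swap i i' b) x = psiC q h μ c k a b x := by
  unfold psiC
  simp only [swap_lt_right hi hab, swap_eq_right hab]

theorem psiC_swap_colour (hi : (i : ℕ) + 1 = i') (q h : ℂ) (μ : Fin (m + 1) → ℂ)
    (c : Fin n → Fin (m + 1)) (k : Fin m) {a b : Fin n} (hab : ¬ InPair i i' a b) (x : ℂ) :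
    psiC q h μ (c ∘ Equiv.swap i i') k a b x = psiC q h μ c k a b x := by
  unfold psiC
  split_ifs with h1 h2
  · rfl
  · subst h2
    have h3 : b ≠ i ∧ b ≠ i' := by simpa [InPair, not_or] using hab
    rw [dyn_swap_of_ne hi h μ c k h3.1 h3.2]
  · rfl

theorem denC_swap_left (hi : (i : ℕ) + 1 = i') (q h : ℂ) {a b : Fin n} (hab : ¬ InPair i i' a b)
    (x y : ℂ) : denC q h (Equiv.swap i i' a) b x y = denC q h a b x y := by
  unfold denC
  simp only [lt_swap_left hi hab, swap_lt_left hi hab]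

theorem denC_swap_right (hi : (i : ℕ) + 1 = i') (q h : ℂ) {a b : Fin n} (hab : ¬ InPair i i' a b)
    (x y : ℂ) : denC q h a (Equiv.swap i i' b) x y = denC q h a b x y := by
  unfold denC
  simp only [lt_swap_right hi hab, swap_lt_right hi hab]

open Classical in
/-- The part of `kern` formed by the factors in which at most one of the two positions is in the
pair `{i, i'}`. -/
def kernRest (q h : ℂ) (μ : Fin (m + 1) → ℂ) (i i' : Fin n) (c : Fin n → Fin (m + 1)) (k : Fin m)
    (w v : Fin n → ℂ) : ℂ :=
  (∏ a ∈ lvl c k.castSucc, ∏ b ∈ lvl c k.succ,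
      if InPair i i' a b then 1 else psiC q h μ c k a b (v b / w a)) *
    ∏ a ∈ lvl c k.castSucc, ∏ b ∈ lvl c k.castSucc,
      if InPair i i' a b then 1 else denC q h a b (w b) (w a)

theorem kernRest_swap (hi : (i : ℕ) + 1 = i') (q h : ℂ) (μ : Fin (m + 1) → ℂ)
    (c : Fin n → Fin (m + 1)) (k : Fin m) (w v : Fin n → ℂ) :
    kernRest q h μ i i' (c ∘ Equiv.swap i i') k (w ∘ Equiv.swap i i') (v ∘ Equiv.swap i i') =
      kernRest q h μ i i' c k w v := by
  classical
  unfold kernRest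
  congr 1
  · rw [prod_lvl_swap]
    refine prod_congr rfl fun a _ => ?_
    rw [prod_lvl_swap]
    refine prod_congr rfl fun b _ => ?_
    rw [inPair_swap_left, inPair_swap_right]
    split_ifs with h1
    · rfl
    · rw [psiC_swap_colour hi, psiC_swap_left hi, psiC_swap_right hi _ _ _ _ _ h1]
      · simp
      · rwa [inPair_swap_right]
      · rwa [inPair_swap_left, inPair_swap_right]
  · rw [prod_lvl_swap]
    refine prod_congr rfl fun a _ => ?_
    rw [prod_lvl_swap]
    refine prod_congr rfl fun b _ => ?_
    rw [inPair_swap_left, inPair_swap_right]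
    split_ifs with h1
    · rfl
    · rw [denC_swap_left hi, denC_swap_right hi _ _ h1]
      · simp
      · rwa [inPair_swap_right]

theorem kernRest_swap_upper (hi : (i : ℕ) + 1 = i') (q h : ℂ) (μ : Fin (m + 1) → ℂ)
    (c : Fin n → Fin (m + 1)) (k : Fin m) (hk : i ∈ lvl c k.succ ↔ i' ∈ lvl c k.succ)
    (w v : Fin n → ℂ) :
    kernRest q h μ i i' c k w (v ∘ Equiv.swap i i') = kernRest q h μ i i' c k w v := by
  classical
  unfold kernRest
  congr 1
  refine prod_congr rfl fun a _ => ?_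
  rw [← prod_lvl_swap_of_iff hk]
  refine prod_congr rfl fun b _ => ?_
  rw [inPair_swap_right]
  split_ifs with h1
  · rfl
  · rw [psiC_swap_right hi _ _ _ _ _ h1]
    simp

theorem kernRest_swap_lower (hi : (i : ℕ) + 1 = i') (q h : ℂ) (μ : Fin (m + 1) → ℂ)
    (c : Fin n → Fin (m + 1)) (k : Fin m) (hk : i ∈ lvl c k.castSucc ↔ i' ∈ lvl c k.castSucc)
    (w v : Fin n → ℂ) :
    kernRest q h μ i i' c k (w ∘ Equiv.swap i i') v = kernRest q h μ i i' c k w v := by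
  classical
  unfold kernRest
  congr 1
  · rw [← prod_lvl_swap_of_iff hk]
    refine prod_congr rfl fun a _ => prod_congr rfl fun b _ => ?_
    rw [inPair_swap_left]
    split_ifs with h1
    · rfl
    · rw [psiC_swap_left hi _ _ _ _ _ h1]
      simp
  · rw [← prod_lvl_swap_of_iff hk]
    refine prod_congr rfl fun a _ => ?_
    rw [← prod_lvl_swap_of_iff hk]
    refine prod_congr rfl fun b _ => ?_
    rw [inPair_swap_left, inPair_swap_right]
    split_ifs with h1
    · rfl
    · rw [denC_swap_left hi, denC_swap_right hi _ _ h1]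
      · simp
      · rwa [inPair_swap_right]

theorem kern_swap (hi : (i : ℕ) + 1 = i') (q h : ℂ) (μ : Fin (m + 1) → ℂ)
    (c : Fin n → Fin (m + 1)) (k : Fin m) (hk : ¬ (c i ≤ k.succ ∧ c i' ≤ k.succ))
    (w v : Fin n → ℂ) :
    kern q h μ (c ∘ Equiv.swap i i') k (w ∘ Equiv.swap i i') (v ∘ Equiv.swap i i') =
      kern q h μ c k w v := by
  have hpair : ∀ a b, c a ≤ k.succ → c b ≤ k.succ → InPair i i' a b → a = b := by
    rintro a b ha hb ⟨rfl | rfl, rfl | rfl⟩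
    · rfl
    · exact absurd ⟨ha, hb⟩ hk
    · exact absurd ⟨hb, ha⟩ hk
    · rfl
  have hle : k.castSucc ≤ k.succ := Fin.castSucc_lt_succ.le
  unfold kern
  congr 1
  · rw [prod_lvl_swap]
    refine prod_congr rfl fun a ha => ?_
    rw [prod_lvl_swap]
    refine prod_congr rfl fun b hb => ?_
    rw [mem_lvl] at ha hb
    simp only [Function.comp_apply, Equiv.swap_apply_self]
    by_cases hab : InPair i i' a b
    · obtain rfl := hpair a b (ha.trans hle) hb hab
      simp [psiC, dyn_swap hi h μ c k hk hb]
    · rw [psiC_swap_colour hi, psiC_swap_left hi, psiC_swap_right hi _ _ _ _ _ hab]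
      · rwa [inPair_swap_right]
      · rwa [inPair_swap_left, inPair_swap_right]
  · rw [prod_lvl_swap]
    refine prod_congr rfl fun a ha => ?_
    rw [prod_lvl_swap]
    refine prod_congr rfl fun b hb => ?_
    rw [mem_lvl] at ha hb
    simp only [Function.comp_apply, Equiv.swap_apply_self]
    by_cases hab : InPair i i' a b
    · obtain rfl := hpair a b (ha.trans hle) (hb.trans hle) hab
      simp [denC]
    · rw [denC_swap_left hi, denC_swap_right hi _ _ hab]
      rwa [inPair_swap_right]

theorem comp_swap_swap {α : Type*} (f : Fin n → α) :
    (f ∘ Equiv.swap i i') ∘ Equiv.swap i i' = f := by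
  funext a
  simp

theorem comp_swap_mem_assign {V : Finset ℂ} {c : Fin n → Fin (m + 1)} {k : Fin (m + 1)}
    {w : Fin n → ℂ} (hw : w ∈ assign V (lvl c k)) :
    w ∘ Equiv.swap i i' ∈ assign V (lvl (c ∘ Equiv.swap i i') k) := by
  rw [mem_assign] at hw ⊢
  refine ⟨hw.1.comp ⟨fun a ha => mem_lvl_swap.1 ha, (Equiv.injective _).injOn, fun a ha => ?_⟩,
    fun a ha => hw.2 _ fun h => ha (mem_lvl_swap.2 h)⟩
  exact ⟨Equiv.swap i i' a, mem_lvl_swap.2 (by simpa using ha), by simp⟩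

theorem sum_assign_swap (V : Finset ℂ) (c : Fin n → Fin (m + 1)) (k : Fin (m + 1))
    (F : (Fin n → ℂ) → ℂ) :
    ∑ w ∈ assign V (lvl (c ∘ Equiv.swap i i') k), F w =
      ∑ w ∈ assign V (lvl c k), F (w ∘ Equiv.swap i i') := by
  refine (sum_nbij' (· ∘ Equiv.swap i i') (· ∘ Equiv.swap i i')
    (fun w hw => comp_swap_mem_assign hw) (fun w hw => ?_) (fun w _ => comp_swap_swap w)
    (fun w _ => comp_swap_swap w) fun w _ => rfl).symm
  have := comp_swap_mem_assign (i := i) (i' := i') hw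
  rwa [comp_swap_swap] at this

/-- If at most one of two adjacent positions belongs to the level, swapping them amounts to a
relabelling. -/
theorem gfun_swap (hi : (i : ℕ) + 1 = i') (q h : ℂ) (μ : Fin (m + 1) → ℂ) (V : Fin m → Finset ℂ)
    (c : Fin n → Fin (m + 1)) (k : Fin (m + 1)) (hk : ¬ (c i ≤ k ∧ c i' ≤ k)) (v : Fin n → ℂ) :
    gfun q h μ V (c ∘ Equiv.swap i i') k (v ∘ Equiv.swap i i') = gfun q h μ V c k v := by
  induction k using Fin.induction generalizing v with
  | zero => rw [gfun_zero, gfun_zero]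
  | succ k ih =>
    have hle : k.castSucc ≤ k.succ := Fin.castSucc_lt_succ.le
    rw [gfun_succ, gfun_succ, sum_assign_swap]
    refine sum_congr rfl fun w _ => ?_
    rw [ih (fun h => hk ⟨h.1.trans hle, h.2.trans hle⟩), kern_swap hi q h μ c k hk]

open Classical in
theorem prod_pair_split (i i' : Fin n) (A B : Finset (Fin n)) (f : Fin n → Fin n → ℂ) :
    ∏ a ∈ A, ∏ b ∈ B, f a b = (∏ a ∈ A, ∏ b ∈ B, if InPair i i' a b then 1 else f a b) *
      ∏ a ∈ A with a = i ∨ a = i', ∏ b ∈ B with b = i ∨ b = i', f a b := by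
  have h2 : (∏ a ∈ A with a = i ∨ a = i', ∏ b ∈ B with b = i ∨ b = i', f a b) =
      ∏ a ∈ A, ∏ b ∈ B, if InPair i i' a b then f a b else 1 := by
    rw [prod_filter]
    refine prod_congr rfl fun a _ => ?_
    split_ifs with h
    · rw [prod_filter]
      refine prod_congr rfl fun b _ => ?_
      simp [InPair, h]
    · rw [prod_eq_one]
      intro b _
      simp [InPair, h]
  rw [h2, ← prod_mul_distrib]
  refine prod_congr rfl fun a _ => ?_
  rw [← prod_mul_distrib]
  refine prod_congr rfl fun b _ => ?_
  split_ifs <;> simp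

theorem filter_pair_both {A : Finset (Fin n)} (h : i ∈ A) (h' : i' ∈ A) :
    A.filter (fun a => a = i ∨ a = i') = {i, i'} := by
  ext a
  simp only [mem_filter, mem_insert, mem_singleton]
  constructor
  · exact fun h => h.2
  · rintro (rfl | rfl) <;> simp [h, h']

theorem filter_pair_left {A : Finset (Fin n)} (h : i ∈ A) (h' : i' ∉ A) :
    A.filter (fun a => a = i ∨ a = i') = {i} := by
  ext a
  simp only [mem_filter, mem_singleton]
  constructor
  · rintro ⟨h1, rfl | rfl⟩
    · rfl
    · exact absurd h1 h'
  · rintro rfl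
    simp [h]

theorem filter_pair_right {A : Finset (Fin n)} (h : i ∉ A) (h' : i' ∈ A) :
    A.filter (fun a => a = i ∨ a = i') = {i'} := by
  simpa only [or_comm] using filter_pair_left h' h

theorem filter_pair_none {A : Finset (Fin n)} (h : i ∉ A) (h' : i' ∉ A) :
    A.filter (fun a => a = i ∨ a = i') = ∅ := by
  ext a
  simp only [mem_filter, notMem_empty, iff_false, not_and]
  rintro ha (rfl | rfl)
  · exact h ha
  · exact h' ha

theorem kern_eq_both (hi : (i : ℕ) + 1 = i') (q h : ℂ) (μ : Fin (m + 1) → ℂ)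
    (c : Fin n → Fin (m + 1)) (k : Fin m) (h1 : c i ≤ k.castSucc) (h2 : c i' ≤ k.castSucc)
    (w v : Fin n → ℂ) :
    kern q h μ c k w v = kernRest q h μ i i' c k w v *
      pairKernel q h (dyn h μ c k i) (dyn h μ c k i') (w i) (w i') (v i) (v i') := by
  classical
  have hle : k.castSucc ≤ k.succ := Fin.castSucc_lt_succ.le
  have hlt : i < i' := Fin.lt_def.2 (by omega)
  unfold kern kernRest
  rw [prod_pair_split i i', prod_pair_split i i' (lvl c k.castSucc) (lvl c k.castSucc),
    filter_pair_both (mem_lvl.2 h1) (mem_lvl.2 h2),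
    filter_pair_both (mem_lvl.2 (h1.trans hle)) (mem_lvl.2 (h2.trans hle))]
  simp only [prod_pair hlt.ne, psiC, denC, hlt, hlt.not_gt, hlt.ne', if_true, if_false,
    lt_irrefl, pairKernel]
  ring

theorem kern_eq_left (hi : (i : ℕ) + 1 = i') (q h : ℂ) (μ : Fin (m + 1) → ℂ)
    (c : Fin n → Fin (m + 1)) (k : Fin m) (h1 : c i ≤ k.castSucc) (h2 : c i' = k.succ)
    (w v : Fin n → ℂ) :
    kern q h μ c k w v = kernRest q h μ i i' c k w v *
      (theta q (v i / w i * dyn h μ c k i) / theta q (dyn h μ c k i) * theta q (v i' / w i)) := by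
  classical
  have hle : k.castSucc ≤ k.succ := Fin.castSucc_lt_succ.le
  have hlt : i < i' := Fin.lt_def.2 (by omega)
  have h2' : i' ∉ lvl c k.castSucc := by
    rw [mem_lvl, h2, not_le]
    exact Fin.castSucc_lt_succ
  unfold kern kernRest
  rw [prod_pair_split i i', prod_pair_split i i' (lvl c k.castSucc) (lvl c k.castSucc),
    filter_pair_left (mem_lvl.2 h1) h2',
    filter_pair_both (mem_lvl.2 (h1.trans hle)) (mem_lvl.2 h2.le),
    prod_singleton, prod_singleton, prod_singleton, prod_pair hlt.ne]
  simp only [psiC, denC, hlt.not_gt, hlt.ne', if_true, if_false, lt_irrefl]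
  ring

theorem kern_eq_right (hi : (i : ℕ) + 1 = i') (q h : ℂ) (μ : Fin (m + 1) → ℂ)
    (c : Fin n → Fin (m + 1)) (k : Fin m) (h1 : c i = k.succ) (h2 : c i' ≤ k.castSucc)
    (w v : Fin n → ℂ) :
    kern q h μ c k w v = kernRest q h μ i i' c k w v *
      (theta q (v i / w i' * h) / theta q h *
        (theta q (v i' / w i' * dyn h μ c k i') / theta q (dyn h μ c k i'))) := by
  classical
  have hle : k.castSucc ≤ k.succ := Fin.castSucc_lt_succ.le
  have hlt : i < i' := Fin.lt_def.2 (by omega)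
  have h1' : i ∉ lvl c k.castSucc := by
    rw [mem_lvl, h1, not_le]
    exact Fin.castSucc_lt_succ
  unfold kern kernRest
  rw [prod_pair_split i i', prod_pair_split i i' (lvl c k.castSucc) (lvl c k.castSucc),
    filter_pair_right h1' (mem_lvl.2 h2),
    filter_pair_both (mem_lvl.2 h1.le) (mem_lvl.2 (h2.trans hle)),
    prod_singleton, prod_singleton, prod_singleton, prod_pair hlt.ne]
  simp only [psiC, denC, hlt, if_true, if_false, lt_irrefl]
  ring

theorem kern_eq_none (q h : ℂ) (μ : Fin (m + 1) → ℂ)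
    (c : Fin n → Fin (m + 1)) (k : Fin m) (h1 : c i = k.succ) (h2 : c i' = k.succ)
    (w v : Fin n → ℂ) :
    kern q h μ c k w v = kernRest q h μ i i' c k w v := by
  classical
  have h1' : i ∉ lvl c k.castSucc := by
    rw [mem_lvl, h1, not_le]
    exact Fin.castSucc_lt_succ
  have h2' : i' ∉ lvl c k.castSucc := by
    rw [mem_lvl, h2, not_le]
    exact Fin.castSucc_lt_succ
  unfold kern kernRest
  rw [prod_pair_split i i', prod_pair_split i i' (lvl c k.castSucc) (lvl c k.castSucc),
    filter_pair_none h1' h2', prod_empty, prod_empty, mul_one, mul_one]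

end Colouring

/-! ### The exchange relation -/

section Exchange

variable {m n : ℕ}

/-- The assumptions on `ħ` and `μ` of the orthogonality relation. -/
structure Nondeg (q h : ℂ) (μ : Fin (m + 1) → ℂ) (lam : Fin (m + 1) → ℕ) : Prop where
  h_ne : h ≠ 0
  μ_ne : ∀ j, μ j ≠ 0
  theta_h : theta q h ≠ 0
  theta_μ : ∀ j k, j < k → lam j ≠ 0 → ∀ e : ℤ, -(lam k : ℤ) ≤ e → e ≤ (lam j : ℤ) →
    theta q (μ k / μ j * h ^ e) ≠ 0

/-- The colouring `c` takes each value `j` exactly `lam j` times. -/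
def HasContent (c : Fin n → Fin (m + 1)) (lam : Fin (m + 1) → ℕ) : Prop :=
  ∀ j, (univ.filter fun x => c x = j).card = lam j

/-- The values of `v` at the positions in `s` are in general position: they are nonzero, and `ϑ`
does not vanish at their mutual quotients, nor at `ħ` times these. -/
def GoodOn (q h : ℂ) (s : Finset (Fin n)) (v : Fin n → ℂ) : Prop :=
  (∀ a ∈ s, v a ≠ 0) ∧
    ∀ a ∈ s, ∀ b ∈ s, a ≠ b → theta q (v a / v b) ≠ 0 ∧ theta q (h * (v a / v b)) ≠ 0

/-- The elements of `V` are in general position, in the sense of `GoodOn`. -/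
def GoodSet (q h : ℂ) (V : Finset ℂ) : Prop :=
  (∀ x ∈ V, x ≠ 0) ∧ ∀ x ∈ V, ∀ y ∈ V, x ≠ y → theta q (x / y) ≠ 0 ∧ theta q (h * (x / y)) ≠ 0

theorem GoodSet.goodOn {q h : ℂ} {V : Finset ℂ} (hV : GoodSet q h V) {s : Finset (Fin n)}
    {w : Fin n → ℂ} (hw : w ∈ assign V s) : GoodOn q h s w := by
  rw [mem_assign] at hw
  exact ⟨fun a ha => hV.1 _ (hw.1.mapsTo ha), fun a ha b hb hab =>
    hV.2 _ (hw.1.mapsTo ha) _ (hw.1.mapsTo hb) fun e => hab (hw.1.injOn ha hb e)⟩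

variable {q h : ℂ} {μ : Fin (m + 1) → ℂ} {lam : Fin (m + 1) → ℕ} {c : Fin n → Fin (m + 1)}
  {i i' : Fin n}

theorem HasContent.swap (hc : HasContent c lam) (i i' : Fin n) :
    HasContent (c ∘ Equiv.swap i i') lam := by
  intro j
  rw [← hc j]
  exact card_equiv (Equiv.swap i i') fun x => by simp

theorem HasContent.cpos_le (hc : HasContent c lam) (j : Fin (m + 1)) (a : Fin n) :
    cpos c j a ≤ lam j := by
  rw [← hc j]
  exact card_le_card fun x hx => by simp_all

theorem HasContent.cpos_lt (hc : HasContent c lam) (a : Fin n) :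
    cpos c (c a) a < lam (c a) := by
  rw [← hc (c a)]
  refine card_lt_card ((ssubset_iff_of_subset fun x hx => by simp_all).2 ⟨a, by simp, by simp⟩)

theorem Nondeg.dyn_ne (hN : Nondeg q h μ lam) (c : Fin n → Fin (m + 1)) (k : Fin m) (a : Fin n) :
    dyn h μ c k a ≠ 0 :=
  mul_ne_zero (div_ne_zero (hN.μ_ne _) (hN.μ_ne _)) (zpow_ne_zero _ hN.h_ne)

theorem Nondeg.theta_dyn_ne (hN : Nondeg q h μ lam) (hc : HasContent c lam) {k : Fin m}
    {a : Fin n} (ha : c a ≤ k.castSucc) : theta q (dyn h μ c k a) ≠ 0 := by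
  have h1 := hc.cpos_lt a
  have h2 := hc.cpos_le k.succ a
  exact hN.theta_μ _ _ (ha.trans_lt Fin.castSucc_lt_succ) (by omega) _ (by omega) (by omega)

/-- The dynamical argument of the exchange relation at the positions `a, b`. -/
def exDyn (h : ℂ) (μ : Fin (m + 1) → ℂ) (c : Fin n → Fin (m + 1)) (a b : Fin n) : ℂ :=
  μ (c b) / μ (c a) * h ^ ((cpos c (c a) a : ℤ) - (cpos c (c b) b : ℤ))

theorem Nondeg.exDyn_ne (hN : Nondeg q h μ lam) (c : Fin n → Fin (m + 1)) (a b : Fin n) :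
    exDyn h μ c a b ≠ 0 :=
  mul_ne_zero (div_ne_zero (hN.μ_ne _) (hN.μ_ne _)) (zpow_ne_zero _ hN.h_ne)

theorem Nondeg.exDyn_of_eq (hN : Nondeg q h μ lam) (hi : (i : ℕ) + 1 = i') (hcc : c i = c i') :
    exDyn h μ c i i' = h⁻¹ := by
  unfold exDyn
  rw [← hcc, cpos_succ hi, div_self (hN.μ_ne _)]
  simp

theorem exDyn_swap (hi : (i : ℕ) + 1 = i') (h : ℂ) (μ : Fin (m + 1) → ℂ) (hcc : c i ≠ c i') :
    exDyn h μ (c ∘ Equiv.swap i i') i i' = (exDyn h μ c i i')⁻¹ := by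
  have hne : i ≠ i' := by rintro rfl; omega
  unfold exDyn
  simp only [Function.comp_apply, Equiv.swap_apply_left, Equiv.swap_apply_right]
  rw [cpos_swap hi c _ hne, cpos_swap_right hi, cpos_succ hi, if_neg hcc, if_neg hcc.symm,
    mul_inv, inv_div, ← zpow_neg]
  simp

theorem Nondeg.theta_exDyn_ne (hN : Nondeg q h μ lam) (hc : HasContent c lam)
    (hi : (i : ℕ) + 1 = i') : theta q (exDyn h μ c i i') ≠ 0 := by
  have key : ∀ a b, c a < c b → theta q (exDyn h μ c a b) ≠ 0 := by
    intro a b hab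
    have h1 := hc.cpos_lt a
    have h2 := hc.cpos_le (c b) b
    exact hN.theta_μ _ _ hab (by omega) _ (by omega) (by omega)
  rcases lt_trichotomy (c i) (c i') with hlt | heq | hlt
  · exact key _ _ hlt
  · rw [hN.exDyn_of_eq hi heq, theta_inv]
    exact neg_ne_zero.2 hN.theta_h
  · have e : exDyn h μ c i i' = (exDyn h μ c i' i)⁻¹ := by
      unfold exDyn
      rw [mul_inv, inv_div, ← zpow_neg, neg_sub]
    rw [e, theta_inv]
    exact neg_ne_zero.2 (key _ _ hlt)

theorem Nondeg.dyn_div_dyn (hN : Nondeg q h μ lam) (hi : (i : ℕ) + 1 = i') {k : Fin m}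
    (h1 : c i ≤ k.castSucc) : dyn h μ c k i / dyn h μ c k i' = exDyn h μ c i i' := by
  have h3 : c i ≠ k.succ := (h1.trans_lt Fin.castSucc_lt_succ).ne
  have hh := hN.h_ne
  have := hN.μ_ne
  unfold dyn exDyn
  rw [cpos_succ hi c k.succ, if_neg h3, add_zero, zpow_sub₀ hh, zpow_sub₀ hh, zpow_sub₀ hh,
    zpow_add₀ hh, zpow_add₀ hh]
  have h4 := this k.succ
  have h5 := this (c i)
  have h6 := this (c i')
  field_simp

theorem dyn_swap_left (hi : (i : ℕ) + 1 = i') (h : ℂ) (μ : Fin (m + 1) → ℂ) {k : Fin m}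
    (h1 : c i ≤ k.castSucc) (hcc : c i ≠ c i') :
    dyn h μ (c ∘ Equiv.swap i i') k i = dyn h μ c k i' := by
  have hne : i ≠ i' := by rintro rfl; omega
  have h3 : c i ≠ k.succ := (h1.trans_lt Fin.castSucc_lt_succ).ne
  unfold dyn
  simp only [Function.comp_apply, Equiv.swap_apply_left]
  rw [cpos_swap hi c _ hne, cpos_swap hi c _ hne, cpos_succ hi, cpos_succ hi, if_neg h3, if_neg hcc]
  simp

theorem dyn_swap_right (hi : (i : ℕ) + 1 = i') (h : ℂ) (μ : Fin (m + 1) → ℂ) {k : Fin m}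
    (h2 : c i' ≤ k.castSucc) (hcc : c i ≠ c i') :
    dyn h μ (c ∘ Equiv.swap i i') k i' = dyn h μ c k i := by
  have h3 : c i' ≠ k.succ := (h2.trans_lt Fin.castSucc_lt_succ).ne
  unfold dyn
  simp only [Function.comp_apply, Equiv.swap_apply_right]
  rw [cpos_swap_right hi, cpos_swap_right hi, if_neg h3, if_neg hcc.symm]
  simp

theorem Nondeg.dyn_eq_exDyn_mul (hN : Nondeg q h μ lam) (hi : (i : ℕ) + 1 = i') {k : Fin m}
    (h1 : c i ≤ k.castSucc) (h2 : c i' = k.succ) :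
    dyn h μ c k i = exDyn h μ c i i' * h := by
  have h3 : c i ≠ k.succ := (h1.trans_lt Fin.castSucc_lt_succ).ne
  unfold dyn exDyn
  rw [h2, cpos_succ hi, if_neg h3, mul_assoc, ← zpow_add_one₀ hN.h_ne]
  congr 2
  push_cast
  ring

theorem dyn_swap_eq_exDyn (hi : (i : ℕ) + 1 = i') (h : ℂ) (μ : Fin (m + 1) → ℂ) {k : Fin m}
    (h1 : c i ≤ k.castSucc) (h2 : c i' = k.succ) :
    dyn h μ (c ∘ Equiv.swap i i') k i' = exDyn h μ c i i' := by
  have h3 : c i ≠ k.succ := (h1.trans_lt Fin.castSucc_lt_succ).ne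
  unfold dyn exDyn
  simp only [Function.comp_apply, Equiv.swap_apply_right]
  rw [cpos_swap_right hi, cpos_swap_right hi, h2, if_neg h3.symm, if_pos rfl,
    cpos_succ hi, if_neg h3]
  congr 2
  push_cast
  ring

/-- The dynamical part of the off-diagonal coefficient of the exchange relation for the colours
`j, l`; it vanishes for `j = l`. Only the product of the coefficients for `(j, l)` and `(l, j)` has
an intrinsic meaning (`rDyn_mul_rDyn`), and the normalization of the weight functions distributes it
unevenly. -/
def rDyn (q h : ℂ) (j l : Fin (m + 1)) (w : ℂ) : ℂ :=
  if j < l then theta q h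
  else if l < j then theta q (w / h) * theta q (w * h) / (theta q h * theta q w ^ 2) else 0

theorem rDyn_of_lt {j l : Fin (m + 1)} (hjl : j < l) (w : ℂ) : rDyn q h j l w = theta q h :=
  if_pos hjl

theorem rDyn_of_gt {j l : Fin (m + 1)} (hjl : l < j) (w : ℂ) :
    rDyn q h j l w = theta q (w / h) * theta q (w * h) / (theta q h * theta q w ^ 2) := by
  rw [rDyn, if_neg hjl.not_gt, if_pos hjl]

theorem rDyn_self (j : Fin (m + 1)) (w : ℂ) : rDyn q h j j w = 0 := by simp [rDyn]

theorem rDyn_mul_rDyn {j l : Fin (m + 1)} (hjl : j ≠ l) {w : ℂ} (θh : theta q h ≠ 0)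
    (θw : theta q w ≠ 0) :
    rDyn q h j l w * rDyn q h l j w⁻¹ * theta q w ^ 2 = theta q (w / h) * theta q (w * h) := by
  have e1 : theta q (w⁻¹ / h) = -theta q (w * h) := by
    rw [← theta_inv, mul_inv, div_eq_mul_inv]
  have e2 : theta q (w⁻¹ * h) = -theta q (w / h) := by
    rw [← theta_inv, inv_div, div_eq_mul_inv, mul_comm]
  rcases hjl.lt_or_gt with hlt | hlt
  · rw [rDyn_of_lt hlt, rDyn_of_gt hlt, e1, e2, theta_inv]
    field_simp
  · rw [rDyn_of_lt hlt, rDyn_of_gt hlt]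
    field_simp

theorem rDiag_of_inv {x : ℂ} (θh : theta q h ≠ 0)
    (θx : theta q (h * x) ≠ 0) : rDiag q h h⁻¹ x = 1 := by
  unfold rDiag
  rw [show h⁻¹ / x = (h * x)⁻¹ by rw [mul_inv, div_eq_mul_inv], theta_inv, theta_inv]
  field_simp

/-- Pairing each assignment with the one in which the values at `i` and `i'` are interchanged; after
this the exchange relation at level `k + 1` holds summand by summand. -/
theorem sum_assign_symm {V : Finset ℂ} {k : Fin (m + 1)} (h1 : c i ≤ k) (h2 : c i' ≤ k)
    (F : (Fin n → ℂ) → ℂ) :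
    ∑ w ∈ assign V (lvl c k), F w =
      ∑ w ∈ assign V (lvl c k), (F w + F (w ∘ Equiv.swap i i')) / 2 := by
  have h3 := sum_assign_swap (i := i) (i' := i') V c k F
  rw [lvl_swap_eq (by simp [mem_lvl, h1, h2])] at h3
  rw [← sum_div, sum_add_distrib, ← h3]
  ring

theorem comp_swap_of_eq (hcc : c i = c i') : c ∘ Equiv.swap i i' = c := by
  funext a
  rcases swap_cases i i' a with ⟨rfl, h'⟩ | ⟨rfl, h'⟩ | ⟨h, h1, h'⟩ <;> simp [h', hcc]

/-- The statement of the exchange relation at level `k`: the effect on a partial weight function of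
swapping its variables at two adjacent positions. -/
def Exchange (q h : ℂ) (μ : Fin (m + 1) → ℂ) (V : Fin m → Finset ℂ) (i i' : Fin n)
    (k : Fin (m + 1)) (c : Fin n → Fin (m + 1)) (v : Fin n → ℂ) : Prop :=
  gfun q h μ V c k (v ∘ Equiv.swap i i') =
    rDiag q h (exDyn h μ c i i') (v i / v i') * gfun q h μ V c k v +
      rDyn q h (c i) (c i') (exDyn h μ c i i') * rOff q h (v i / v i') *
        gfun q h μ V (c ∘ Equiv.swap i i') k v

/-- The induction step when both positions belong to the lower level. -/
theorem exchange_both (hq : ‖q‖ < 1) (hN : Nondeg q h μ lam) {V : Fin m → Finset ℂ}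
    (hV : ∀ k, GoodSet q h (V k)) (hi : (i : ℕ) + 1 = i') {k : Fin m}
    (hc : HasContent c lam) {v : Fin n → ℂ} (hv : GoodOn q h (lvl c k.succ) v)
    (h1 : c i ≤ k.castSucc) (h2 : c i' ≤ k.castSucc)
    (ih : ∀ w, GoodOn q h (lvl c k.castSucc) w → Exchange q h μ V i i' k.castSucc c w)
    (ih' : ∀ w, GoodOn q h (lvl c k.castSucc) w →
      Exchange q h μ V i i' k.castSucc (c ∘ Equiv.swap i i') w) :
    Exchange q h μ V i i' k.succ c v := by
  have hne : i ≠ i' := by rintro rfl; omega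
  have hh := hN.h_ne
  have hle : k.castSucc ≤ k.succ := Fin.castSucc_lt_succ.le
  have m1 := mem_lvl.2 (h1.trans hle)
  have m2 := mem_lvl.2 (h2.trans hle)
  obtain ⟨θs, θhs⟩ := hv.2 i m1 i' m2 hne
  obtain ⟨-, θsh⟩ := hv.2 i' m2 i m1 hne.symm
  have hup : i ∈ lvl c k.succ ↔ i' ∈ lvl c k.succ := by simp only [m1, m2]
  have hlow : i ∈ lvl c k.castSucc ↔ i' ∈ lvl c k.castSucc := by simp [mem_lvl, h1, h2]
  have hw := hN.theta_exDyn_ne hc hi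
  have hdiv : dyn h μ c k i / dyn h μ c k i' = exDyn h μ c i i' := hN.dyn_div_dyn hi h1
  have hR1 : ∀ w v, kernRest q h μ i i' c k w (v ∘ Equiv.swap i i') = kernRest q h μ i i' c k w v :=
    fun w v => kernRest_swap_upper hi q h μ c k hup w v
  have hR2 : ∀ w v, kernRest q h μ i i' c k (w ∘ Equiv.swap i i') v = kernRest q h μ i i' c k w v :=
    fun w v => kernRest_swap_lower hi q h μ c k hlow w v
  have hR3 : ∀ w v, kernRest q h μ i i' (c ∘ Equiv.swap i i') k w v
      = kernRest q h μ i i' c k w v := fun w v => by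
    have := kernRest_swap hi q h μ c k (w ∘ Equiv.swap i i') (v ∘ Equiv.swap i i')
    rwa [comp_swap_swap, comp_swap_swap, hR1, hR2] at this
  have hsym := fun c₁ c₂ v => sum_assign_symm (i := i) (i' := i') (V := V k) h1 h2
    fun w => gfun q h μ V c₁ k.castSucc w * kern q h μ c₂ k w v
  unfold Exchange
  rw [gfun_succ, gfun_succ, gfun_succ, lvl_swap_eq hlow,
    hsym c c (v ∘ Equiv.swap i i'), hsym c c v, hsym (c ∘ Equiv.swap i i') (c ∘ Equiv.swap i i') v,
    mul_sum, mul_sum, ← sum_add_distrib]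
  refine sum_congr rfl fun w hw' => ?_
  have hgood := (hV k).goodOn hw'
  have l1 := mem_lvl.2 h1
  have l2 := mem_lvl.2 h2
  obtain ⟨θx, θhx⟩ := hgood.2 i l1 i' l2 hne
  obtain ⟨-, θxh⟩ := hgood.2 i' l2 i l1 hne.symm
  have e1 : (c ∘ Equiv.swap i i') i ≤ k.castSucc := by simpa using h2
  have e2 : (c ∘ Equiv.swap i i') i' ≤ k.castSucc := by simpa using h1
  have key := fun (g g' f₁ f₁' f₂ f₂' : ℂ) hg => pairKernel_exchange hq (g := g) (g' := g')
    (f₁ := f₁) (f₁' := f₁') (f₂ := f₂) (f₂' := f₂') (x₁ := w i) (x₂ := w i') (s₁ := v i)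
    (s₂ := v i') hh
    (hN.dyn_ne c k i) (hN.dyn_ne c k i') (hgood.1 i l1) (hgood.1 i' l2) (hv.1 i m1) (hv.1 i' m2)
    hN.theta_h (hN.theta_dyn_ne hc h1) (hN.theta_dyn_ne hc h2) (by rwa [hdiv])
    θx θhx θxh θs θhs θsh hg
  simp only [kern_eq_both hi q h μ c k h1 h2, kern_eq_both hi q h μ _ k e1 e2, hR1, hR2, hR3,
    Function.comp_apply, Equiv.swap_apply_left, Equiv.swap_apply_right]
  have E1 := ih w hgood
  by_cases hcc : c i = c i'
  · -- equal colours: the relation is the symmetry of the function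
    have hinv := hN.exDyn_of_eq hi hcc
    unfold Exchange at E1
    rw [← hcc, rDyn_self] at E1 ⊢
    specialize key 0 0 (gfun q h μ V c k.castSucc w)
      (gfun q h μ V c k.castSucc (w ∘ Equiv.swap i i')) 0 0
      (by rw [hdiv, hinv, inv_mul_cancel₀ hh, theta_one]; ring) (by rw [E1, hdiv]; ring) (by ring)
    rw [hdiv] at key
    linear_combination (kernRest q h μ i i' c k w v / 2) * key
  · have E2 := ih' w hgood
    have hex := exDyn_swap hi h μ hcc
    have d1 := dyn_swap_left hi h μ h1 hcc
    have d2 := dyn_swap_right hi h μ h2 hcc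
    unfold Exchange at E1 E2
    rw [comp_swap_swap, hex] at E2
    simp only [Function.comp_apply, Equiv.swap_apply_left, Equiv.swap_apply_right] at E2
    specialize key _ _ (gfun q h μ V c k.castSucc w)
      (gfun q h μ V c k.castSucc (w ∘ Equiv.swap i i'))
      (gfun q h μ V (c ∘ Equiv.swap i i') k.castSucc w)
      (gfun q h μ V (c ∘ Equiv.swap i i') k.castSucc (w ∘ Equiv.swap i i'))
      (rDyn_mul_rDyn (j := c i) (l := c i') hcc hN.theta_h (by rwa [hdiv])) (by rw [E1, hdiv])
      (by rw [E2, hdiv, ← inv_div (dyn h μ c k i), hdiv])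
    rw [hdiv] at key
    rw [d1, d2]
    linear_combination (kernRest q h μ i i' c k w v / 2) * key

/-- The induction step when only `i` belongs to the lower level. By `gfun_swap` the lower levels do
not see the swap, so no induction hypothesis is needed. -/
theorem exchange_left (hq : ‖q‖ < 1) (hN : Nondeg q h μ lam) {V : Fin m → Finset ℂ}
    (hV : ∀ k, GoodSet q h (V k)) (hi : (i : ℕ) + 1 = i') {k : Fin m}
    (hc : HasContent c lam) {v : Fin n → ℂ} (hv : GoodOn q h (lvl c k.succ) v)
    (h1 : c i ≤ k.castSucc) (h2 : c i' = k.succ) :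
    Exchange q h μ V i i' k.succ c v := by
  have hne : i ≠ i' := by rintro rfl; omega
  have hh := hN.h_ne
  have hle : k.castSucc ≤ k.succ := Fin.castSucc_lt_succ.le
  have hnot : ¬ c i' ≤ k.castSucc := by rw [h2, not_le]; exact Fin.castSucc_lt_succ
  have m1 := mem_lvl.2 (h1.trans hle)
  have m2 := mem_lvl.2 h2.le
  obtain ⟨θs, θhs⟩ := hv.2 i m1 i' m2 hne
  have hup : i ∈ lvl c k.succ ↔ i' ∈ lvl c k.succ := by simp only [m1, m2]
  have hR1 : ∀ w v, kernRest q h μ i i' c k w (v ∘ Equiv.swap i i') = kernRest q h μ i i' c k w v :=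
    fun w v => kernRest_swap_upper hi q h μ c k hup w v
  have hR3 : ∀ w v, kernRest q h μ i i' (c ∘ Equiv.swap i i') k (w ∘ Equiv.swap i i') v
      = kernRest q h μ i i' c k w v := fun w v => by
    have := kernRest_swap hi q h μ c k w (v ∘ Equiv.swap i i')
    rwa [comp_swap_swap, hR1] at this
  have hlt : c i < c i' := by rw [h2]; exact h1.trans_lt Fin.castSucc_lt_succ
  unfold Exchange
  rw [gfun_succ, gfun_succ, gfun_succ, sum_assign_swap, mul_sum, mul_sum, ← sum_add_distrib,
    rDyn_of_lt hlt]
  refine sum_congr rfl fun w hw' => ?_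
  have hgood := (hV k).goodOn hw'
  have l1 := mem_lvl.2 h1
  have e1 : (c ∘ Equiv.swap i i') i = k.succ := by simpa using h2
  have e2 : (c ∘ Equiv.swap i i') i' ≤ k.castSucc := by simpa using h1
  have d1 := hN.dyn_eq_exDyn_mul hi h1 h2
  have d2 := dyn_swap_eq_exDyn hi h μ h1 h2
  have key := singleKernel_exchange_left hq (x := w i) (s₁ := v i)
    (s₂ := v i') hh
    (hN.exDyn_ne c i i') (hgood.1 i l1) (hv.1 i m1) (hv.1 i' m2)
    hN.theta_h (hN.theta_exDyn_ne hc hi) (by rw [← d1]; exact hN.theta_dyn_ne hc h1) θhs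
  rw [gfun_swap hi q h μ V c k.castSucc fun h => hnot h.2]
  simp only [kern_eq_left hi q h μ c k h1 h2, kern_eq_right hi q h μ _ k e1 e2, hR1, hR3,
    Function.comp_apply, Equiv.swap_apply_left, Equiv.swap_apply_right]
  rw [d1, d2]
  linear_combination (kernRest q h μ i i' c k w v * gfun q h μ V c k.castSucc w) * key

/-- The induction step when only `i'` belongs to the lower level. -/
theorem exchange_right (hq : ‖q‖ < 1) (hN : Nondeg q h μ lam) {V : Fin m → Finset ℂ}
    (hV : ∀ k, GoodSet q h (V k)) (hi : (i : ℕ) + 1 = i') {k : Fin m}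
    (hc : HasContent c lam) {v : Fin n → ℂ} (hv : GoodOn q h (lvl c k.succ) v)
    (h1 : c i = k.succ) (h2 : c i' ≤ k.castSucc) :
    Exchange q h μ V i i' k.succ c v := by
  have hne : i ≠ i' := by rintro rfl; omega
  have hh := hN.h_ne
  have hle : k.castSucc ≤ k.succ := Fin.castSucc_lt_succ.le
  have hnot : ¬ c i ≤ k.castSucc := by rw [h1, not_le]; exact Fin.castSucc_lt_succ
  have m1 := mem_lvl.2 h1.le
  have m2 := mem_lvl.2 (h2.trans hle)
  obtain ⟨θs, θhs⟩ := hv.2 i m1 i' m2 hne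
  have hup : i ∈ lvl c k.succ ↔ i' ∈ lvl c k.succ := by simp only [m1, m2]
  have hR1 : ∀ w v, kernRest q h μ i i' c k w (v ∘ Equiv.swap i i') = kernRest q h μ i i' c k w v :=
    fun w v => kernRest_swap_upper hi q h μ c k hup w v
  have hR3 : ∀ w v, kernRest q h μ i i' (c ∘ Equiv.swap i i') k (w ∘ Equiv.swap i i') v
      = kernRest q h μ i i' c k w v := fun w v => by
    have := kernRest_swap hi q h μ c k w (v ∘ Equiv.swap i i')
    rwa [comp_swap_swap, hR1] at this
  have hlt : c i' < c i := by rw [h1]; exact h2.trans_lt Fin.castSucc_lt_succ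
  unfold Exchange
  rw [gfun_succ, gfun_succ, gfun_succ, sum_assign_swap, mul_sum, mul_sum, ← sum_add_distrib,
    rDyn_of_gt hlt]
  refine sum_congr rfl fun w hw' => ?_
  have hgood := (hV k).goodOn hw'
  have l2 := mem_lvl.2 h2
  have e1 : (c ∘ Equiv.swap i i') i ≤ k.castSucc := by simpa using h2
  have e2 : (c ∘ Equiv.swap i i') i' = k.succ := by simpa using h1
  have hc' := hc.swap i i'
  have d1 := hN.dyn_eq_exDyn_mul hi e1 e2
  have d2 := dyn_swap_eq_exDyn hi h μ e1 e2
  rw [comp_swap_swap] at d2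
  have key := singleKernel_exchange_right hq (x := w i') (s₁ := v i)
    (s₂ := v i') hh
    (hN.exDyn_ne (c ∘ Equiv.swap i i') i i') (hgood.1 i' l2) (hv.1 i m1) (hv.1 i' m2)
    hN.theta_h (hN.theta_exDyn_ne hc' hi) (by rw [← d1]; exact hN.theta_dyn_ne hc' e1) θhs
  have hex : exDyn h μ c i i' = (exDyn h μ (c ∘ Equiv.swap i i') i i')⁻¹ := by
    rw [exDyn_swap hi h μ hlt.ne', inv_inv]
  rw [gfun_swap hi q h μ V c k.castSucc fun h => hnot h.1]
  simp only [kern_eq_right hi q h μ c k h1 h2, kern_eq_left hi q h μ _ k e1 e2, hR1, hR3,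
    Function.comp_apply, Equiv.swap_apply_left, Equiv.swap_apply_right]
  rw [d1, d2, hex]
  generalize exDyn h μ (c ∘ Equiv.swap i i') i i' = W at *
  have f1 : theta q (W⁻¹ / h) = -theta q (W * h) := by
    rw [← theta_inv, mul_inv, div_eq_mul_inv]
  have f2 : theta q (W⁻¹ * h) = -theta q (W / h) := by
    rw [← theta_inv, inv_div, div_eq_mul_inv, mul_comm]
  rw [f1, f2, theta_inv, neg_sq]
  linear_combination (kernRest q h μ i i' c k w v * gfun q h μ V c k.castSucc w) * key

/-- The induction step when both positions enter at the upper level: the function is symmetric in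
the two variables. -/
theorem exchange_none (hN : Nondeg q h μ lam) (V : Fin m → Finset ℂ)
    (hi : (i : ℕ) + 1 = i') {k : Fin m} {v : Fin n → ℂ} (hv : GoodOn q h (lvl c k.succ) v)
    (h1 : c i = k.succ) (h2 : c i' = k.succ) :
    Exchange q h μ V i i' k.succ c v := by
  have hne : i ≠ i' := by rintro rfl; omega
  have m1 := mem_lvl.2 h1.le
  have m2 := mem_lvl.2 h2.le
  obtain ⟨θs, θhs⟩ := hv.2 i m1 i' m2 hne
  have hup : i ∈ lvl c k.succ ↔ i' ∈ lvl c k.succ := by simp only [m1, m2]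
  have hcc : c i = c i' := h1.trans h2.symm
  unfold Exchange
  rw [hN.exDyn_of_eq hi hcc, rDiag_of_inv hN.theta_h θhs, hcc, rDyn_self, gfun_succ, gfun_succ]
  simp only [kern_eq_none q h μ c k h1 h2, kernRest_swap_upper hi q h μ c k hup]
  ring

/-- The exchange relation for two neighbouring positions of a level, by induction on the level. -/
theorem exchange (hq : ‖q‖ < 1) (hN : Nondeg q h μ lam) {V : Fin m → Finset ℂ}
    (hV : ∀ k, GoodSet q h (V k)) (hi : (i : ℕ) + 1 = i') (k : Fin (m + 1))
    (hc : HasContent c lam) {v : Fin n → ℂ}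
    (hv : GoodOn q h (lvl c k) v) (h1 : c i ≤ k) (h2 : c i' ≤ k) :
    Exchange q h μ V i i' k c v := by
  have hne : i ≠ i' := by rintro rfl; omega
  induction k using Fin.induction generalizing c v with
  | zero =>
    have h3 : c i = c i' := by rw [Fin.le_zero_iff.1 h1, Fin.le_zero_iff.1 h2]
    obtain ⟨-, θhs⟩ := hv.2 i (mem_lvl.2 h1) i' (mem_lvl.2 h2) hne
    unfold Exchange
    rw [gfun_zero, gfun_zero, hN.exDyn_of_eq hi h3, rDiag_of_inv hN.theta_h θhs, h3, rDyn_self]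
    ring
  | succ k ih =>
    have hcases : ∀ a, c a ≤ k.succ → c a ≤ k.castSucc ∨ c a = k.succ := fun a ha =>
      (lt_or_eq_of_le ha).imp_left Fin.le_castSucc_iff.2
    rcases hcases i h1 with h1' | h1' <;> rcases hcases i' h2 with h2' | h2'
    · have hlow : i ∈ lvl c k.castSucc ↔ i' ∈ lvl c k.castSucc := by simp [mem_lvl, h1', h2']
      exact exchange_both hq hN hV hi hc hv h1' h2' (fun w hw => ih hc hw h1' h2') fun w hw =>
        ih (hc.swap i i') (by rwa [lvl_swap_eq hlow]) (by simpa using h2') (by simpa using h1')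
    · exact exchange_left hq hN hV hi hc hv h1' h2'
    · exact exchange_right hq hN hV hi hc hv h1' h2'
    · exact exchange_none hN V hi hv h1' h2'

end Exchange

/-! ### Triangularity and diagonal values -/

section Triangular

variable {m n : ℕ} {q h : ℂ} {μ : Fin (m + 1) → ℂ} {lam : Fin (m + 1) → ℕ}
  {c : Fin n → Fin (m + 1)}

/-- If the kernel between two levels does not vanish, values do not move to the left on the way
from the upper to the lower level: a value `w a` that also occurs at `b > a` in the upper level
contributes a factor `ϑ(1) = 0`. -/
theorem exists_le_of_kern_ne_zero {k : Fin m} {w v : Fin n → ℂ} (hk : kern q h μ c k w v ≠ 0)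
    {a : Fin n} (ha : a ∈ lvl c k.castSucc) (hwa : w a ≠ 0)
    (hv : ∃ b ∈ lvl c k.succ, v b = w a) : ∃ b ∈ lvl c k.succ, b ≤ a ∧ w a = v b := by
  obtain ⟨b, hb, hvb⟩ := hv
  refine ⟨b, hb, ?_, hvb.symm⟩
  by_contra hlt
  rw [not_le] at hlt
  have h1 := prod_ne_zero_iff.1 (prod_ne_zero_iff.1 (left_ne_zero_of_mul hk) a ha) b hb
  rw [psiC, if_neg hlt.not_gt, if_neg hlt.ne', hvb, div_self hwa, theta_one] at h1
  exact h1 rfl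

theorem exists_assign_of_gfun_ne_zero {V : Fin m → Finset ℂ} (hV : ∀ k, GoodSet q h (V k))
    (hmono : Monotone V) (K : Fin (m + 1)) {v : Fin n → ℂ} (hne : gfun q h μ V c K v ≠ 0)
    (hv : ∀ k : Fin m, k.castSucc < K → ∀ x ∈ V k, ∃ b ∈ lvl c K, v b = x) (k : Fin m)
    (hk : k.castSucc < K) :
    ∃ w ∈ assign (V k) (lvl c k.castSucc), ∀ a ∈ lvl c k.castSucc,
      ∃ b ∈ lvl c K, b ≤ a ∧ w a = v b := by
  induction K using Fin.induction generalizing v with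
  | zero => exact absurd hk (Fin.not_lt_zero _)
  | succ K ih =>
    rw [gfun_succ] at hne
    obtain ⟨w, hw, hne'⟩ := exists_ne_zero_of_sum_ne_zero hne
    have hbij := (mem_assign.1 hw).1
    have step : ∀ a ∈ lvl c K.castSucc, ∃ b ∈ lvl c K.succ, b ≤ a ∧ w a = v b := fun a ha =>
      exists_le_of_kern_ne_zero (right_ne_zero_of_mul hne') ha ((hV K).1 _ (hbij.mapsTo ha))
        (hv K Fin.castSucc_lt_succ _ (hbij.mapsTo ha))
    rcases (Fin.castSucc_lt_succ_iff.1 hk).lt_or_eq with hlt | rfl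
    · obtain ⟨u, hu, hu'⟩ := ih (left_ne_zero_of_mul hne') (fun k' hk' x hx => by
        obtain ⟨b, hb, hb'⟩ := hbij.surjOn (hmono (Fin.castSucc_lt_castSucc_iff.1 hk').le hx)
        exact ⟨b, hb, hb'⟩) (Fin.castSucc_lt_castSucc_iff.2 hlt)
      refine ⟨u, hu, fun a ha => ?_⟩
      obtain ⟨b, hb, hba, e⟩ := hu' a ha
      obtain ⟨b', hb', hba', e'⟩ := step b hb
      exact ⟨b', hb', hba'.trans hba, e.trans e'⟩
    · exact ⟨w, hw, step⟩

/-- The values taken by `v` on the lower levels of the colouring `c`. -/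
def vals (c : Fin n → Fin (m + 1)) (v : Fin n → ℂ) (k : Fin m) : Finset ℂ := by
  classical
  exact (lvl c k.castSucc).image v

theorem mem_vals {v : Fin n → ℂ} {k : Fin m} {x : ℂ} :
    x ∈ vals c v k ↔ ∃ a, c a ≤ k.castSucc ∧ v a = x := by
  classical
  simp [vals, mem_lvl]

theorem vals_mono (c : Fin n → Fin (m + 1)) (v : Fin n → ℂ) : Monotone (vals c v) := by
  intro k k' hk x hx
  rw [mem_vals] at hx ⊢
  obtain ⟨a, ha, rfl⟩ := hx
  exact ⟨a, ha.trans (Fin.castSucc_le_castSucc_iff.2 hk), rfl⟩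

theorem GoodOn.goodSet_vals {v : Fin n → ℂ} (hv : GoodOn q h univ v) (c : Fin n → Fin (m + 1))
    (k : Fin m) : GoodSet q h (vals c v k) := by
  constructor
  · intro x hx
    obtain ⟨a, -, rfl⟩ := mem_vals.1 hx
    exact hv.1 a (mem_univ _)
  · intro x hx y hy hxy
    obtain ⟨a, -, rfl⟩ := mem_vals.1 hx
    obtain ⟨b, -, rfl⟩ := mem_vals.1 hy
    exact hv.2 a (mem_univ _) b (mem_univ _) fun e => hxy (by rw [e])

theorem GoodOn.injective {v : Fin n → ℂ} (hv : GoodOn q h univ v) : Function.Injective v := by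
  intro a b hab
  by_contra hne
  have h1 := (hv.2 a (mem_univ _) b (mem_univ _) hne).1
  rw [hab, div_self (hv.1 b (mem_univ _)), theta_one] at h1
  exact h1 rfl

theorem GoodOn.comp_perm {v : Fin n → ℂ} (hv : GoodOn q h univ v) (σ : Equiv.Perm (Fin n)) :
    GoodOn q h univ (v ∘ σ) :=
  ⟨fun _ _ => hv.1 _ (mem_univ _), fun _ _ _ _ hab => hv.2 _ (mem_univ _) _ (mem_univ _)
    fun e => hab (σ.injective e)⟩

theorem lvl_last (c : Fin n → Fin (m + 1)) : lvl c (Fin.last m) = univ := by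
  ext a
  simp [mem_lvl, Fin.le_last]

theorem exists_assign_vals {κ : Fin n → Fin (m + 1)} {v : Fin n → ℂ} (hv : GoodOn q h univ v)
    (hne : gfun q h μ (vals κ v) c (Fin.last m) v ≠ 0) (k : Fin m) :
    ∃ w ∈ assign (vals κ v k) (lvl c k.castSucc), ∀ a ∈ lvl c k.castSucc, ∃ b ≤ a, w a = v b := by
  obtain ⟨w, hw, hw'⟩ := exists_assign_of_gfun_ne_zero (hv.goodSet_vals κ) (vals_mono κ v) _ hne
    (fun k _ x hx => by
      obtain ⟨a, -, e⟩ := mem_vals.1 hx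
      exact ⟨a, by rw [lvl_last]; exact mem_univ _, e⟩) k (Fin.castSucc_lt_last k)
  refine ⟨w, hw, fun a ha => ?_⟩
  obtain ⟨b, -, hb, e⟩ := hw' a ha
  exact ⟨b, hb, e⟩

/-- Two colourings of the same content that are comparable pointwise agree. -/
theorem HasContent.eq_of_le {c' : Fin n → Fin (m + 1)} (hc : HasContent c lam)
    (hc' : HasContent c' lam) (hle : ∀ x, c x ≤ c' x) : c = c' := by
  have hsum : ∀ {d : Fin n → Fin (m + 1)}, HasContent d lam →
      ∑ x, (d x : ℕ) = ∑ j, lam j * (j : ℕ) := by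
    intro d hd
    rw [← sum_fiberwise_of_maps_to (t := univ) (g := d) (fun _ _ => mem_univ _)]
    refine sum_congr rfl fun j _ => ?_
    rw [← hd j, ← smul_eq_mul, ← sum_const]
    refine sum_congr rfl fun x hx => ?_
    rw [(mem_filter.1 hx).2]
  have h1 := (sum_eq_sum_iff_of_le (s := univ) (f := fun x => (c x : ℕ))
    (g := fun x => (c' x : ℕ)) fun x _ => hle x).1 ((hsum hc).trans (hsum hc').symm)
  funext x
  exact Fin.ext (h1 x (mem_univ x))

theorem le_of_forall_castSucc {x y : Fin (m + 1)}
    (hxy : ∀ k : Fin m, x ≤ k.castSucc → y ≤ k.castSucc) : y ≤ x := by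
  induction x using Fin.lastCases with
  | last => exact Fin.le_last y
  | cast k => exact hxy k le_rfl

/-- Triangularity against an increasing `c`: if `κ y ≤ k`, the value `v y` sits on level `k` at some
`a ≥ y`, whence `c y ≤ c a ≤ k`. So `c ≤ κ` pointwise. -/
theorem eq_of_gfun_ne_zero_left {κ : Fin n → Fin (m + 1)} (hc : HasContent c lam)
    (hκ : HasContent κ lam) (hmono : Monotone c) {v : Fin n → ℂ} (hv : GoodOn q h univ v)
    (hne : gfun q h μ (vals κ v) c (Fin.last m) v ≠ 0) : c = κ := by
  refine hc.eq_of_le hκ fun y => le_of_forall_castSucc fun k hk => ?_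
  obtain ⟨w, hw, hw'⟩ := exists_assign_vals hv hne k
  obtain ⟨a, ha, e⟩ := (mem_assign.1 hw).1.surjOn (mem_vals.2 ⟨y, hk, rfl⟩)
  obtain ⟨b, hb, e'⟩ := hw' a ha
  have : y = b := hv.injective (e.symm.trans e')
  exact (hmono (this.trans_le hb)).trans (mem_lvl.1 ha)

/-- Triangularity against a decreasing `κ`: if `c y ≤ k`, the value at `y` on level `k` is `v b` for
some `b ≤ y` with `κ b ≤ k`, whence `κ y ≤ κ b ≤ k`. So `κ ≤ c` pointwise. -/
theorem eq_of_gfun_ne_zero_right {κ : Fin n → Fin (m + 1)} (hc : HasContent c lam)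
    (hκ : HasContent κ lam) (hanti : Antitone κ) {v : Fin n → ℂ} (hv : GoodOn q h univ v)
    (hne : gfun q h μ (vals κ v) c (Fin.last m) v ≠ 0) : c = κ := by
  refine (hκ.eq_of_le hc fun y => le_of_forall_castSucc fun k hk => ?_).symm
  obtain ⟨w, hw, hw'⟩ := exists_assign_vals hv hne k
  obtain ⟨b, hb, e⟩ := hw' y (mem_lvl.2 hk)
  obtain ⟨x, hx, e'⟩ := mem_vals.1 ((mem_assign.1 hw).1.mapsTo (mem_lvl.2 hk))
  have : x = b := hv.injective (e'.trans e)
  exact (hanti hb).trans (this ▸ hx)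

/-- The contribution of the positions `a, b` to a diagonal value of a weight function. -/
def diagFactor (q h : ℂ) (v : Fin n → ℂ) (a b : Fin n) : ℂ :=
  if b < a then theta q (v b / v a * h) / theta q h else theta q (v b / v a)

/-- On the diagonal, the factors inside a level cancel. -/
theorem kern_diag (hN : Nondeg q h μ lam) (hc : HasContent c lam) {v : Fin n → ℂ}
    (hv : GoodOn q h univ v) (k : Fin m) {w w' : Fin n → ℂ}
    (hw : ∀ a ∈ lvl c k.castSucc, w a = v a) (hw' : ∀ a ∈ lvl c k.succ, w' a = v a) :
    kern q h μ c k w w' =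
      ∏ b with c b = k.succ, ∏ a ∈ lvl c k.castSucc, diagFactor q h v a b := by
  have hle : k.castSucc ≤ k.succ := Fin.castSucc_lt_succ.le
  have hdisj : Disjoint (lvl c k.castSucc) (univ.filter fun b => c b = k.succ) := by
    rw [disjoint_left]
    intro a ha hb
    rw [mem_lvl, (mem_filter.1 hb).2, Fin.le_castSucc_iff] at ha
    exact ha.ne rfl
  have hunion : lvl c k.succ = lvl c k.castSucc ∪ univ.filter fun b => c b = k.succ := by
    ext a
    simp only [mem_union, mem_lvl, mem_filter, mem_univ, true_and, Fin.le_castSucc_iff]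
    exact le_iff_lt_or_eq
  rw [prod_comm]
  unfold kern
  rw [← prod_mul_distrib]
  refine prod_congr rfl fun a ha => ?_
  have hva := hv.1 a (mem_univ _)
  rw [hunion, prod_union hdisj, mul_right_comm, ← prod_mul_distrib, prod_eq_one, one_mul]
  · refine prod_congr rfl fun b hb => ?_
    have hbk := (mem_filter.1 hb).2
    have hab : b ≠ a := by
      rintro rfl
      exact disjoint_left.1 hdisj ha hb
    rw [hw a ha, hw' b (mem_lvl.2 hbk.le), psiC, diagFactor, if_neg hab]
  · intro b hb
    rw [hw a ha, hw b hb, hw' b (mem_lvl.2 ((mem_lvl.1 hb).trans hle)), psiC, denC]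
    rcases lt_trichotomy a b with hab | rfl | hab
    · have h1 := (hv.2 b (mem_univ _) a (mem_univ _) hab.ne').1
      rw [if_neg hab.not_gt, if_neg hab.ne', if_pos hab]
      field_simp
    · have h1 := hN.theta_dyn_ne hc (mem_lvl.1 ha)
      simp only [lt_irrefl, if_false, if_true]
      rw [div_self hva, one_mul, div_self h1, one_mul]
    · have h1 := (hv.2 b (mem_univ _) a (mem_univ _) hab.ne).2
      have h2 := hN.theta_h
      rw [if_pos hab, if_neg hab.not_gt, if_pos hab, mul_comm (v b / v a) h,
        mul_div_assoc h]
      generalize theta q (h * (v b / v a)) = t at *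
      field_simp

theorem eq_of_injOn_of_le {s : Finset (Fin n)} {g : Fin n → Fin n} (hg : ∀ a ∈ s, g a ∈ s)
    (hinj : Set.InjOn g s) (hle : ∀ a ∈ s, g a ≤ a) : ∀ a ∈ s, g a = a := by
  intro a
  induction a using WellFoundedLT.induction with
  | _ a ih =>
    intro ha
    by_contra hne
    have hlt := lt_of_le_of_ne (hle a ha) hne
    exact hne (hinj (hg a ha) ha (ih _ hlt (hg a ha)))

/-- At its own fixed point, only the assignment that keeps all values in place contributes. -/
theorem gfun_diag_level (hN : Nondeg q h μ lam) (hc : HasContent c lam) {v : Fin n → ℂ}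
    (hv : GoodOn q h univ v) (K : Fin (m + 1)) {w : Fin n → ℂ} (hw : ∀ a ∈ lvl c K, w a = v a) :
    gfun q h μ (vals c v) c K w =
      ∏ b ∈ lvl c K, ∏ a with c a < c b, diagFactor q h v a b := by
  induction K using Fin.induction generalizing w with
  | zero =>
    rw [gfun_zero, prod_eq_one]
    intro b hb
    rw [mem_lvl, Fin.le_zero_iff] at hb
    rw [hb, filter_false_of_mem fun a _ => Fin.not_lt_zero _, prod_empty]
  | succ k ih =>
    have hle : k.castSucc ≤ k.succ := Fin.castSucc_lt_succ.le
    have hdisj : Disjoint (lvl c k.castSucc) (univ.filter fun b => c b = k.succ) := by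
      rw [disjoint_left]
      intro a ha hb
      rw [mem_lvl, (mem_filter.1 hb).2, Fin.le_castSucc_iff] at ha
      exact ha.ne rfl
    have hunion : lvl c k.succ = lvl c k.castSucc ∪ univ.filter fun b => c b = k.succ := by
      ext a
      simp only [mem_union, mem_lvl, mem_filter, mem_univ, true_and, Fin.le_castSucc_iff]
      exact le_iff_lt_or_eq
    set w₀ : Fin n → ℂ := fun a => if a ∈ lvl c k.castSucc then v a else 0 with hw₀
    have hw₀' : ∀ a ∈ lvl c k.castSucc, w₀ a = v a := fun a ha => if_pos ha
    have hmem : w₀ ∈ assign (vals c v k) (lvl c k.castSucc) := by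
      refine mem_assign.2 ⟨⟨fun a ha => ?_, fun a ha b hb hab => ?_, fun x hx => ?_⟩,
        fun a ha => if_neg ha⟩
      · rw [hw₀' a ha]
        exact mem_vals.2 ⟨a, mem_lvl.1 ha, rfl⟩
      · rw [hw₀' a ha, hw₀' b hb] at hab
        exact hv.injective hab
      · obtain ⟨a, ha, e⟩ := mem_vals.1 hx
        exact ⟨a, mem_lvl.2 ha, (hw₀' a (mem_lvl.2 ha)).trans e⟩
    rw [gfun_succ, sum_eq_single_of_mem w₀ hmem, ih hw₀', kern_diag hN hc hv k hw₀' hw, hunion,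
      prod_union hdisj]
    · congr 1
      refine prod_congr rfl fun b hb => ?_
      refine prod_congr ?_ fun _ _ => rfl
      ext a
      rw [mem_lvl, mem_filter, (mem_filter.1 hb).2, Fin.le_castSucc_iff]
      simp
    · -- in a nonvanishing term, a value at `a` on the lower level comes from some `b ≤ a` in this
      -- level, and an injective self-map of the level with this property is the identity
      intro u hu hne
      by_contra hterm
      refine hne ?_
      obtain ⟨hbij, hzero⟩ := mem_assign.1 hu
      have hstep : ∀ a ∈ lvl c k.castSucc, ∃ b ∈ lvl c k.castSucc, b ≤ a ∧ u a = v b := by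
        intro a ha
        obtain ⟨y, hy, e⟩ := mem_vals.1 (hbij.mapsTo ha)
        have hy' : y ∈ lvl c k.succ := mem_lvl.2 (hy.trans hle)
        obtain ⟨b, hb, hba, e'⟩ := exists_le_of_kern_ne_zero (right_ne_zero_of_mul hterm) ha
          (by rw [← e]; exact hv.1 y (mem_univ _)) ⟨y, hy', by rw [hw y hy', e]⟩
        rw [hw b hb] at e'
        have : y = b := hv.injective (e.trans e')
        exact ⟨b, this ▸ mem_lvl.2 hy, hba, e'⟩
      choose! g hg using hstep
      have hid := eq_of_injOn_of_le (fun a ha => (hg a ha).1) (fun a ha b hb hab =>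
        hbij.injOn ha hb (by rw [(hg a ha).2.2, (hg b hb).2.2, hab])) fun a ha => (hg a ha).2.1
      funext a
      by_cases ha : a ∈ lvl c k.castSucc
      · rw [hw₀' a ha, (hg a ha).2.2, hid a ha]
      · rw [hzero a ha, hw₀]
        exact (if_neg ha).symm

theorem gfun_diag (hN : Nondeg q h μ lam) (hc : HasContent c lam) {v : Fin n → ℂ}
    (hv : GoodOn q h univ v) :
    gfun q h μ (vals c v) c (Fin.last m) v = ∏ b, ∏ a with c a < c b, diagFactor q h v a b := by
  rw [gfun_diag_level hN hc hv _ fun _ _ => rfl, lvl_last]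

end Triangular

/-! ### Reversal of the positions -/

section Pairing

variable {m n : ℕ} {q h : ℂ} {μ : Fin (m + 1) → ℂ} {lam : Fin (m + 1) → ℕ}
  {c : Fin n → Fin (m + 1)} {i i' : Fin n}

/-- The substitution `μ_j ↦ ħ^{λ_j} / μ_j`. -/
def tauμ (h : ℂ) (lam : Fin (m + 1) → ℕ) (μ : Fin (m + 1) → ℂ) (j : Fin (m + 1)) : ℂ :=
  h ^ lam j / μ j

theorem Nondeg.tau (hN : Nondeg q h μ lam) : Nondeg q h (tauμ h lam μ) lam where
  h_ne := hN.h_ne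
  μ_ne j := div_ne_zero (pow_ne_zero _ hN.h_ne) (hN.μ_ne j)
  theta_h := hN.theta_h
  theta_μ j k hjk hj e he he' := by
    have e1 : tauμ h lam μ k / tauμ h lam μ j * h ^ e =
        (μ k / μ j * h ^ ((lam j : ℤ) - lam k - e))⁻¹ := by
      have h1 := hN.h_ne
      have h2 := hN.μ_ne j
      have h3 := hN.μ_ne k
      unfold tauμ
      rw [zpow_sub₀ h1, zpow_sub₀ h1, zpow_natCast, zpow_natCast]
      have h4 := zpow_ne_zero e h1
      field_simp
    rw [e1, theta_inv]
    exact neg_ne_zero.2 (hN.theta_μ j k hjk hj _ (by omega) (by omega))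

theorem rDyn_inv (q h : ℂ) (j l : Fin (m + 1)) (w : ℂ) : rDyn q h j l w⁻¹ = rDyn q h j l w := by
  have e1 : theta q (w⁻¹ / h) = -theta q (w * h) := by
    rw [← theta_inv, mul_inv, div_eq_mul_inv]
  have e2 : theta q (w⁻¹ * h) = -theta q (w / h) := by
    rw [← theta_inv, inv_div, div_eq_mul_inv, mul_comm]
  unfold rDyn
  rw [e1, e2, theta_inv, neg_mul_neg, neg_sq, mul_comm (theta q (w * h))]

theorem HasContent.comp_perm (hc : HasContent c lam) (σ : Equiv.Perm (Fin n)) :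
    HasContent (c ∘ σ) lam := by
  intro j
  rw [← hc j]
  exact card_equiv σ fun x => by simp

theorem HasContent.cpos_rev (hc : HasContent c lam) (j : Fin (m + 1)) (x : Fin n) :
    cpos (c ∘ Fin.revPerm) j x.rev + cpos c j x + (if c x = j then 1 else 0) = lam j := by
  have e1 : cpos (c ∘ Fin.revPerm) j x.rev = (univ.filter fun y => x < y ∧ c y = j).card := by
    refine card_equiv Fin.revPerm fun y => ?_
    simp only [mem_filter, mem_univ, true_and, Function.comp_apply, Fin.revPerm_apply]
    rw [Fin.lt_rev_iff]
  have e2 : (if c x = j then 1 else 0) = (univ.filter fun y => y = x ∧ c y = j).card := by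
    split_ifs with hx
    · symm
      rw [card_eq_one]
      exact ⟨x, by ext y; simp; rintro rfl; exact hx⟩
    · symm
      rw [card_eq_zero, filter_eq_empty_iff]
      rintro y - ⟨rfl, hy⟩
      exact hx hy
  rw [e1, e2, cpos, ← hc j, ← card_union_of_disjoint, ← card_union_of_disjoint]
  · congr 1
    ext y
    simp only [mem_union, mem_filter, mem_univ, true_and]
    rcases lt_trichotomy x y with hxy | rfl | hxy
    · simp [hxy, hxy.not_gt, hxy.ne']
    · simp
    · simp [hxy, hxy.not_gt, hxy.ne]
  · rw [disjoint_left]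
    simp only [mem_union, mem_filter, mem_univ, true_and]
    rintro y (⟨hy, -⟩ | ⟨hy, -⟩) ⟨rfl, -⟩ <;> exact lt_irrefl _ hy
  · rw [disjoint_left]
    simp only [mem_filter, mem_univ, true_and]
    rintro y ⟨hy, -⟩ ⟨hy', -⟩
    exact lt_asymm hy hy'

/-- The substitution `τ` is made so that the exchange relations keep their dynamical arguments under
reversal of the positions. -/
theorem Nondeg.exDyn_rev (hN : Nondeg q h μ lam) (hc : HasContent c lam) (a b : Fin n) :
    exDyn h (tauμ h lam μ) (c ∘ Fin.revPerm) b.rev a.rev = exDyn h μ c a b := by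
  have h1 := hN.h_ne
  have h2 := hN.μ_ne (c a)
  have h3 := hN.μ_ne (c b)
  have ha := hc.cpos_rev (c a) a
  have hb := hc.cpos_rev (c b) b
  rw [if_pos rfl] at ha hb
  unfold exDyn
  simp only [Function.comp_apply, Fin.revPerm_apply, Fin.rev_rev]
  have e : ((cpos c (c a) a : ℤ) - cpos c (c b) b) =
      lam (c a) - lam (c b) + ((cpos (c ∘ Fin.revPerm) (c b) b.rev : ℤ) -
        cpos (c ∘ Fin.revPerm) (c a) a.rev) := by omega
  rw [e, zpow_add₀ h1, zpow_sub₀ h1 (lam (c a) : ℤ), zpow_natCast, zpow_natCast]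
  unfold tauμ
  field_simp

/-! ### The pairing of weight functions -/

/-- The pairing, over all colourings of content `λ`, of the weight functions with their images under
`τ` and reversal of the positions. The intermediate variables run over the values in `V` on the one
side and in `V'` on the other. -/
def pairing (q h : ℂ) (μ : Fin (m + 1) → ℂ) (lam : Fin (m + 1) → ℕ) (V V' : Fin m → Finset ℂ)
    (v : Fin n → ℂ) : ℂ := by
  classical
  exact ∑ c : Fin n → Fin (m + 1) with HasContent c lam,
    gfun q h μ V c (Fin.last m) v *
      gfun q h (tauμ h lam μ) V' (c ∘ Fin.revPerm) (Fin.last m) (v ∘ Fin.revPerm)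

/-- A bilinear sum is invariant under a transformation that couples only `c` and `s c`, for an
involution `s`, if the `2 × 2` blocks on the two sides are inverse transpose to each other. -/
theorem sum_exchange {α : Type*} {C : Finset α} (s : α → α) (hs : ∀ c ∈ C, s c ∈ C)
    (hss : ∀ c, s (s c) = c) (A B a b a' b' : α → ℂ)
    (h1 : ∀ c ∈ C, a c * a' c + b (s c) * b' (s c) = 1)
    (h2 : ∀ c ∈ C, a c * b' c + b (s c) * a' (s c) = 0) :
    ∑ c ∈ C, (a c * A c + b c * A (s c)) * (a' c * B c + b' c * B (s c)) =
      ∑ c ∈ C, A c * B c := by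
  have e : ∀ F : α → ℂ, ∑ c ∈ C, F (s c) = ∑ c ∈ C, F c := fun F =>
    sum_bij' (fun c _ => s c) (fun c _ => s c) hs hs (fun c _ => hss c) (fun c _ => hss c)
      fun _ _ => rfl
  calc _ = ∑ c ∈ C, (a c * A c * (a' c * B c + b' c * B (s c))) +
        ∑ c ∈ C, (fun d => b (s d) * A d * (a' (s d) * B (s d) + b' (s d) * B d)) (s c) := by
          rw [← sum_add_distrib]
          refine sum_congr rfl fun c _ => ?_
          simp only [hss]
          ring
    _ = _ := by
      rw [e fun d => b (s d) * A d * (a' (s d) * B (s d) + b' (s d) * B d), ← sum_add_distrib]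
      refine sum_congr rfl fun c hc => ?_
      linear_combination A c * B c * h1 c hc + A c * B (s c) * h2 c hc

/-- The pairing is unchanged when two neighbouring variables are exchanged: the exchange matrices of
the two sides are inverse transpose to each other. -/
theorem pairing_swap (hq : ‖q‖ < 1) (hN : Nondeg q h μ lam) {V V' : Fin m → Finset ℂ}
    (hV : ∀ k, GoodSet q h (V k)) (hV' : ∀ k, GoodSet q h (V' k)) (hi : (i : ℕ) + 1 = i')
    {v : Fin n → ℂ} (hv : GoodOn q h univ v) :
    pairing q h μ lam V V' (v ∘ Equiv.swap i i') = pairing q h μ lam V V' v := by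
  classical
  have hne : i ≠ i' := by rintro rfl; omega
  have hi2 : ((i'.rev : Fin n) : ℕ) + 1 = i.rev := by
    rw [Fin.val_rev, Fin.val_rev]
    omega
  have hrev : ∀ {β : Type} (f : Fin n → β), (f ∘ Equiv.swap i i') ∘ Fin.revPerm =
      (f ∘ Fin.revPerm) ∘ Equiv.swap i'.rev i.rev := by
    intro β f
    funext x
    simp only [Function.comp_apply, Fin.revPerm_apply]
    congr 1
    rcases swap_cases i i' x.rev with ⟨h, h'⟩ | ⟨h, h'⟩ | ⟨h, h1, h'⟩ <;> rw [h']
    · rw [← Fin.rev_rev x, h, Equiv.swap_apply_right, Fin.rev_rev]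
    · rw [← Fin.rev_rev x, h, Equiv.swap_apply_left, Fin.rev_rev]
    · rw [Equiv.swap_apply_of_ne_of_ne]
      · rintro rfl; simp at h1
      · rintro rfl; simp at h
  unfold pairing
  set X := v i / v i' with hX
  have hX0 : X ≠ 0 := div_ne_zero (hv.1 _ (mem_univ _)) (hv.1 _ (mem_univ _))
  have hXi : v i' / v i = X⁻¹ := (inv_div _ _).symm
  have θhX : theta q (h * X) ≠ 0 := (hv.2 i (mem_univ _) i' (mem_univ _) hne).2
  have θhX' : theta q (h / X) ≠ 0 := by
    rw [div_eq_mul_inv, ← hXi]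
    exact (hv.2 i' (mem_univ _) i (mem_univ _) hne.symm).2
  have hC : ∀ {c : Fin n → Fin (m + 1)},
      c ∈ univ.filter (fun c : Fin n → Fin (m + 1) => HasContent c lam) ↔ HasContent c lam :=
    by simp
  rw [← sum_exchange (C := univ.filter (fun c : Fin n → Fin (m + 1) => HasContent c lam))
    (fun c => c ∘ Equiv.swap i i') (fun c hc => hC.2 ((hC.1 hc).swap i i'))
    (fun c => comp_swap_swap c) (fun c => gfun q h μ V c (Fin.last m) v)
    (fun c => gfun q h (tauμ h lam μ) V' (c ∘ Fin.revPerm) (Fin.last m) (v ∘ Fin.revPerm))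
    (fun c => rDiag q h (exDyn h μ c i i') X)
    (fun c => rDyn q h (c i) (c i') (exDyn h μ c i i') * rOff q h X)
    (fun c => rDiag q h (exDyn h μ c i i') X⁻¹)
    (fun c => rDyn q h (c i') (c i) (exDyn h μ c i i') * rOff q h X⁻¹)]
  · refine sum_congr rfl fun c hc => ?_
    rw [hC] at hc
    congr 1
    · exact exchange hq hN hV hi (Fin.last m) hc (by rw [lvl_last]; exact hv) (Fin.le_last _)
        (Fin.le_last _)
    · have := exchange hq hN.tau hV' hi2 (Fin.last m) (hc.comp_perm Fin.revPerm)
        (v := v ∘ Fin.revPerm) (by rw [lvl_last]; exact hv.comp_perm _) (Fin.le_last _)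
        (Fin.le_last _)
      unfold Exchange at this
      rw [← hrev, ← hrev, hN.exDyn_rev hc] at this
      simp only [Function.comp_apply, Fin.revPerm_apply, Fin.rev_rev, hXi] at this
      exact this
  · intro c hc
    rw [hC] at hc
    by_cases hcc : c i = c i'
    · simp only [comp_swap_of_eq hcc, hN.exDyn_of_eq hi hcc, hcc, rDyn_self]
      rw [rDiag_of_inv hN.theta_h θhX, rDiag_of_inv hN.theta_h (by rwa [← div_eq_mul_inv])]
      ring
    · have θw := hN.theta_exDyn_ne hc hi
      simp only [exDyn_swap hi h μ hcc, Function.comp_apply, Equiv.swap_apply_left,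
        Equiv.swap_apply_right]
      rw [rDyn_inv q h (c i)]
      rw [← rDiag_mul_rDiag hq hN.h_ne (hN.exDyn_ne c i i') hX0 θw θhX θhX'
        (rDyn_mul_rDyn hcc hN.theta_h θw)]
      ring
  · intro c hc
    rw [hC] at hc
    by_cases hcc : c i = c i'
    · simp only [comp_swap_of_eq hcc, hcc, rDyn_self]
      ring
    · simp only [exDyn_swap hi h μ hcc, Function.comp_apply, Equiv.swap_apply_left,
        Equiv.swap_apply_right]
      rw [rDyn_inv]
      have := rDiag_inv_mul_rOff q h (exDyn h μ c i i') X
      linear_combination rDyn q h (c i') (c i) (exDyn h μ c i i') * this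

/-- The pairing is a symmetric function of the variables. -/
theorem pairing_perm (hq : ‖q‖ < 1) (hN : Nondeg q h μ lam) {V V' : Fin m → Finset ℂ}
    (hV : ∀ k, GoodSet q h (V k)) (hV' : ∀ k, GoodSet q h (V' k)) {v : Fin n → ℂ}
    (hv : GoodOn q h univ v) (σ : Equiv.Perm (Fin n)) :
    pairing q h μ lam V V' (v ∘ σ) = pairing q h μ lam V V' v := by
  obtain - | n := n
  · rw [Subsingleton.elim σ 1]
    rfl
  have hσ : σ ∈ Submonoid.closure
      (Set.range fun i : Fin n => Equiv.swap i.castSucc i.succ) := by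
    rw [Equiv.Perm.mclosure_swap_castSucc_succ]
    trivial
  induction hσ using Submonoid.closure_induction generalizing v with
  | mem τ hτ =>
    obtain ⟨j, rfl⟩ := hτ
    exact pairing_swap hq hN hV hV' (by simp) hv
  | one => rfl
  | mul τ τ' _ _ ih ih' =>
    rw [Equiv.Perm.coe_mul, ← Function.comp_assoc, ih' (hv.comp_perm τ), ih hv]

theorem vals_comp_perm (c : Fin n → Fin (m + 1)) (v : Fin n → ℂ) (σ : Equiv.Perm (Fin n)) :
    vals (c ∘ σ) (v ∘ σ) = vals c v := by
  funext k
  ext x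
  rw [mem_vals, mem_vals]
  exact ⟨fun ⟨a, h1, h2⟩ => ⟨σ a, h1, h2⟩, fun ⟨a, h1, h2⟩ =>
    ⟨σ.symm a, by simpa using h1, by simpa using h2⟩⟩

theorem pairing_of_monotone (hN : Nondeg q h μ lam) {κ ℓ : Fin n → Fin (m + 1)}
    (hκ : HasContent κ lam) (hℓ : HasContent ℓ lam) (hmono : Monotone ℓ) {v : Fin n → ℂ}
    (hv : GoodOn q h univ v) : pairing q h μ lam (vals κ v) (vals ℓ v) v =
      if κ = ℓ then ∏ b, ∏ a with ℓ a < ℓ b,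
        theta q (v b / v a) * (theta q (v b / v a * h) / theta q h) else 0 := by
  classical
  have hanti : Antitone (ℓ ∘ Fin.revPerm) := fun a b hab =>
    hmono (Fin.rev_le_rev.2 hab)
  unfold pairing
  rw [sum_eq_single_of_mem ℓ (by simpa using hℓ)]
  · split_ifs with hκℓ
    · subst hκℓ
      rw [gfun_diag hN hκ hv, ← vals_comp_perm κ v Fin.revPerm,
        gfun_diag hN.tau (hκ.comp_perm _) (hv.comp_perm _)]
      rw [← Equiv.prod_comp Fin.revPerm (fun b => ∏ a with (κ ∘ Fin.revPerm) a <
        (κ ∘ Fin.revPerm) b, diagFactor q h (v ∘ Fin.revPerm) a b), ← prod_mul_distrib]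
      refine prod_congr rfl fun b _ => ?_
      have e : ∏ a with (κ ∘ Fin.revPerm) a < (κ ∘ Fin.revPerm) (Fin.revPerm b),
          diagFactor q h (v ∘ Fin.revPerm) a (Fin.revPerm b) =
          ∏ a with κ a < κ b, diagFactor q h (v ∘ Fin.revPerm) (Fin.revPerm a) (Fin.revPerm b) :=
        prod_equiv Fin.revPerm (by simp) (by simp)
      rw [e, ← prod_mul_distrib]
      refine prod_congr rfl fun a ha => ?_
      have hab : a < b := by
        by_contra hab
        exact (mem_filter.1 ha).2.not_ge (hmono (not_lt.1 hab))
      unfold diagFactor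
      simp only [Function.comp_apply, Fin.revPerm_apply, Fin.rev_rev, Fin.rev_lt_rev]
      rw [if_neg hab.not_gt, if_pos hab]
    · by_contra hne
      exact hκℓ (eq_of_gfun_ne_zero_left hℓ hκ hmono hv (left_ne_zero_of_mul hne)).symm
  · intro c hc hcℓ
    by_contra hne
    have h1 := right_ne_zero_of_mul hne
    rw [← vals_comp_perm ℓ v Fin.revPerm] at h1
    have h2 := eq_of_gfun_ne_zero_right ((mem_filter.1 hc).2.comp_perm _) (hℓ.comp_perm _) hanti
      (hv.comp_perm _) h1
    exact hcℓ (Fin.revPerm.surjective.injective_comp_right h2)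

/-- The pairing at the fixed points: it is moved by symmetry to the chamber in which `ℓ` is sorted,
where triangularity leaves a single term. -/
theorem pairing_vals (hq : ‖q‖ < 1) (hN : Nondeg q h μ lam) {κ ℓ : Fin n → Fin (m + 1)}
    (hκ : HasContent κ lam) (hℓ : HasContent ℓ lam) {v : Fin n → ℂ}
    (hv : GoodOn q h univ v) : pairing q h μ lam (vals κ v) (vals ℓ v) v =
      if κ = ℓ then ∏ b, ∏ a with ℓ a < ℓ b,
        theta q (v b / v a) * (theta q (v b / v a * h) / theta q h) else 0 := by
  have h1 := pairing_of_monotone hN (hκ.comp_perm (Tuple.sort ℓ)) (hℓ.comp_perm (Tuple.sort ℓ))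
    (Tuple.monotone_sort ℓ) (hv.comp_perm (Tuple.sort ℓ))
  rw [vals_comp_perm, vals_comp_perm,
    pairing_perm hq hN (hv.goodSet_vals κ) (hv.goodSet_vals ℓ) hv] at h1
  rw [h1]
  refine if_congr (Tuple.sort ℓ).surjective.injective_comp_right.eq_iff ?_ rfl
  refine Fintype.prod_equiv (Tuple.sort ℓ) _ _ fun b => ?_
  exact prod_equiv (Tuple.sort ℓ) (by simp) (by simp)

end Pairing

/-! ### Tuples of subsets as colourings -/

section Bridge

variable {m : ℕ} {lam : Fin (m + 1) → ℕ}

theorem FlagIndex.exists_mem (I : FlagIndex lam) (x : Fin (size lam)) : ∃ j, x ∈ I.1 j := by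
  have h1 : I.upTo (Fin.last m) = univ := by
    rw [← card_eq_iff_eq_univ, I.card_upTo, Fintype.card_fin]
  have h2 : x ∈ I.upTo (Fin.last m) := h1 ▸ mem_univ x
  obtain ⟨j, -, hj⟩ := mem_biUnion.1 h2
  exact ⟨j, hj⟩

/-- The colouring attached to `I`: the colour of a position is the index of the part containing
it. -/
def FlagIndex.col (I : FlagIndex lam) (x : Fin (size lam)) : Fin (m + 1) := (I.exists_mem x).choose

theorem FlagIndex.mem_iff (I : FlagIndex lam) {x : Fin (size lam)} {j : Fin (m + 1)} :
    x ∈ I.1 j ↔ I.col x = j := by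
  have h1 : x ∈ I.1 (I.col x) := (I.exists_mem x).choose_spec
  constructor
  · intro hx
    by_contra hne
    exact disjoint_left.1 (I.2.2 _ _ hne) h1 hx
  · rintro rfl
    exact h1

theorem FlagIndex.val_eq (I : FlagIndex lam) (j : Fin (m + 1)) :
    I.1 j = univ.filter fun x => I.col x = j := by
  ext x
  simp [I.mem_iff]

theorem FlagIndex.hasContent (I : FlagIndex lam) : HasContent I.col lam := fun j => by
  rw [← I.val_eq, I.2.1]

theorem FlagIndex.col_injective : Function.Injective (FlagIndex.col (lam := lam)) := by
  intro I J hIJ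
  refine Subtype.ext (funext fun j => ?_)
  rw [I.val_eq, J.val_eq, hIJ]

theorem FlagIndex.exists_col {c : Fin (size lam) → Fin (m + 1)} (hc : HasContent c lam) :
    ∃ I : FlagIndex lam, I.col = c := by
  refine ⟨⟨fun j => univ.filter fun x => c x = j, hc, fun i j hij => disjoint_left.2 ?_⟩, ?_⟩
  · intro x hx hx'
    exact hij ((mem_filter.1 hx).2.symm.trans (mem_filter.1 hx').2)
  · funext x
    exact (FlagIndex.mem_iff _).1 (by simp)

theorem FlagIndex.sum_col {M : Type*} [AddCommMonoid M] (F : (Fin (size lam) → Fin (m + 1)) → M)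
    [DecidablePred fun c : Fin (size lam) → Fin (m + 1) => HasContent c lam] :
    ∑ c : Fin (size lam) → Fin (m + 1) with HasContent c lam, F c =
      ∑ I : FlagIndex lam, F I.col := by
  symm
  refine sum_bij (fun I _ => I.col) (fun I _ => by simpa using I.hasContent)
    (fun I _ J _ hIJ => FlagIndex.col_injective hIJ) (fun c hc => ?_) fun _ _ => rfl
  obtain ⟨I, hI⟩ := FlagIndex.exists_col (mem_filter.1 hc).2
  exact ⟨I, mem_univ _, hI⟩

theorem FlagIndex.col_perm (I : FlagIndex lam) (σ : Equiv.Perm (Fin (size lam))) :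
    (I.perm σ⁻¹).col = I.col ∘ σ := by
  funext x
  refine (FlagIndex.mem_iff _).1 ?_
  have : σ x ∈ I.1 (I.col (σ x)) := I.mem_iff.2 rfl
  exact mem_map.2 ⟨σ x, this, by simp⟩

theorem FlagIndex.upTo_eq (I : FlagIndex lam) (k : Fin (m + 1)) : I.upTo k = lvl I.col k := by
  ext x
  simp [FlagIndex.upTo, mem_lvl, I.mem_iff]

theorem FlagIndex.part_eq (I : FlagIndex lam) (k : Fin (m + 1)) (a : Fin (psum lam k)) :
    I.part k a = I.col (I.elt k a) :=
  (I.mem_iff.1 (I.exists_part k a).choose_spec).symm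

theorem FlagIndex.pos_eq (I : FlagIndex lam) (j : Fin (m + 1)) (x : Fin (size lam)) :
    I.pos j x = cpos I.col j x := by
  unfold FlagIndex.pos cpos
  congr 1
  ext y
  simp [I.mem_iff, and_comm]

theorem FlagIndex.dim_eq (I : FlagIndex lam) : I.dim = (univ.filter
    fun ab : Fin (size lam) × Fin (size lam) => I.col ab.1 < I.col ab.2 ∧ ab.2 < ab.1).card := by
  unfold FlagIndex.dim
  congr 1
  ext ab
  simp only [I.mem_iff, mem_filter, mem_univ, true_and]
  constructor
  · rintro ⟨_, _, h1, rfl, rfl, h2⟩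
    exact ⟨h1, h2⟩
  · rintro ⟨h1, h2⟩
    exact ⟨_, _, h1, rfl, rfl, h2⟩

theorem FlagIndex.elt_strictMono (I : FlagIndex lam) (k : Fin (m + 1)) : StrictMono (I.elt k) :=
  (orderEmbOfFin _ _).strictMono

theorem FlagIndex.exists_elt (I : FlagIndex lam) {k : Fin (m + 1)} {x : Fin (size lam)} :
    (∃ a, I.elt k a = x) ↔ x ∈ lvl I.col k := by
  have := Finset.range_orderEmbOfFin (I.upTo k) (I.card_upTo k)
  rw [← I.upTo_eq, ← mem_coe, ← this]
  rfl

theorem FlagIndex.prod_elt (I : FlagIndex lam) (k : Fin (m + 1)) (F : Fin (size lam) → ℂ) :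
    ∏ x ∈ lvl I.col k, F x = ∏ a, F (I.elt k a) := by
  symm
  refine prod_bij (fun a _ => I.elt k a) (fun a _ => I.exists_elt.1 ⟨a, rfl⟩)
    (fun a _ b _ hab => (I.elt_strictMono k).injective hab) (fun x hx => ?_) fun _ _ => rfl
  obtain ⟨a, ha⟩ := I.exists_elt.2 hx
  exact ⟨a, mem_univ _, ha⟩

theorem FlagIndex.elt_last (I : FlagIndex lam) (a : Fin (size lam)) :
    I.elt (Fin.last m) a = a := by
  have h1 : I.upTo (Fin.last m) = univ := by rw [I.upTo_eq, lvl_last]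
  have h2 := orderEmbOfFin_unique (I.card_upTo (Fin.last m)) (f := id)
    (fun x => h1 ▸ mem_univ x) strictMono_id
  exact (congrFun h2 a).symm

/-! ### Symmetrizations as iterated sums -/

/-- Values `u` of the variables of level `k`, placed at the positions of the level. -/
def FlagIndex.place (I : FlagIndex lam) (k : Fin (m + 1)) (u : Fin (psum lam k) → ℂ) :
    Fin (size lam) → ℂ := Function.extend (I.elt k) u 0

theorem FlagIndex.place_elt (I : FlagIndex lam) (k : Fin (m + 1)) (u : Fin (psum lam k) → ℂ)
    (a : Fin (psum lam k)) : I.place k u (I.elt k a) = u a :=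
  (I.elt_strictMono k).injective.extend_apply _ _ _

theorem FlagIndex.place_last (I : FlagIndex lam) (z : Fin (size lam) → ℂ) :
    I.place (Fin.last m) z = z := by
  funext a
  have := I.place_elt (Fin.last m) z a
  rwa [I.elt_last] at this

theorem FlagIndex.psi_eq (I : FlagIndex lam) (q h : ℂ) (μ : Fin (m + 1) → ℂ) (k : Fin m)
    (a : Fin (psum lam k.castSucc)) (b : Fin (psum lam k.succ)) (x : ℂ) :
    psi q I h μ k a b x = psiC q h μ I.col k (I.elt k.castSucc a) (I.elt k.succ b) x := by
  unfold psi psiC dynArg dyn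
  simp only [I.part_eq, I.pos_eq]

theorem FlagIndex.kern_place (I : FlagIndex lam) (q h : ℂ) (μ : Fin (m + 1) → ℂ) (k : Fin m)
    (u : Fin (psum lam k.castSucc) → ℂ) (u' : Fin (psum lam k.succ) → ℂ) :
    kern q h μ I.col k (I.place _ u) (I.place _ u') =
      (∏ a : Fin (psum lam k.castSucc), ∏ b : Fin (psum lam k.succ),
          psi q I h μ k a b (u' b / u a)) *
        (∏ a : Fin (psum lam k.castSucc), ∏ b ∈ Ioi a, 1 / theta q (u b / u a)) *
        (∏ a : Fin (psum lam k.castSucc), ∏ b ∈ Iio a,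
          theta q h / theta q (h * u b / u a)) := by
  unfold kern
  simp only [I.prod_elt, I.place_elt, I.psi_eq]
  rw [mul_assoc]
  congr 1
  rw [← prod_mul_distrib]
  refine prod_congr rfl fun a _ => ?_
  rw [← filter_lt_eq_Ioi, ← filter_gt_eq_Iio, prod_filter, prod_filter, ← prod_mul_distrib]
  refine prod_congr rfl fun b _ => ?_
  unfold denC
  simp only [(I.elt_strictMono k.castSucc).lt_iff_lt]
  rcases lt_trichotomy a b with hab | rfl | hab
  · simp [hab, hab.not_gt]
  · simp
  · simp [hab, hab.not_gt]

theorem FlagIndex.sum_assign (I : FlagIndex lam) (k : Fin (m + 1)) {u : Fin (psum lam k) → ℂ}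
    (hu : Function.Injective u) {V : Finset ℂ} (hV : ∀ x, x ∈ V ↔ ∃ a, u a = x)
    (F : (Fin (size lam) → ℂ) → ℂ) :
    ∑ w ∈ assign V (lvl I.col k), F w =
      ∑ σ : Equiv.Perm (Fin (psum lam k)), F (I.place k (u ∘ σ)) := by
  symm
  refine sum_bij (fun σ _ => I.place k (u ∘ σ)) (fun σ _ => ?_) (fun σ _ τ _ hστ => ?_)
    (fun w hw => ?_) fun _ _ => rfl
  · refine mem_assign.2 ⟨⟨fun x hx => ?_, fun x hx y hy hxy => ?_, fun x hx => ?_⟩, fun x hx => ?_⟩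
    · obtain ⟨a, rfl⟩ := I.exists_elt.2 hx
      rw [I.place_elt]
      exact (hV _).2 ⟨_, rfl⟩
    · obtain ⟨a, rfl⟩ := I.exists_elt.2 hx
      obtain ⟨b, rfl⟩ := I.exists_elt.2 hy
      rw [I.place_elt, I.place_elt] at hxy
      rw [σ.injective (hu hxy)]
    · obtain ⟨a, rfl⟩ := (hV _).1 hx
      refine ⟨I.elt k (σ.symm a), I.exists_elt.1 ⟨_, rfl⟩, ?_⟩
      rw [I.place_elt, Function.comp_apply, Equiv.apply_symm_apply]
    · exact Function.extend_apply' _ _ _ fun hx' => hx (I.exists_elt.1 hx')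
  · ext1 a
    have := congrFun hστ (I.elt k a)
    rw [I.place_elt, I.place_elt] at this
    exact hu this
  · obtain ⟨hbij, hzero⟩ := mem_assign.1 hw
    have h1 : ∀ a, ∃ b, u b = w (I.elt k a) := fun a =>
      (hV _).1 (hbij.mapsTo (I.exists_elt.1 ⟨a, rfl⟩))
    choose g hg using h1
    have hinj : Function.Injective g := fun a b hab => by
      refine (I.elt_strictMono k).injective
        (hbij.injOn (I.exists_elt.1 ⟨a, rfl⟩) (I.exists_elt.1 ⟨b, rfl⟩) ?_)
      rw [← hg, ← hg, hab]
    refine ⟨Equiv.ofBijective g (Finite.injective_iff_bijective.1 hinj), mem_univ _, ?_⟩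
    funext x
    by_cases hx : x ∈ lvl I.col k
    · obtain ⟨a, rfl⟩ := I.exists_elt.2 hx
      rw [I.place_elt, ← hg]
      rfl
    · rw [hzero x hx]
      exact Function.extend_apply' _ _ _ fun hx' => hx (I.exists_elt.1 hx')

/-- The iterated sum of a chain of kernels `K k`, whose intermediate variables run over the
families `f k`, as a function of the variable at the end `k` of the chain. -/
def chain {m : ℕ} {β : Type} (P : Fin m → Type) [∀ k, Fintype (P k)] (f : ∀ k, P k → β)
    (K : Fin m → β → β → ℂ) (k : Fin (m + 1)) : β → ℂ :=
  Fin.induction (motive := fun _ => β → ℂ) (fun _ => 1)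
    (fun k G v => ∑ x : P k, G (f k x) * K k (f k x) v) k

theorem chain_succ {m : ℕ} {β : Type} (P : Fin m → Type) [∀ k, Fintype (P k)]
    (f : ∀ k, P k → β) (K : Fin m → β → β → ℂ) (k : Fin m) (v : β) :
    chain P f K k.succ v = ∑ x : P k, chain P f K k.castSucc (f k x) * K k (f k x) v := rfl

theorem chain_castSucc {m : ℕ} {β : Type} (P : Fin (m + 1) → Type) [∀ k, Fintype (P k)]
    (f : ∀ k, P k → β) (K : Fin (m + 1) → β → β → ℂ) (k : Fin (m + 1)) :
    chain P f K k.castSucc = chain (fun k : Fin m => P k.castSucc) (fun k => f k.castSucc)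
      (fun k => K k.castSucc) k := by
  induction k using Fin.induction with
  | zero => rfl
  | succ k ih =>
    funext v
    rw [chain_succ, ← Fin.succ_castSucc, chain_succ, ih]

/-- The iterated sum along the whole chain is the sum over all choices of the intermediate
variables. -/
theorem chain_last {m : ℕ} {β : Type} (P : Fin m → Type) [∀ k, Fintype (P k)]
    (f : ∀ k, P k → β) (K : Fin m → β → β → ℂ) (v : β) :
    chain P f K (Fin.last m) v = ∑ σ : ∀ k, P k, ∏ k : Fin m,
      K k (f k (σ k)) (Fin.snoc (α := fun _ => β) (fun k => f k (σ k)) v k.succ) := by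
  induction m generalizing v with
  | zero => simp; rfl
  | succ m ih =>
    rw [← Fin.succ_last, chain_succ, ← Equiv.sum_comp (Fin.snocEquiv P), Fintype.sum_prod_type]
    refine sum_congr rfl fun x _ => ?_
    rw [chain_castSucc, ih, sum_mul]
    refine sum_congr rfl fun σ _ => ?_
    rw [Fin.prod_univ_castSucc]
    simp only [Fin.snocEquiv, Equiv.coe_fn_mk, Fin.snoc_last, Fin.snoc_castSucc, Fin.succ_last]
    congr 1
    refine prod_congr rfl fun k _ => ?_
    congr 1
    have key : ∀ j : Fin (m + 1), Fin.snoc (α := fun _ => β) (fun k => f k.castSucc (σ k))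
        (f (Fin.last m) x) j = f j (Fin.snoc (α := P) σ x j) := by
      intro j
      induction j using Fin.lastCases with
      | last => rw [Fin.snoc_last, Fin.snoc_last]
      | cast j => rw [Fin.snoc_castSucc, Fin.snoc_castSucc]
    rw [Fin.succ_castSucc, Fin.snoc_castSucc, key]

/-! ### Weight functions at the fixed points -/

theorem FlagIndex.place_extendZ (I : FlagIndex lam) (t : TVar lam) (z : Fin (size lam) → ℂ)
    (k : Fin (m + 1)) : I.place k (extendZ t z k) =
      Fin.snoc (α := fun _ => Fin (size lam) → ℂ) (fun k => I.place k.castSucc (t k)) z k := by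
  unfold extendZ
  induction k using Fin.lastCases with
  | last => rw [Fin.snoc_last, Fin.lastCases_last, I.place_last]
  | cast k => rw [Fin.snoc_castSucc, Fin.lastCases_castSucc]

/-- The weight function as an iterated sum: symmetrizing over the variables of a level amounts to
summing over the assignments of their values to the positions of the level. -/
theorem weightW_eq (q h : ℂ) (μ : Fin (m + 1) → ℂ) (I : FlagIndex lam) (t : TVar lam)
    (z : Fin (size lam) → ℂ) (ht : ∀ k, Function.Injective (t k)) {V : Fin m → Finset ℂ}
    (hV : ∀ k x, x ∈ V k ↔ ∃ a, t k a = x) :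
    weightW q I t z h μ = thetaPrimeOne q ^ I.dim * gfun q h μ V I.col (Fin.last m) z := by
  have h1 : ∀ K : Fin (m + 1), gfun q h μ V I.col K =
      chain (fun k : Fin m => Equiv.Perm (Fin (psum lam k.castSucc)))
        (fun k σ => I.place k.castSucc (t k ∘ σ)) (kern q h μ I.col) K := by
    intro K
    induction K using Fin.induction with
    | zero => rfl
    | succ k ih =>
      funext v
      rw [gfun_succ, chain_succ, ih, I.sum_assign _ (ht k) (hV k)]
  rw [h1, chain_last, weightW, symLam, mul_sum]
  refine sum_congr rfl fun σ _ => ?_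
  unfold weightU
  congr 1
  refine prod_congr rfl fun k _ => ?_
  have := I.place_extendZ (fun k a => t k (σ k a)) z k.succ
  rw [← I.kern_place, this]
  rfl

theorem weightWPerm_eq (q h : ℂ) (μ : Fin (m + 1) → ℂ) (σ : Equiv.Perm (Fin (size lam)))
    (I K : FlagIndex lam) {z : Fin (size lam) → ℂ} (hz : Function.Injective z) :
    weightWPerm q σ I (fixedPt z K) z h μ = thetaPrimeOne q ^ (I.perm σ⁻¹).dim *
      gfun q h μ (vals K.col z) (I.col ∘ σ) (Fin.last m) (z ∘ σ) := by
  unfold weightWPerm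
  rw [weightW_eq q h μ _ _ _ (V := vals K.col z), I.col_perm]
  · rfl
  · exact fun k a b hab => (K.elt_strictMono _).injective (hz hab)
  · intro k x
    rw [mem_vals]
    constructor
    · rintro ⟨a, ha, rfl⟩
      obtain ⟨b, rfl⟩ := K.exists_elt.2 (mem_lvl.2 ha)
      exact ⟨b, rfl⟩
    · rintro ⟨a, rfl⟩
      exact ⟨K.elt k.castSucc a, mem_lvl.1 (K.exists_elt.1 ⟨a, rfl⟩), rfl⟩

/-! ### Counting pairs of positions -/

/-- Products over pairs of elements of distinct parts, in terms of the colouring. -/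
theorem FlagIndex.prod_lt {M : Type*} [CommMonoid M] (I : FlagIndex lam)
    (F : Fin (size lam) → Fin (size lam) → M) :
    ∏ k, ∏ l ∈ Ioi k, ∏ a ∈ I.1 k, ∏ b ∈ I.1 l, F a b =
      ∏ b, ∏ a with I.col a < I.col b, F a b := by
  have e : ∀ G : Fin (size lam) → M, ∏ k, ∏ a ∈ I.1 k, G a = ∏ a, G a := by
    intro G
    rw [← prod_fiberwise (s := univ) (g := I.col)]
    exact prod_congr rfl fun k _ => by rw [I.val_eq]
  calc _ = ∏ k, ∏ a ∈ I.1 k, ∏ l ∈ Ioi (I.col a), ∏ b ∈ I.1 l, F a b := by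
        refine prod_congr rfl fun k _ => ?_
        rw [prod_comm]
        exact prod_congr rfl fun a ha => by rw [I.mem_iff.1 ha]
    _ = ∏ a, ∏ b with I.col a < I.col b, F a b := by
        rw [e fun a => ∏ l ∈ Ioi (I.col a), ∏ b ∈ I.1 l, F a b]
        refine prod_congr rfl fun a _ => ?_
        rw [← prod_fiberwise_of_maps_to (t := Ioi (I.col a)) (g := I.col)
          fun b hb => mem_Ioi.2 (mem_filter.1 hb).2]
        refine prod_congr rfl fun l hl => prod_congr ?_ fun _ _ => rfl
        ext b
        simp only [I.mem_iff, mem_filter, mem_univ, true_and]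
        exact ⟨fun hb => ⟨hb ▸ mem_Ioi.1 hl, hb⟩, fun hb => hb.2⟩
    _ = _ := by
        simp only [prod_filter]
        exact prod_comm

theorem FlagIndex.prod_const_lt {M : Type*} [CommMonoid M] (I : FlagIndex lam) (x : M) :
    ∏ b, ∏ a with I.col a < I.col b, x = x ^ dimLam lam := by
  rw [← I.prod_lt fun _ _ => x]
  simp only [prod_const, I.2.1, dimLam, ← prod_pow_eq_pow_sum, ← pow_mul, mul_comm]

theorem FlagIndex.card_lt (I : FlagIndex lam) : (univ.filter
    fun ab : Fin (size lam) × Fin (size lam) => I.col ab.1 < I.col ab.2).card = dimLam lam := by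
  refine Nat.pow_right_injective le_rfl ?_
  change 2 ^ _ = 2 ^ _
  rw [← I.prod_const_lt, ← prod_const, prod_filter, Fintype.prod_prod_type_right]
  simp only [prod_filter]

theorem FlagIndex.dim_add_dim_rev (I : FlagIndex lam) :
    I.dim + (I.perm (longest lam)⁻¹).dim = dimLam lam := by
  rw [← I.card_lt, I.dim_eq, FlagIndex.dim_eq, I.col_perm]
  have e : (univ.filter fun ab : Fin (size lam) × Fin (size lam) =>
      (I.col ∘ longest lam) ab.1 < (I.col ∘ longest lam) ab.2 ∧ ab.2 < ab.1).card =
      (univ.filter fun ab : Fin (size lam) × Fin (size lam) =>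
        I.col ab.1 < I.col ab.2 ∧ ab.1 < ab.2).card := by
    refine card_equiv ((longest lam).prodCongr (longest lam)) fun ab => ?_
    simp [longest]
  rw [e, ← card_union_of_disjoint]
  · congr 1
    ext ab
    simp only [mem_union, mem_filter, mem_univ, true_and, ← and_or_left, and_iff_left_iff_imp]
    intro hab
    exact (lt_or_gt_of_ne fun e => hab.ne (by rw [e])).symm
  · rw [disjoint_left]
    intro ab hab hab'
    exact lt_asymm (mem_filter.1 hab).2.2 (mem_filter.1 hab').2.2

end Bridge

/-! ### Orthogonality -/

section Orthogonality

variable {m : ℕ} {lam : Fin (m + 1) → ℕ} {q h : ℂ} {μ : Fin (m + 1) → ℂ}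
  {z : Fin (size lam) → ℂ}

theorem denomR_mul_denomQ (q h : ℂ) (z : Fin (size lam) → ℂ) (L : FlagIndex lam) :
    denomR q z L * denomQ q z h L =
      ∏ b, ∏ a with L.col a < L.col b, theta q (z b / z a) * theta q (h * z b / z a) := by
  unfold denomR denomQ
  rw [L.prod_lt, L.prod_lt, ← prod_mul_distrib]
  exact prod_congr rfl fun b _ => prod_mul_distrib.symm

theorem denomR_mul_denomQ_ne_zero (hv : GoodOn q h univ z) (L : FlagIndex lam) :
    denomR q z L * denomQ q z h L ≠ 0 := by
  rw [denomR_mul_denomQ]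
  refine prod_ne_zero_iff.2 fun b _ => prod_ne_zero_iff.2 fun a ha => ?_
  have hab : b ≠ a := by
    rintro rfl
    exact lt_irrefl _ (mem_filter.1 ha).2
  obtain ⟨h1, h2⟩ := hv.2 b (mem_univ _) a (mem_univ _) hab
  exact mul_ne_zero h1 (by rwa [mul_div_assoc])

/-- The values at the fixed points of the weight functions for the identity form a matrix whose
right inverse is made of the values of the weight functions for the longest permutation. -/
theorem sum_gfun_mul_gfun (hq : ‖q‖ < 1) (hN : Nondeg q h μ lam) (hv : GoodOn q h univ z)
    (K L : FlagIndex lam) :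
    ∑ I : FlagIndex lam, gfun q h μ (vals K.col z) I.col (Fin.last m) z *
      (gfun q h (tauμ h lam μ) (vals L.col z) (I.col ∘ Fin.revPerm) (Fin.last m)
        (z ∘ Fin.revPerm) * (theta q h ^ dimLam lam / (denomR q z L * denomQ q z h L))) =
      if K = L then 1 else 0 := by
  classical
  have h1 := pairing_vals hq hN K.hasContent L.hasContent hv
  unfold pairing at h1
  rw [FlagIndex.sum_col] at h1
  simp only [← mul_assoc]
  rw [← sum_mul, h1]
  by_cases hKL : K = L
  · rw [if_pos hKL, if_pos (congrArg _ hKL)]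
    have e : ∏ b, ∏ a with L.col a < L.col b,
        theta q (z b / z a) * (theta q (z b / z a * h) / theta q h) =
        denomR q z L * denomQ q z h L * (theta q h)⁻¹ ^ dimLam lam := by
      rw [denomR_mul_denomQ, ← L.prod_const_lt, ← prod_mul_distrib]
      refine prod_congr rfl fun b _ => ?_
      rw [← prod_mul_distrib]
      refine prod_congr rfl fun a _ => ?_
      rw [mul_comm (z b / z a) h, ← mul_div_assoc h, div_eq_mul_inv (theta q _), mul_assoc]
    have hne := denomR_mul_denomQ_ne_zero hv L
    have hθ := pow_ne_zero (dimLam lam) hN.theta_h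
    rw [e, inv_pow]
    generalize denomR q z L * denomQ q z h L = D at *
    field_simp
  · rw [if_neg hKL, if_neg fun e => hKL (FlagIndex.col_injective e), zero_mul]

/-- The matrix relation of `sum_gfun_mul_gfun` in the other order, in which the sum runs over the
fixed points. -/
theorem sum_gfun_mul_gfun_comm (hq : ‖q‖ < 1) (hN : Nondeg q h μ lam) (hv : GoodOn q h univ z)
    (I J : FlagIndex lam) :
    ∑ L : FlagIndex lam, (gfun q h (tauμ h lam μ) (vals L.col z) (J.col ∘ Fin.revPerm) (Fin.last m)
        (z ∘ Fin.revPerm) * (theta q h ^ dimLam lam / (denomR q z L * denomQ q z h L))) *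
      gfun q h μ (vals L.col z) I.col (Fin.last m) z = if I = J then 1 else 0 := by
  have h1 : (Matrix.of fun K I : FlagIndex lam => gfun q h μ (vals K.col z) I.col (Fin.last m) z) *
      (Matrix.of fun J L : FlagIndex lam =>
        gfun q h (tauμ h lam μ) (vals L.col z) (J.col ∘ Fin.revPerm) (Fin.last m)
        (z ∘ Fin.revPerm) * (theta q h ^ dimLam lam / (denomR q z L * denomQ q z h L))) = 1 := by
    ext K L
    rw [Matrix.mul_apply, Matrix.one_apply, ← sum_gfun_mul_gfun hq hN hv K L]
    rfl
  have h2 := congrFun (congrFun (mul_eq_one_comm.1 h1 :) J) I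
  rw [Matrix.mul_apply, Matrix.one_apply] at h2
  simp only [eq_comm (a := I)]
  exact h2

end Orthogonality

end EllipticOrth

end

theorem mainTheorem2 (q : ℂ) (hq : ‖q‖ < 1) (m : ℕ) (lam : Fin (m + 1) → ℕ)
    (z : Fin (EllipticOrth.size lam) → ℂ) (h : ℂ) (μ : Fin (m + 1) → ℂ)
    (hz : ∀ a, z a ≠ 0) (hh : h ≠ 0) (hμ : ∀ j, μ j ≠ 0)
    (hθh : EllipticOrth.theta q h ≠ 0)
    (hθz : ∀ a b, a ≠ b → EllipticOrth.theta q (z b / z a) ≠ 0)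
    (hθhz : ∀ a b, a ≠ b → EllipticOrth.theta q (h * z b / z a) ≠ 0)
    (hθμ : ∀ j k, j < k → lam j ≠ 0 → ∀ e : ℤ, -(lam k : ℤ) ≤ e → e ≤ (lam j : ℤ) →
      EllipticOrth.theta q (μ k / μ j * h ^ e) ≠ 0)
    (I J : EllipticOrth.FlagIndex lam) :
    EllipticOrth.innerE q z h
      (fun t => EllipticOrth.weightWPerm q 1 I t z h μ)
      (fun t => (EllipticOrth.theta q h / EllipticOrth.thetaPrimeOne q) ^ EllipticOrth.dimLam lam *
        EllipticOrth.tau (EllipticOrth.weightWPerm q (EllipticOrth.longest lam) J) t z h μ)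
      = if I = J then 1 else 0 := by
  open EllipticOrth in
  have hN : Nondeg q h μ lam := ⟨hh, hμ, hθh, hθμ⟩
  have hv : GoodOn q h univ z := ⟨fun a _ => hz a, fun a _ b _ hab =>
    ⟨hθz b a hab.symm, by rw [← mul_div_assoc]; exact hθhz b a hab.symm⟩⟩
  have hθ' := thetaPrimeOne_ne_zero hq
  have hperm : I.perm 1⁻¹ = I := FlagIndex.col_injective (by rw [I.col_perm]; rfl)
  have hterm : ∀ L : FlagIndex lam,
      weightWPerm q 1 I (fixedPt z L) z h μ *
        ((theta q h / thetaPrimeOne q) ^ dimLam lam *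
          tau (weightWPerm q (longest lam) J) (fixedPt z L) z h μ) /
            (denomR q z L * denomQ q z h L) =
      thetaPrimeOne q ^ I.dim * thetaPrimeOne q ^ (J.perm (longest lam)⁻¹).dim /
          thetaPrimeOne q ^ dimLam lam *
        ((gfun q h (tauμ h lam μ) (vals L.col z) (J.col ∘ Fin.revPerm) (Fin.last m)
          (z ∘ Fin.revPerm) * (theta q h ^ dimLam lam / (denomR q z L * denomQ q z h L))) *
            gfun q h μ (vals L.col z) I.col (Fin.last m) z) := by
    intro L
    have e1 := weightWPerm_eq q h μ 1 I L hv.injective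
    have e2 : tau (weightWPerm q (longest lam) J) (fixedPt z L) z h μ =
        thetaPrimeOne q ^ (J.perm (longest lam)⁻¹).dim *
          gfun q h (tauμ h lam μ) (vals L.col z) (J.col ∘ Fin.revPerm) (Fin.last m)
            (z ∘ Fin.revPerm) :=
      weightWPerm_eq q h (tauμ h lam μ) (longest lam) J L hv.injective
    rw [hperm, Equiv.Perm.coe_one, Function.comp_id, Function.comp_id] at e1
    rw [e1, e2, div_pow]
    ring
  unfold innerE
  rw [sum_congr rfl fun L _ => hterm L, ← mul_sum, sum_gfun_mul_gfun_comm hq hN hv]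
  by_cases hIJ : I = J
  · rw [if_pos hIJ, mul_one, ← hIJ, ← pow_add, I.dim_add_dim_rev, div_self (pow_ne_zero _ hθ')]
  · rw [if_neg hIJ, mul_zero]
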